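/- Let $N\ge 3$ and $0\le\alpha<\beta\le 1$, and let $B_\beta\setminus B_\alpha=\{x\in\mathbb{R}^N:\alpha<|x|<\beta\}$, with the convention $B_\beta\setminus B_0=B_\beta$. Let $$\mathcal{C}_{+}=\{u\in H^1_{rad}(B_\beta\setminus B_\alpha):\ u\ge 0,\ u(r)\le u(s)\text{ for all }\alpha<r\le s\le\beta\}$$ be the cone of nonnegative, radially nondecreasing $H^1$ functions (identified with their representatives continuous on $[\alpha,\beta]$) and, for $p>1$, $$c_{p,+}(\alpha,\beta)=\inf\left\{\frac{\|u\|_{H^1}^2}{\|u\|_{p+1}^2}:\ u\in\mathcal{C}_{+},\ u\not\equiv0,\ \|u\|_\infty<\sqrt e+1\right\},$$ where $\|u\|_{H^1}^2=\int_{B_\beta\setminus B_\alpha}(|\nabla u|^2+u^2)\,dx$ and $\|u\|_{p+1}$ is the norm of $L^{p+1}(B_\beta\setminus B_\alpha)$. There exists $p_0=p_0(N,\alpha,\beta)>1$ such that for every $p>p_0$ the following holds. There is a function $u_{p,+}\in\mathcal{C}_{+}$, strictly increasing on $[\alpha,\beta]$, which is a classical solution of $$-\Delta u+u=u^p\ \text{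 in }B_\beta\setminus B_\alpha,\qquad \partial_\nu u=0\ \text{ on }\partial(B_\beta\setminus B_\alpha),$$ and a positive multiple of which achieves $c_{p,+}(\alpha,\beta)$. It is the only solution in $\mathcal{C}_{+}$ with a positive multiple achieving $c_{p,+}(\alpha,\beta)$, and the functions that achieve $c_{p,+}(\alpha,\beta)$ are exactly the multiples $t\,u_{p,+}$ with $t>0$ and $\|t\,u_{p,+}\|_\infty<\sqrt e+1$. -/

import Mathlib

open MeasureTheory Set
open scoped ContDiff Laplacian

noncomputable section

namespace NeumannLayer

/-- The space `ℝ^N` with its Euclidean norm. -/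
abbrev Space (N : ℕ) : Type := EuclideanSpace ℝ (Fin N)

/-- The domain `B_β \ B_α = {x : α < |x| < β}`, with the convention `B_β \ B_0 = B_β`. -/
def shell (N : ℕ) (α β : ℝ) : Set (Space N) :=
  if α = 0 then Metric.ball 0 β else {x | α < ‖x‖ ∧ ‖x‖ < β}

/-- The radial function `x ↦ u(|x|)` on `ℝ^N` with profile `u`. -/
def radial (N : ℕ) (u : ℝ → ℝ) : Space N → ℝ := fun x => u ‖x‖

/-- `g ∈ L²(Ω; ℝ^N)` is a weak gradient of `f` on the open set `Ω`:
`∫_Ω f ∂_v φ = - ∫_Ω ⟨g, v⟩ φ` for every `φ ∈ C_c^∞(Ω)` and every direction `v`. -/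
structure IsWeakGradient {N : ℕ} (Ω : Set (Space N)) (f : Space N → ℝ)
    (g : Space N → Space N) : Prop where
  memLp : MemLp g 2 (volume.restrict Ω)
  integral_eq : ∀ φ : Space N → ℝ, ContDiff ℝ ∞ φ → HasCompactSupport φ → tsupport φ ⊆ Ω →
    ∀ v : Space N,
      ∫ x in Ω, f x * fderiv ℝ φ x v = - ∫ x in Ω, inner ℝ (g x) v * φ x

/-- `f ∈ H¹(Ω)`: `f ∈ L²(Ω)` and `f` has a weak gradient in `L²(Ω)`. -/
def MemH1 {N : ℕ} (Ω : Set (Space N)) (f : Space N → ℝ) : Prop :=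
  MemLp f 2 (volume.restrict Ω) ∧ ∃ g, IsWeakGradient Ω f g

open Classical in
/-- The weak gradient of `f` on `Ω` (determined almost everywhere in `Ω`); `0` if there is none. -/
def weakGradient {N : ℕ} (Ω : Set (Space N)) (f : Space N → ℝ) : Space N → Space N :=
  if h : ∃ g, IsWeakGradient Ω f g then h.choose else 0

/-- `‖f‖²_{H¹(Ω)} = ∫_Ω (|∇f|² + f²) dx`. -/
def h1NormSq {N : ℕ} (Ω : Set (Space N)) (f : Space N → ℝ) : ℝ :=
  ∫ x in Ω, (‖weakGradient Ω f x‖ ^ 2 + f x ^ 2)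

/-- `‖f‖_{L^q(Ω)} = (∫_Ω |f|^q dx)^{1/q}`, for finite `q`. -/
def lqNorm {N : ℕ} (q : ℝ) (Ω : Set (Space N)) (f : Space N → ℝ) : ℝ :=
  (∫ x in Ω, |f x| ^ q) ^ (1 / q)

/-- The cone `𝒞₊` of nonnegative, radially nondecreasing functions in `H¹_rad(B_β \ B_α)`.
A radial function is given by its profile on `[α, β]`, and the profile is the representative that is
continuous on `[α, β]`; hence equality of elements of the cone is equality of the profiles on
`[α, β]`. -/
structure MemCone (N : ℕ) (α β : ℝ) (u : ℝ → ℝ) : Prop where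
  continuousOn : ContinuousOn u (Icc α β)
  memH1 : MemH1 (shell N α β) (radial N u)
  nonneg : ∀ r ∈ Icc α β, 0 ≤ u r
  monotoneOn : MonotoneOn u (Icc α β)

/-- The quotient `Q_p(u) = ‖u‖²_{H¹} / ‖u‖²_{p+1}` on `B_β \ B_α`. -/
def Q (N : ℕ) (p α β : ℝ) (u : ℝ → ℝ) : ℝ :=
  h1NormSq (shell N α β) (radial N u) / lqNorm (p + 1) (shell N α β) (radial N u) ^ 2

/-- The competitors: `u ∈ 𝒞₊`, `u ≢ 0` (so that `Q_p(u)` makes sense), `‖u‖_∞ < √e + 1`. -/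
structure Admissible (N : ℕ) (α β : ℝ) (u : ℝ → ℝ) : Prop where
  memCone : MemCone N α β u
  ne_zero : ∃ r ∈ Icc α β, u r ≠ 0
  bound : eLpNorm (radial N u) ⊤ (volume.restrict (shell N α β)) <
    ENNReal.ofReal (√(Real.exp 1) + 1)

/-- The infimum `c_{p,+}(α, β)` of `Q_p` over the competitors. -/
def cPlus (N : ℕ) (p α β : ℝ) : ℝ :=
  sInf (Q N p α β '' {u | Admissible N α β u})

/-- `w` achieves `c_{p,+}(α, β)`. -/
def Achieves (N : ℕ) (p α β : ℝ) (w : ℝ → ℝ) : Prop :=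
  Admissible N α β w ∧ Q N p α β w = cPlus N p α β

/-- The radial function with profile `u` is a classical solution of
`-Δu + u = u^p` in `B_β \ B_α`, `∂_ν u = 0` on `∂(B_β \ B_α)`.
For `α = 0` the condition `u'(0) = 0` expresses regularity at the origin. -/
structure IsNeumannSolution (N : ℕ) (p α β : ℝ) (u : ℝ → ℝ) : Prop where
  contDiffOn_profile : ContDiffOn ℝ 2 u (Icc α β)
  contDiffOn : ContDiffOn ℝ 2 (radial N u) (shell N α β)
  equation : ∀ x ∈ shell N α β,
    - (Δ (radial N u)) x + radial N u x = radial N u x ^ p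
  neumann_left : derivWithin u (Icc α β) α = 0
  neumann_right : derivWithin u (Icc α β) β = 0

/-- The properties that define `u_{p,+}(·; α, β)`: it belongs to `𝒞₊`, it solves the Neumann
problem, and a positive multiple of it achieves `c_{p,+}(α, β)`. -/
structure IsUPlus (N : ℕ) (p α β : ℝ) (u : ℝ → ℝ) : Prop where
  memCone : MemCone N α β u
  solution : IsNeumannSolution N p α β u
  achieves : ∃ t : ℝ, 0 < t ∧ Achieves N p α β (fun r => t * u r)

end NeumannLayer

end

noncomputable section

open Filter Topology Metric
open scoped Convolution

namespace NeumannLayer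


/-! ### The shell -/

section Shell

variable {N : ℕ} {α β : ℝ}

/-! The quotient is homogeneous of degree zero, so the bound `√e + 1` on the sup norm only restricts
which multiples are admitted. The task is to minimise `Q` over the nonzero part of the cone and to
show that, for large `p`, there is only one minimising ray.

Radial problems are written as first-order systems for a profile `u` and its flux `k = r^(N-1) u'`:
the equation `-Δu + u = f` becomes `k' = r^(N-1) (u - f)`, and the Neumann condition becomes `k = 0`
at both ends.

Existence rests on the inverse iteration `v ↦ w = (-Δ + 1)⁻¹ v^p`. It preserves the cone
(`RadialNeumann.flux_nonneg`). Green's formula with Cauchy–Schwarz and Hölder shows that it does not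
increase `Q`, and that `v` is a multiple of `w` if `Q` stays the same (`Q_inverse_iteration`).
Images normalised to have maximum `1` are 1-Lipschitz, so compactness gives a minimizer
(`exists_minimizer`). Being a multiple of its own image, a minimizer solves the nonlinear problem
after rescaling (`solution_of_minimizer`), and no variational inequality on the cone has to be
analysed.

A profile slightly below the constant `1` has smaller energy. This keeps a minimizing solution at or
below `1 - η` at the inner boundary, with `η` independent of large `p` (`exists_margin`). Such a
solution is strictly increasing, crosses the level `1` with flux bounded below, and has a maximum
tending to `1`, because `u(β)^(p+1)` is at most a constant times `p + 1`.

Uniqueness (`eventually_layerSolution_unique`) compares two such solutions. If `u₁(β) > u₂(β)`, a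
Wronskian argument produces a last crossing, where `k₁ > k₂`. Below the level `1 - ε` the function
`t - t^p` is increasing, so `u₁ ≤ u₂` at some radius forces `k₁ ≤ k₂` there
(`LayerSolution.flux_le_of_le`); a crossing at such a level is impossible. A higher crossing lies
between the levels `1 - ε` and `1 + ε`. Using the level instead of the radius as independent
variable, a short-interval stability estimate carries the strict flux ordering down to `1 - ε`
(`LayerSolution.exists_flux_lt_at_level`), with the same contradiction. Hence the outer values
agree, and backward ODE uniqueness identifies the solutions. -/

lemma isOpen_shell : IsOpen (shell N α β) := by
  unfold shell
  split_ifs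
  · exact isOpen_ball
  · exact (isOpen_lt continuous_const continuous_norm).inter
      (isOpen_lt continuous_norm continuous_const)

lemma measurableSet_shell : MeasurableSet (shell N α β) := isOpen_shell.measurableSet

lemma norm_lt_of_mem_shell {x : Space N} (hx : x ∈ shell N α β) : ‖x‖ < β := by
  unfold shell at hx
  split_ifs at hx
  · simpa using hx
  · exact hx.2

lemma lt_norm_of_mem_shell {x : Space N} (hx : x ∈ shell N α β) (h0 : x ≠ 0) : α < ‖x‖ := by
  unfold shell at hx
  split_ifs at hx with h
  · rw [h]; exact norm_pos_iff.2 h0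
  · exact hx.1

lemma le_norm_of_mem_shell {x : Space N} (hx : x ∈ shell N α β) : α ≤ ‖x‖ := by
  unfold shell at hx
  split_ifs at hx with h
  · rw [h]; exact norm_nonneg x
  · exact hx.1.le

lemma norm_mem_Icc {x : Space N} (hx : x ∈ shell N α β) : ‖x‖ ∈ Icc α β :=
  ⟨le_norm_of_mem_shell hx, (norm_lt_of_mem_shell hx).le⟩

lemma eq_zero_of_zero_mem_shell (hα : 0 ≤ α) (h : (0 : Space N) ∈ shell N α β) : α = 0 := by
  have := le_norm_of_mem_shell h
  rw [norm_zero] at this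
  exact le_antisymm this hα

lemma mem_shell {x : Space N} (h1 : α < ‖x‖) (h2 : ‖x‖ < β) : x ∈ shell N α β := by
  unfold shell
  split_ifs
  · simpa using h2
  · exact ⟨h1, h2⟩

lemma shell_subset_ball : shell N α β ⊆ ball 0 β := fun x hx => by
  simpa using norm_lt_of_mem_shell hx

lemma volume_shell_lt_top : volume (shell N α β) < ⊤ :=
  (measure_mono shell_subset_ball).trans_lt measure_ball_lt_top

instance : IsFiniteMeasure (volume.restrict (shell N α β)) :=
  ⟨by simpa using volume_shell_lt_top⟩

lemma exists_norm_eq (hN : 3 ≤ N) {r : ℝ} (hr : 0 ≤ r) : ∃ x : Space N, ‖x‖ = r :=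
  ⟨EuclideanSpace.single ⟨0, by omega⟩ r, by simp [abs_of_nonneg hr]⟩

/-- Functions which agree almost everywhere on the shell, and whose profiles are continuous, have
the same profile. -/
lemma eqOn_Icc_of_ae_eq (hN : 3 ≤ N) (hα : 0 ≤ α) (hαβ : α < β) {u v : ℝ → ℝ}
    (hu : ContinuousOn u (Icc α β)) (hv : ContinuousOn v (Icc α β))
    (h : ∀ᵐ x ∂(volume.restrict (shell N α β)), radial N u x = radial N v x) :
    EqOn u v (Icc α β) := by
  have hn : ContinuousOn (fun x : Space N => ‖x‖) (shell N α β) := continuous_norm.continuousOn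
  have h1 : EqOn (radial N u) (radial N v) (shell N α β) := by
    apply Measure.eqOn_open_of_ae_eq (μ := volume) h isOpen_shell
    · exact hu.comp hn fun x hx => norm_mem_Icc hx
    · exact hv.comp hn fun x hx => norm_mem_Icc hx
  have h2 : EqOn u v (Ioo α β) := by
    intro r hr
    obtain ⟨x, hx⟩ := exists_norm_eq hN (hα.trans hr.1.le)
    have := h1 (mem_shell (by rw [hx]; exact hr.1) (by rw [hx]; exact hr.2) : x ∈ shell N α β)
    simpa [radial, hx] using this
  exact h2.of_subset_closure hu hv Ioo_subset_Icc_self (by rw [closure_Ioo hαβ.ne])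

lemma continuousOn_radial {u : ℝ → ℝ} (hu : ContinuousOn u (Icc α β)) :
    ContinuousOn (radial N u) (shell N α β) :=
  hu.comp continuous_norm.continuousOn fun _ hx => norm_mem_Icc hx

lemma exists_bound_radial {u : ℝ → ℝ} (hu : ContinuousOn u (Icc α β)) :
    ∃ C, ∀ x ∈ shell N α β, ‖radial N u x‖ ≤ C := by
  obtain ⟨C, hC⟩ := isCompact_Icc.exists_bound_of_continuousOn hu
  exact ⟨C, fun x hx => hC _ (norm_mem_Icc hx)⟩

lemma memLp_of_bound {F : Type*} [NormedAddCommGroup F] {f : Space N → F}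
    (hf : ContinuousOn f (shell N α β)) {C : ℝ} (hC : ∀ x ∈ shell N α β, ‖f x‖ ≤ C) (q : ENNReal) :
    MemLp f q (volume.restrict (shell N α β)) :=
  MemLp.of_bound (hf.aestronglyMeasurable measurableSet_shell) C
    ((ae_restrict_iff' measurableSet_shell).2 (.of_forall hC))

lemma memLp_radial {u : ℝ → ℝ} (hu : ContinuousOn u (Icc α β)) (q : ENNReal) :
    MemLp (radial N u) q (volume.restrict (shell N α β)) := by
  obtain ⟨C, hC⟩ := exists_bound_radial (N := N) hu
  exact memLp_of_bound (continuousOn_radial hu) hC q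

lemma integrable_radial {u : ℝ → ℝ} (hu : ContinuousOn u (Icc α β)) :
    Integrable (radial N u) (volume.restrict (shell N α β)) :=
  memLp_one_iff_integrable.1 (memLp_radial hu 1)

end Shell

/-! ### Weak gradients -/

section WeakGradient

variable {N : ℕ} {Ω : Set (Space N)} {f f' : Space N → ℝ} {g g' : Space N → Space N}

lemma IsWeakGradient.congr (h : IsWeakGradient Ω f g) (hΩ : MeasurableSet Ω) (hf : EqOn f f' Ω) :
    IsWeakGradient Ω f' g where
  memLp := h.memLp
  integral_eq φ h1 h2 h3 v := by
    rw [← h.integral_eq φ h1 h2 h3 v]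
    exact setIntegral_congr_fun hΩ fun x hx => by simp only [hf hx]

lemma IsWeakGradient.const_mul (h : IsWeakGradient Ω f g) (c : ℝ) :
    IsWeakGradient Ω (fun x => c * f x) (fun x => c • g x) where
  memLp := h.memLp.const_smul c
  integral_eq φ h1 h2 h3 v := by
    simp only [real_inner_smul_left, mul_assoc, integral_const_mul, h.integral_eq φ h1 h2 h3 v]
    ring

/-- Every coordinate of the difference of two weak gradients integrates to zero against all test
functions, so the fundamental lemma of the calculus of variations applies coordinatewise. -/
lemma IsWeakGradient.ae_eq (hΩ : IsOpen Ω) (h : IsWeakGradient Ω f g) (h' : IsWeakGradient Ω f g') :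
    g =ᵐ[volume.restrict Ω] g' := by
  have key : ∀ i : Fin N, ∀ᵐ x ∂(volume : Measure (Space N)),
      x ∈ Ω → inner ℝ (g x - g' x) (EuclideanSpace.single i (1 : ℝ)) = 0 := by
    intro i
    set e : Space N := EuclideanSpace.single i (1 : ℝ)
    have hm : MemLp (fun x => inner ℝ (g x - g' x) e) 2 (volume.restrict Ω) :=
      (h.memLp.sub h'.memLp).inner_const e
    apply hΩ.ae_eq_zero_of_integral_contDiff_smul_eq_zero
    · intro x hx
      obtain ⟨ε, hε, hb⟩ := Metric.isOpen_iff.1 hΩ x hx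
      refine ⟨ball x ε, mem_nhdsWithin_of_mem_nhds (ball_mem_nhds x hε), ?_⟩
      have hloc : MemLp (fun x => inner ℝ (g x - g' x) e) 2 (volume.restrict (ball x ε)) :=
        hm.mono_measure (Measure.restrict_mono hb le_rfl)
      have : IsFiniteMeasure (volume.restrict (ball x ε)) :=
        ⟨by simpa using measure_ball_lt_top⟩
      exact MemLp.integrable (by norm_num) hloc
    · intro φ h1 h2 h3
      have e1 := h.integral_eq φ h1 h2 h3 e
      have e2 := h'.integral_eq φ h1 h2 h3 e
      have hφ : MemLp φ 2 (volume.restrict Ω) :=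
        (h1.continuous.memLp_of_hasCompactSupport h2).mono_measure Measure.restrict_le_self
      have i1 : Integrable (fun x => inner ℝ (g x) e * φ x) (volume.restrict Ω) :=
        (h.memLp.inner_const e).integrable_mul hφ
      have i2 : Integrable (fun x => inner ℝ (g' x) e * φ x) (volume.restrict Ω) :=
        (h'.memLp.inner_const e).integrable_mul hφ
      have e3 : ∫ x in Ω, φ x • inner ℝ (g x - g' x) e = 0 := by
        have : ∀ x, φ x • inner ℝ (g x - g' x) e
            = inner ℝ (g x) e * φ x - inner ℝ (g' x) e * φ x := by
          intro x; rw [inner_sub_left, smul_eq_mul]; ring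
        simp_rw [this]
        rw [integral_sub i1 i2]
        linarith
      rw [← e3, setIntegral_eq_integral_of_forall_compl_eq_zero]
      intro x hx
      rw [image_eq_zero_of_notMem_tsupport fun hx' => hx (h3 hx'), zero_smul]
  have := ae_all_iff.2 key
  rw [EventuallyEq, ae_restrict_iff' hΩ.measurableSet]
  filter_upwards [this] with x hx hxΩ
  rw [← sub_eq_zero]
  ext i
  have := hx i hxΩ
  simpa [EuclideanSpace.inner_single_right] using this

lemma isWeakGradient_weakGradient (h : ∃ g, IsWeakGradient Ω f g) :
    IsWeakGradient Ω f (weakGradient Ω f) := by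
  unfold weakGradient
  rw [dif_pos h]
  exact h.choose_spec

/-- Almost everywhere uniqueness makes the choice inside `weakGradient` irrelevant: the energy can
be computed with whichever gradient is at hand. -/
lemma h1NormSq_eq (hΩ : IsOpen Ω) (h : IsWeakGradient Ω f g) :
    h1NormSq Ω f = ∫ x in Ω, (‖g x‖ ^ 2 + f x ^ 2) := by
  have := (isWeakGradient_weakGradient ⟨g, h⟩).ae_eq hΩ h
  refine integral_congr_ae ?_
  filter_upwards [this] with x hx
  rw [hx]

/-- The identity which defines a weak gradient extends to compactly supported test functions of
class `C¹`. -/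
lemma IsWeakGradient.integral_eq_of_contDiff_one (hΩ : IsOpen Ω) (h : IsWeakGradient Ω f g)
    (hf : IntegrableOn f Ω) (hg : IntegrableOn g Ω) {φ : Space N → ℝ} (hφ : ContDiff ℝ 1 φ)
    (hc : HasCompactSupport φ) (hs : tsupport φ ⊆ Ω) (v : Space N) :
    ∫ x in Ω, f x * fderiv ℝ φ x v = - ∫ x in Ω, inner ℝ (g x) v * φ x := by
  have hdc : Continuous fun x => fderiv ℝ φ x v :=
    (hφ.continuous_fderiv one_ne_zero).clm_apply continuous_const
  have hds : HasCompactSupport fun x => fderiv ℝ φ x v :=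
    (hc.fderiv ℝ).comp_left (g := fun L : Space N →L[ℝ] ℝ => L v) (by simp)
  have u1 := hφ.continuous.uniformContinuous_of_tendsto_cocompact
    (hc.is_zero_at_infty (f := φ))
  have u2 := hdc.uniformContinuous_of_tendsto_cocompact (hds.is_zero_at_infty)
  obtain ⟨δ₀, hδ₀, hsub⟩ := hc.isCompact.exists_cthickening_subset_open hΩ hs
  -- Mollification at scale `δ`: the bound `δ ≤ δ₀` keeps the support inside `Ω`. The derivative of
  -- the mollified function is the mollified derivative, so uniform continuity controls both errors.
  have approx : ∀ ε > 0, ∃ ψ : Space N → ℝ, ContDiff ℝ ∞ ψ ∧ HasCompactSupport ψ ∧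
      tsupport ψ ⊆ Ω ∧ (∀ x, |ψ x - φ x| ≤ ε) ∧
        ∀ x, |fderiv ℝ ψ x v - fderiv ℝ φ x v| ≤ ε := by
    intro ε hε
    obtain ⟨δ₁, hδ₁, H1⟩ := Metric.uniformContinuous_iff.1 u1 ε hε
    obtain ⟨δ₂, hδ₂, H2⟩ := Metric.uniformContinuous_iff.1 u2 ε hε
    set δ := min δ₀ (min δ₁ δ₂)
    have hδ : 0 < δ := lt_min hδ₀ (lt_min hδ₁ hδ₂)
    let b : ContDiffBump (0 : Space N) := ⟨δ / 2, δ, half_pos hδ, half_lt_self hδ⟩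
    have hli : LocallyIntegrable φ volume := hφ.continuous.locallyIntegrable
    have hbli : LocallyIntegrable (b.normed volume) (volume : Measure (Space N)) :=
      b.continuous_normed.locallyIntegrable
    have hsupp : Function.support (b.normed volume ⋆[ContinuousLinearMap.lsmul ℝ ℝ, volume] φ)
        ⊆ cthickening δ (tsupport φ) := by
      refine (support_convolution_subset _).trans ?_
      rintro _ ⟨x, hx, y, hy, rfl⟩
      rw [b.support_normed_eq] at hx
      have hx' : ‖x‖ < δ := by simpa using hx
      refine mem_cthickening_of_dist_le _ y _ _ (subset_tsupport φ hy) ?_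
      simpa [dist_eq_norm] using hx'.le
    have hts : tsupport (b.normed volume ⋆[ContinuousLinearMap.lsmul ℝ ℝ, volume] φ)
        ⊆ cthickening δ (tsupport φ) := closure_minimal hsupp isClosed_cthickening
    refine ⟨b.normed volume ⋆[ContinuousLinearMap.lsmul ℝ ℝ, volume] φ, ?_, ?_, ?_, ?_, ?_⟩
    · exact b.hasCompactSupport_normed.contDiff_convolution_left _ b.contDiff_normed hli
    · exact HasCompactSupport.of_support_subset_isCompact hc.isCompact.cthickening hsupp
    · exact hts.trans ((cthickening_mono (min_le_left _ _) _).trans hsub)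
    · intro x
      rw [← Real.dist_eq]
      apply b.dist_normed_convolution_le hφ.continuous.aestronglyMeasurable
      intro y hy
      exact (H1 (lt_of_lt_of_le (mem_ball.1 hy)
        ((min_le_right _ _).trans (min_le_left _ _)))).le
    · intro x
      have hd := (hc.hasFDerivAt_convolution_right (ContinuousLinearMap.lsmul ℝ ℝ) hbli hφ x).fderiv
      have e : fderiv ℝ (b.normed volume ⋆[ContinuousLinearMap.lsmul ℝ ℝ, volume] φ) x v =
          (b.normed volume ⋆[ContinuousLinearMap.lsmul ℝ ℝ, volume] fun y => fderiv ℝ φ y v) x := by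
        rw [hd]
        exact convolution_precompR_apply (ContinuousLinearMap.lsmul ℝ ℝ) hbli (hc.fderiv ℝ)
          (hφ.continuous_fderiv one_ne_zero) x v
      rw [e, ← Real.dist_eq]
      apply b.dist_normed_convolution_le hdc.aestronglyMeasurable
      intro y hy
      exact (H2 (lt_of_lt_of_le (mem_ball.1 hy)
        ((min_le_right _ _).trans (min_le_right _ _)))).le
  have hgv : IntegrableOn (fun x => inner ℝ (g x) v) Ω := hg.inner_const v
  have bdd : ∀ {F ψ : Space N → ℝ}, IntegrableOn F Ω → Continuous ψ → HasCompactSupport ψ →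
      IntegrableOn (fun x => F x * ψ x) Ω := by
    intro F ψ hF hψ hψc
    obtain ⟨C, hC⟩ := hψ.bounded_above_of_compact_support hψc
    exact hF.mul_bdd hψ.aestronglyMeasurable (.of_forall hC)
  -- The identity holds for the mollified function, so its defect for `φ` is at most `ε` times a
  -- quantity independent of `ε`.
  have est : ∀ ε > 0, |(∫ x in Ω, f x * fderiv ℝ φ x v) + ∫ x in Ω, inner ℝ (g x) v * φ x| ≤
      ε * ((∫ x in Ω, |f x|) + (∫ x in Ω, |inner ℝ (g x) v|)) := by
    intro ε hε
    obtain ⟨ψ, h1, h2, h3, h4, h5⟩ := approx ε hε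
    have hψ1 : ContDiff ℝ 1 ψ := h1.of_le (by norm_num)
    have hdcψ : Continuous fun x => fderiv ℝ ψ x v :=
      (hψ1.continuous_fderiv one_ne_zero).clm_apply continuous_const
    have hdsψ : HasCompactSupport fun x => fderiv ℝ ψ x v :=
      (h2.fderiv ℝ).comp_left (g := fun L : Space N →L[ℝ] ℝ => L v) (by simp)
    have e := h.integral_eq ψ h1 h2 h3 v
    have d1 : |(∫ x in Ω, f x * fderiv ℝ φ x v) - ∫ x in Ω, f x * fderiv ℝ ψ x v| ≤
        ε * ∫ x in Ω, |f x| := by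
      rw [← integral_sub (bdd hf hdc hds) (bdd hf hdcψ hdsψ), ← integral_const_mul]
      refine (abs_integral_le_integral_abs).trans (integral_mono_of_nonneg
        (.of_forall fun x => abs_nonneg _) (hf.abs.const_mul ε) (.of_forall fun x => ?_))
      dsimp only
      rw [← mul_sub, abs_mul, mul_comm, abs_sub_comm]
      exact mul_le_mul_of_nonneg_right (h5 x) (abs_nonneg _)
    have d2 : |(∫ x in Ω, inner ℝ (g x) v * φ x) - ∫ x in Ω, inner ℝ (g x) v * ψ x| ≤
        ε * ∫ x in Ω, |inner ℝ (g x) v| := by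
      rw [← integral_sub (bdd hgv hφ.continuous hc) (bdd hgv h1.continuous h2),
        ← integral_const_mul]
      refine (abs_integral_le_integral_abs).trans (integral_mono_of_nonneg
        (.of_forall fun x => abs_nonneg _) (hgv.abs.const_mul ε) (.of_forall fun x => ?_))
      dsimp only
      rw [← mul_sub, abs_mul, mul_comm, abs_sub_comm]
      exact mul_le_mul_of_nonneg_right (h4 x) (abs_nonneg _)
    rw [abs_le] at *
    constructor <;> linarith [d1.1, d1.2, d2.1, d2.2]
  have hC : 0 ≤ (∫ x in Ω, |f x|) + ∫ x in Ω, |inner ℝ (g x) v| :=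
    add_nonneg (integral_nonneg fun _ => abs_nonneg _) (integral_nonneg fun _ => abs_nonneg _)
  have h0 : |(∫ x in Ω, f x * fderiv ℝ φ x v) + ∫ x in Ω, inner ℝ (g x) v * φ x| ≤ 0 := by
    refine le_of_forall_pos_le_add fun η hη => ?_
    refine (est (η / ((∫ x in Ω, |f x|) + (∫ x in Ω, |inner ℝ (g x) v|) + 1)) (by positivity)).trans ?_
    rw [zero_add, div_mul_eq_mul_div, div_le_iff₀ (by positivity)]
    nlinarith
  linarith [abs_eq_zero.1 (le_antisymm h0 (abs_nonneg _))]

/-- A classical gradient which is square integrable is a weak gradient. -/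
lemma isWeakGradient_of_hasFDerivAt (hΩ : IsOpen Ω) (hg : ContinuousOn g Ω)
    (hg2 : MemLp g 2 (volume.restrict Ω))
    (hd : ∀ x ∈ Ω, HasFDerivAt f (innerSL ℝ (g x)) x) : IsWeakGradient Ω f g where
  memLp := hg2
  integral_eq φ h1 h2 h3 v := by
    have hf : ContinuousOn f Ω := fun x hx => (hd x hx).continuousAt.continuousWithinAt
    have out : ∀ x ∉ Ω, φ x = 0 := fun x hx =>
      image_eq_zero_of_notMem_tsupport fun hx' => hx (h3 hx')
    have out' : ∀ x ∉ Ω, fderiv ℝ φ x = 0 := fun x hx =>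
      image_eq_zero_of_notMem_tsupport fun hx' => hx (h3 (tsupport_fderiv_subset ℝ hx'))
    have hφ1 : ContDiff ℝ 1 φ := h1.of_le (by norm_num)
    have hdc : Continuous fun x => fderiv ℝ φ x v :=
      (hφ1.continuous_fderiv one_ne_zero).clm_apply continuous_const
    -- `f` and `g` are controlled only on `Ω`; a factor supported in `tsupport φ ⊆ Ω` makes the
    -- product continuous and compactly supported on the whole space.
    have ci : ∀ {F ψ : Space N → ℝ}, ContinuousOn F Ω → Continuous ψ →
        (tsupport ψ ⊆ tsupport φ) → Integrable fun x => F x * ψ x := by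
      intro F ψ hF hψ hsub
      have hcs : HasCompactSupport ψ := h2.mono' (subset_closure.trans hsub)
      have : Continuous fun x => F x * ψ x := by
        rw [continuous_iff_continuousAt]
        intro x
        by_cases hx : x ∈ tsupport ψ
        · exact ((hF x (h3 (hsub hx))).continuousAt (hΩ.mem_nhds (h3 (hsub hx)))).mul
            hψ.continuousAt
        · have : (fun x => F x * ψ x) =ᶠ[𝓝 x] fun _ => 0 := by
            filter_upwards [(isClosed_tsupport ψ).isOpen_compl.mem_nhds hx] with y hy
            rw [image_eq_zero_of_notMem_tsupport hy, mul_zero]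
          exact this.continuousAt
      exact this.integrable_of_hasCompactSupport hcs.mul_left
    have hsubd : tsupport (fun x => fderiv ℝ φ x v) ⊆ tsupport φ := by
      refine (closure_mono fun x hx => ?_).trans (tsupport_fderiv_subset ℝ (f := φ))
      rw [Function.mem_support] at hx ⊢
      intro h0; exact hx (by rw [h0]; simp)
    have hgv : ContinuousOn (fun x => inner ℝ (g x) v) Ω := hg.inner continuousOn_const
    have key := integral_bilinear_hasLineDerivAt_right_eq_neg_left_of_integrable
      (μ := (volume : Measure (Space N)))
      (f := f) (f' := fun x => inner ℝ (g x) v) (g := φ) (g' := fun x => fderiv ℝ φ x v) (v := v)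
      (B := ContinuousLinearMap.mul ℝ ℝ) (ci hgv h1.continuous subset_rfl)
      (ci hf hdc hsubd) (ci hf h1.continuous subset_rfl)
      (fun x hx => by simpa using (hd x (h3 hx)).hasLineDerivAt v)
      (fun x _ => (hφ1.differentiable one_ne_zero x).hasFDerivAt.hasLineDerivAt v)
    simp only [ContinuousLinearMap.mul_apply'] at key
    rw [setIntegral_eq_integral_of_forall_compl_eq_zero,
      setIntegral_eq_integral_of_forall_compl_eq_zero, key]
    · intro x hx; rw [out x hx, mul_zero]
    · intro x hx; rw [out' x hx]; simp

end WeakGradient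

/-! ### Radial solutions of the linear Neumann problem -/

/-- `u` is the profile of a radial solution of `-Δu + u = f` on the shell with Neumann boundary
conditions, and `k = r^(N-1) u'` is its flux. -/
structure RadialNeumann (N : ℕ) (α β : ℝ) (f u k : ℝ → ℝ) : Prop where
  continuousOn_rhs : ContinuousOn f (Icc α β)
  hasDeriv : ∀ r ∈ Icc α β, HasDerivWithinAt u (k r / r ^ (N - 1)) (Icc α β) r
  hasDeriv_flux : ∀ r ∈ Icc α β,
    HasDerivWithinAt k (r ^ (N - 1) * (u r - f r)) (Icc α β) r
  flux_left : k α = 0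
  flux_right : k β = 0

/-- The factor `q` such that `x ↦ q(|x|) x` is the gradient of the radial solution. -/
def gradFactor (N : ℕ) (f u k : ℝ → ℝ) (r : ℝ) : ℝ :=
  if r = 0 then (u 0 - f 0) / N else k r / r ^ N

/-- The gradient of the radial solution. -/
def radialGrad (N : ℕ) (f u k : ℝ → ℝ) (x : Space N) : Space N := gradFactor N f u k ‖x‖ • x

namespace RadialNeumann

variable {N : ℕ} {α β : ℝ} {f u k : ℝ → ℝ}

lemma continuousOn (h : RadialNeumann N α β f u k) : ContinuousOn u (Icc α β) :=
  fun r hr => (h.hasDeriv r hr).continuousWithinAt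

lemma continuousOn_flux (h : RadialNeumann N α β f u k) : ContinuousOn k (Icc α β) :=
  fun r hr => (h.hasDeriv_flux r hr).continuousWithinAt

lemma hasDerivAt (h : RadialNeumann N α β f u k) {r : ℝ} (hr : r ∈ Ioo α β) :
    HasDerivAt u (k r / r ^ (N - 1)) r :=
  (h.hasDeriv r (Ioo_subset_Icc_self hr)).hasDerivAt (Icc_mem_nhds hr.1 hr.2)

lemma hasDerivAt_flux (h : RadialNeumann N α β f u k) {r : ℝ} (hr : r ∈ Ioo α β) :
    HasDerivAt k (r ^ (N - 1) * (u r - f r)) r :=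
  (h.hasDeriv_flux r (Ioo_subset_Icc_self hr)).hasDerivAt (Icc_mem_nhds hr.1 hr.2)

/-- At `r = 0` both sides vanish: the left one because division by zero gives zero. Thus `u' = r q`
holds up to the origin, where the quotient `k / r^(N-1)` alone says nothing. -/
lemma deriv_eq (hN : 3 ≤ N) (r : ℝ) : k r / r ^ (N - 1) = r * gradFactor N f u k r := by
  unfold gradFactor
  split_ifs with h
  · rw [h, zero_pow (by omega)]; simp
  · obtain ⟨n, rfl⟩ : ∃ n, N = n + 1 := ⟨N - 1, by omega⟩
    rw [Nat.add_sub_cancel, pow_succ]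
    field_simp

lemma hasDerivAt_gradFactor (h : RadialNeumann N α β f u k) (hN : 3 ≤ N) (hα : 0 ≤ α) {r : ℝ}
    (hr : r ∈ Ioo α β) :
    HasDerivAt (gradFactor N f u k) ((u r - f r - N * gradFactor N f u k r) / r) r := by
  have hr0 : 0 < r := hα.trans_lt hr.1
  have e : gradFactor N f u k =ᶠ[𝓝 r] fun s => k s / s ^ N := by
    filter_upwards [isOpen_ne.mem_nhds hr0.ne'] with s hs
    simp [gradFactor, hs]
  refine HasDerivAt.congr_of_eventuallyEq ?_ e
  refine ((h.hasDerivAt_flux hr).fun_div (hasDerivAt_pow N r) (by positivity)).congr_deriv ?_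
  rw [e.self_of_nhds]
  obtain ⟨n, rfl⟩ : ∃ n, N = n + 1 := ⟨N - 1, by omega⟩
  rw [Nat.add_sub_cancel]
  field_simp
  ring

/-- Near the origin `k' = r^(N-1) (u - f)` gives `k ≈ c r^N / N` with `c = u(0) - f(0)`. The mean
value inequality for `k - c r^N / N` makes the error `o(r^N)`, which explains the value assigned to
`gradFactor` at `0`. -/
lemma gradFactor_tendsto_zero (h : RadialNeumann N 0 β f u k) (hN : 3 ≤ N) (hβ : 0 < β) :
    ContinuousWithinAt (gradFactor N f u k) (Icc 0 β) 0 := by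
  have hN0 : (0 : ℝ) < N := by exact_mod_cast (by omega : 0 < N)
  have hg : ContinuousWithinAt (fun r => u r - f r) (Icc 0 β) 0 :=
    (h.continuousOn.sub h.continuousOn_rhs) 0 ⟨le_rfl, hβ.le⟩
  rw [Metric.continuousWithinAt_iff] at hg ⊢
  intro ε hε
  obtain ⟨δ, hδ, H⟩ := hg (ε / 2) (half_pos hε)
  refine ⟨δ, hδ, fun {r} hr hrd => ?_⟩
  rcases eq_or_lt_of_le hr.1 with h0 | h0
  · rw [← h0, dist_self]; exact hε
  set c := u 0 - f 0
  have hrd' : r < δ := by simpa [abs_of_nonneg hr.1] using hrd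
  have bound : ‖(k r - c * r ^ N / N) - (k 0 - c * 0 ^ N / N)‖
      ≤ (ε / 2 * r ^ (N - 1)) * ‖r - 0‖ := by
    refine Convex.norm_image_sub_le_of_norm_hasDerivWithin_le
      (f := fun s => k s - c * s ^ N / N) (s := Icc 0 r)
      (f' := fun s => s ^ (N - 1) * (u s - f s) - c * (N * s ^ (N - 1)) / N) ?_ ?_
      (convex_Icc 0 r) ⟨le_rfl, hr.1⟩ ⟨hr.1, le_rfl⟩
    · intro s hs
      exact ((h.hasDeriv_flux s ⟨hs.1, hs.2.trans hr.2⟩).mono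
        (Icc_subset_Icc_right hr.2)).sub
        (((hasDerivAt_pow N s).const_mul c).div_const (N : ℝ)).hasDerivWithinAt
    · intro s hs
      have e : s ^ (N - 1) * (u s - f s) - c * (N * s ^ (N - 1)) / N
          = (u s - f s - c) * s ^ (N - 1) := by field_simp
      rw [e, norm_mul, norm_pow, Real.norm_of_nonneg hs.1]
      have hd := H (x := s) ⟨hs.1, hs.2.trans hr.2⟩ (by
        simpa [abs_of_nonneg hs.1] using hs.2.trans_lt hrd')
      rw [Real.dist_eq] at hd
      exact mul_le_mul hd.le (pow_le_pow_left₀ hs.1 hs.2 _) (by have := hs.1; positivity)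
        (by positivity)
  rw [h.flux_left, zero_pow (by omega)] at bound
  simp only [mul_zero, zero_div, sub_zero, Real.norm_eq_abs, abs_of_pos h0] at bound
  have e1 : r ^ (N - 1) * r = r ^ N := by
    rw [← pow_succ]; congr 1; omega
  rw [mul_assoc, e1] at bound
  rw [Real.dist_eq]
  simp only [gradFactor, if_neg h0.ne', if_true]
  have hrN : 0 < r ^ N := by positivity
  have e2 : k r / r ^ N - c / N = (k r - c * r ^ N / N) / r ^ N := by field_simp
  rw [show (u 0 - f 0) = c from rfl, e2, abs_div, abs_of_pos hrN, div_lt_iff₀ hrN]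
  nlinarith

lemma continuousOn_gradFactor (h : RadialNeumann N α β f u k) (hN : 3 ≤ N) (hα : 0 ≤ α)
    (hαβ : α < β) : ContinuousOn (gradFactor N f u k) (Icc α β) := by
  intro r hr
  rcases eq_or_lt_of_le (hα.trans hr.1) with h0 | h0
  · have hα0 : α = 0 := le_antisymm (h0 ▸ hr.1) hα
    subst hα0
    rw [← h0]
    exact h.gradFactor_tendsto_zero hN hαβ
  · have e : gradFactor N f u k =ᶠ[𝓝[Icc α β] r] fun s => k s / s ^ N := by
      filter_upwards [mem_nhdsWithin_of_mem_nhds (isOpen_ne.mem_nhds h0.ne')] with s hs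
      simp [gradFactor, hs]
    refine ContinuousWithinAt.congr_of_eventuallyEq ?_ e (e.self_of_nhdsWithin hr)
    exact (h.continuousOn_flux r hr).div (continuousWithinAt_id.pow N) (by positivity)

/-- With `q = gradFactor` one has `u' = r q` and `(r q)' = u - f - (N - 1) q`, which is continuous
up to both ends. At the origin `(r q)'` is `q(0)` by definition of the derivative, and this agrees
with the formula because `N q(0) = u(0) - f(0)`. -/
lemma contDiffOn_profile (h : RadialNeumann N α β f u k) (hN : 3 ≤ N) (hα : 0 ≤ α)
    (hαβ : α < β) : ContDiffOn ℝ 2 u (Icc α β) := by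
  have hq := h.continuousOn_gradFactor hN hα hαβ
  have hU := uniqueDiffOn_Icc hαβ
  have hd : ∀ r ∈ Icc α β, HasDerivWithinAt (fun r => r * gradFactor N f u k r)
      (u r - f r - (N - 1) * gradFactor N f u k r) (Icc α β) r := by
    intro r hr
    rcases eq_or_lt_of_le (hα.trans hr.1) with h0 | h0
    · have hα0 : α = 0 := le_antisymm (h0 ▸ hr.1) hα
      subst hα0
      rw [← h0]
      have e : u 0 - f 0 - ((N : ℝ) - 1) * gradFactor N f u k 0 = gradFactor N f u k 0 := by
        have hN0 : (N : ℝ) ≠ 0 := by exact_mod_cast (by omega : N ≠ 0)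
        simp only [gradFactor, if_true]
        field_simp
        ring
      rw [e, hasDerivWithinAt_iff_tendsto_slope]
      have := (hq 0 ⟨le_rfl, hαβ.le⟩).tendsto.mono_left
        (nhdsWithin_mono 0 (sdiff_subset (s := Icc 0 β) (t := {0})))
      refine this.congr' ?_
      filter_upwards [self_mem_nhdsWithin] with s hs
      have hs0 : s ≠ 0 := hs.2
      simp [slope, hs0]
    · have hrN : r ^ (N - 1) ≠ 0 := by positivity
      have e : (fun r => r * gradFactor N f u k r) = fun r => k r / r ^ (N - 1) := by
        ext s; rw [deriv_eq hN]
      rw [e]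
      refine ((h.hasDeriv_flux r hr).fun_div (hasDerivAt_pow (N - 1) r).hasDerivWithinAt
        hrN).congr_deriv ?_
      simp only [gradFactor, if_neg h0.ne']
      obtain ⟨n, rfl⟩ : ∃ n, N = n + 2 := ⟨N - 2, by omega⟩
      have e2 : n + 2 - 1 = n + 1 := by omega
      rw [e2, Nat.add_sub_cancel]
      push_cast
      field_simp
      ring
  have hd1 : EqOn (derivWithin u (Icc α β)) (fun r => r * gradFactor N f u k r) (Icc α β) := by
    intro r hr
    rw [(h.hasDeriv r hr).derivWithin (hU r hr)]
    exact deriv_eq hN r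
  rw [show (2 : WithTop ℕ∞) = 1 + 1 by norm_num, contDiffOn_succ_iff_derivWithin hU]
  refine ⟨fun r hr => (h.hasDeriv r hr).differentiableWithinAt, by simp, ?_⟩
  refine ContDiffOn.congr ?_ hd1
  rw [show (1 : WithTop ℕ∞) = 0 + 1 by norm_num, contDiffOn_succ_iff_derivWithin hU]
  refine ⟨fun r hr => (hd r hr).differentiableWithinAt, by simp, ?_⟩
  rw [contDiffOn_zero]
  refine ContinuousOn.congr ((h.continuousOn.sub h.continuousOn_rhs).sub
    (continuousOn_const (c := (N : ℝ) - 1).mul hq)) fun r hr => ?_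
  exact (hd r hr).derivWithin (hU r hr)

lemma derivWithin_left (h : RadialNeumann N α β f u k) (hαβ : α < β) :
    derivWithin u (Icc α β) α = 0 := by
  have hm : α ∈ Icc α β := ⟨le_rfl, hαβ.le⟩
  rw [(h.hasDeriv α hm).derivWithin (uniqueDiffOn_Icc hαβ α hm), h.flux_left, zero_div]

lemma derivWithin_right (h : RadialNeumann N α β f u k) (hαβ : α < β) :
    derivWithin u (Icc α β) β = 0 := by
  have hm : β ∈ Icc α β := ⟨hαβ.le, le_rfl⟩
  rw [(h.hasDeriv β hm).derivWithin (uniqueDiffOn_Icc hαβ β hm), h.flux_right, zero_div]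

lemma const_mul (h : RadialNeumann N α β f u k) (c : ℝ) :
    RadialNeumann N α β (fun r => c * f r) (fun r => c * u r) (fun r => c * k r) where
  continuousOn_rhs := continuousOn_const.mul h.continuousOn_rhs
  hasDeriv r hr := ((h.hasDeriv r hr).const_mul c).congr_deriv (by ring)
  hasDeriv_flux r hr := ((h.hasDeriv_flux r hr).const_mul c).congr_deriv (by ring)
  flux_left := by rw [h.flux_left, mul_zero]
  flux_right := by rw [h.flux_right, mul_zero]

lemma congr_rhs {f' : ℝ → ℝ} (h : RadialNeumann N α β f u k) (hf : EqOn f f' (Icc α β)) :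
    RadialNeumann N α β f' u k where
  continuousOn_rhs := h.continuousOn_rhs.congr hf.symm
  hasDeriv := h.hasDeriv
  hasDeriv_flux r hr := (h.hasDeriv_flux r hr).congr_deriv (by rw [hf hr])
  flux_left := h.flux_left
  flux_right := h.flux_right

end RadialNeumann

/-! ### Radial solutions on the shell -/

namespace RadialNeumann

variable {N : ℕ} {α β : ℝ} {f u k : ℝ → ℝ}

lemma norm_mem_Ioo {x : Space N} (hx : x ∈ shell N α β) (h0 : x ≠ 0) : ‖x‖ ∈ Ioo α β :=
  ⟨lt_norm_of_mem_shell hx h0, norm_lt_of_mem_shell hx⟩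

lemma hasFDerivAt_norm {x : Space N} (h0 : x ≠ 0) :
    HasFDerivAt (fun y : Space N => ‖y‖) (‖x‖⁻¹ • innerSL ℝ x) x := by
  have h1 : HasFDerivAt (fun y : Space N => ‖y‖ ^ 2) (2 • innerSL ℝ x) x :=
    (hasStrictFDerivAt_norm_sq x).hasFDerivAt
  have h2 := h1.sqrt (by positivity)
  have e : (fun y : Space N => √(‖y‖ ^ 2)) = fun y => ‖y‖ := by
    ext y; rw [Real.sqrt_sq (norm_nonneg y)]
  rw [e, Real.sqrt_sq (norm_nonneg x)] at h2
  refine h2.congr_fderiv ?_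
  ext y
  have : ‖x‖ ≠ 0 := norm_ne_zero_iff.2 h0
  simp
  field_simp

/-- Away from the origin this is the chain rule. At the origin the vanishing flux gives `u(r) - u(0)
= o(r)`, which is differentiability with zero gradient. -/
lemma hasFDerivAt_radial (h : RadialNeumann N α β f u k) (hN : 3 ≤ N) (hα : 0 ≤ α)
    {x : Space N} (hx : x ∈ shell N α β) :
    HasFDerivAt (radial N u) (innerSL ℝ (radialGrad N f u k x)) x := by
  by_cases h0 : x = 0
  · subst h0
    have hα0 := eq_zero_of_zero_mem_shell hα hx
    subst hα0
    have hβ : 0 < β := by simpa using norm_lt_of_mem_shell hx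
    have hd := h.hasDeriv 0 ⟨le_rfl, hβ.le⟩
    rw [h.flux_left, zero_div, hasDerivWithinAt_iff_isLittleO] at hd
    have ht : Tendsto (fun y : Space N => ‖y‖) (𝓝 0) (𝓝[Icc 0 β] 0) := by
      refine tendsto_nhdsWithin_iff.2 ⟨by simpa using (continuous_norm (E := Space N)).tendsto 0, ?_⟩
      filter_upwards [ball_mem_nhds (0 : Space N) hβ] with y hy
      exact ⟨norm_nonneg y, by simpa using (mem_ball.1 hy).le⟩
    have hd2 := hd.comp_tendsto ht
    rw [hasFDerivAt_iff_isLittleO]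
    have e1 : radialGrad N f u k 0 = 0 := by simp [radialGrad]
    rw [e1]
    refine (hd2.norm_right.congr_left fun y => ?_).trans_isBigO ?_
    · simp [radial]
    · refine Asymptotics.IsBigO.of_bound 1 (.of_forall fun y => ?_)
      simp
  · have hr := norm_mem_Ioo hx h0
    have hc := (h.hasDerivAt hr).comp_hasFDerivAt x (hasFDerivAt_norm h0)
    refine hc.congr_fderiv ?_
    ext y
    have : ‖x‖ ≠ 0 := norm_ne_zero_iff.2 h0
    rw [deriv_eq (f := f) (u := u) hN]
    simp [radialGrad]
    field_simp

/-- The derivative of the gradient field. -/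
def hess (N : ℕ) (f u k : ℝ → ℝ) (x : Space N) : Space N →L[ℝ] Space N :=
  gradFactor N f u k ‖x‖ • ContinuousLinearMap.id ℝ (Space N) +
    ((u ‖x‖ - f ‖x‖ - N * gradFactor N f u k ‖x‖) / ‖x‖ ^ 2) • (innerSL ℝ x).smulRight x

/-- At the origin only continuity of `q` is needed: `q(|y|) y - q(0) y = o(|y|)`. -/
lemma hasFDerivAt_radialGrad (h : RadialNeumann N α β f u k) (hN : 3 ≤ N) (hα : 0 ≤ α)
    {x : Space N} (hx : x ∈ shell N α β) :
    HasFDerivAt (radialGrad N f u k) (hess N f u k x) x := by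
  by_cases h0 : x = 0
  · subst h0
    have hα0 := eq_zero_of_zero_mem_shell hα hx
    subst hα0
    have hβ : 0 < β := by simpa using norm_lt_of_mem_shell hx
    have hc := (h.gradFactor_tendsto_zero hN hβ).tendsto
    have ht : Tendsto (fun y : Space N => ‖y‖) (𝓝 0) (𝓝[Icc 0 β] 0) := by
      refine tendsto_nhdsWithin_iff.2 ⟨by simpa using (continuous_norm (E := Space N)).tendsto 0, ?_⟩
      filter_upwards [ball_mem_nhds (0 : Space N) hβ] with y hy
      exact ⟨norm_nonneg y, by simpa using (mem_ball.1 hy).le⟩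
    have hc2 : Tendsto (fun y : Space N => gradFactor N f u k ‖y‖ - gradFactor N f u k 0)
        (𝓝 0) (𝓝 0) := by
      simpa using (hc.comp ht).sub_const (gradFactor N f u k 0)
    rw [hasFDerivAt_iff_isLittleO]
    have ho : (fun y : Space N => (gradFactor N f u k ‖y‖ - gradFactor N f u k 0) • y) =o[𝓝 0]
        fun y : Space N => (1 : ℝ) • y :=
      ((Asymptotics.isLittleO_one_iff ℝ).2 hc2).smul_isBigO (Asymptotics.isBigO_refl _ _)
    refine ho.congr (fun y => ?_) fun y => ?_
    · simp [radialGrad, hess, sub_smul]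
    · simp
  · have hr := norm_mem_Ioo hx h0
    have hc := ((h.hasDerivAt_gradFactor hN hα hr).comp_hasFDerivAt x
      (hasFDerivAt_norm h0)).smul (hasFDerivAt_id x)
    refine hc.congr_fderiv ?_
    ext1 y
    have : ‖x‖ ≠ 0 := norm_ne_zero_iff.2 h0
    simp [hess, smul_smul]
    congr 2
    field_simp

lemma continuousOn_radialGrad (h : RadialNeumann N α β f u k) (hN : 3 ≤ N) (hα : 0 ≤ α)
    (hαβ : α < β) : ContinuousOn (radialGrad N f u k) (shell N α β) :=
  (continuousOn_radial (h.continuousOn_gradFactor hN hα hαβ)).smul continuousOn_id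

/-- The rank-one term has norm `|u - f - N q|`, and this tends to zero at the origin by the choice
of `q(0)`. -/
lemma continuousOn_hess (h : RadialNeumann N α β f u k) (hN : 3 ≤ N) (hα : 0 ≤ α)
    (hαβ : α < β) : ContinuousOn (hess N f u k) (shell N α β) := by
  have hq := continuousOn_radial (N := N) (h.continuousOn_gradFactor hN hα hαβ)
  have hg := continuousOn_radial (N := N) ((h.continuousOn.sub h.continuousOn_rhs).sub
    (continuousOn_const (c := (N : ℝ)).mul (h.continuousOn_gradFactor hN hα hαβ)))
  refine ContinuousOn.add (hq.smul continuousOn_const) ?_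
  intro x hx
  by_cases h0 : x = 0
  · subst h0
    have hα0 := eq_zero_of_zero_mem_shell hα hx
    subst hα0
    have hg0 := (hg 0 hx).tendsto
    have e0 : radial N (fun x => u x - f x - N * gradFactor N f u k x) 0 = 0 := by
      have hN0 : (N : ℝ) ≠ 0 := by exact_mod_cast (by omega : N ≠ 0)
      simp [radial, gradFactor]
      field_simp
      ring
    rw [ContinuousWithinAt]
    simp only [norm_zero, map_zero, ContinuousLinearMap.smulRight_zero, smul_zero]
    have hg1 : Tendsto (radial N (fun x => u x - f x - N * gradFactor N f u k x))
        (𝓝[shell N 0 β] 0) (𝓝 0) := by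
      have := hg0; rw [Pi.sub_def, Pi.sub_def, Pi.mul_def, e0] at this; exact this
    refine squeeze_zero_norm (fun y => ?_) (by simpa using hg1.norm)
    by_cases hy : y = 0
    · simp [hy]
    have : ‖y‖ ≠ 0 := norm_ne_zero_iff.2 hy
    rw [norm_smul, ContinuousLinearMap.norm_smulRight_apply, innerSL_apply_norm, norm_div, norm_pow,
      norm_norm]
    apply le_of_eq
    simp only [radial, Real.norm_eq_abs]
    field_simp
  · have : ‖x‖ ^ 2 ≠ 0 := pow_ne_zero 2 (norm_ne_zero_iff.2 h0)
    refine ((hg x hx).div (continuous_norm.continuousWithinAt.pow 2) this).smul ?_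
    have hcc : Continuous fun y : Space N => (innerSL ℝ y).smulRight y :=
      ((ContinuousLinearMap.smulRightL ℝ (Space N) (Space N)).continuous₂).comp
        ((innerSL ℝ).continuous.prodMk continuous_id)
    exact hcc.continuousWithinAt

lemma contDiffOn_radial (h : RadialNeumann N α β f u k) (hN : 3 ≤ N) (hα : 0 ≤ α)
    (hαβ : α < β) : ContDiffOn ℝ 2 (radial N u) (shell N α β) := by
  have hG : ContDiffOn ℝ 1 (radialGrad N f u k) (shell N α β) := by
    rw [show (1 : WithTop ℕ∞) = 0 + 1 by norm_num, contDiffOn_succ_iff_fderiv_of_isOpen isOpen_shell]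
    refine ⟨fun x hx =>
      (h.hasFDerivAt_radialGrad hN hα hx).differentiableAt.differentiableWithinAt, by simp, ?_⟩
    rw [contDiffOn_zero]
    exact (h.continuousOn_hess hN hα hαβ).congr fun x hx =>
      (h.hasFDerivAt_radialGrad hN hα hx).fderiv
  rw [show (2 : WithTop ℕ∞) = 1 + 1 by norm_num, contDiffOn_succ_iff_fderiv_of_isOpen isOpen_shell]
  refine ⟨fun x hx =>
    (h.hasFDerivAt_radial hN hα hx).differentiableAt.differentiableWithinAt, by simp, ?_⟩
  refine ((innerSL ℝ (E := Space N)).contDiff.comp_contDiffOn hG).congr fun x hx => ?_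
  exact (h.hasFDerivAt_radial hN hα hx).fderiv

/-- The trace of `hess` is `N q + (u - f - N q)`. -/
lemma laplacian_radial (h : RadialNeumann N α β f u k) (hN : 3 ≤ N) (hα : 0 ≤ α)
    {x : Space N} (hx : x ∈ shell N α β) : (Δ (radial N u)) x = u ‖x‖ - f ‖x‖ := by
  rw [InnerProductSpace.laplacian_eq_iteratedFDeriv_orthonormalBasis _
    (EuclideanSpace.basisFun (Fin N) ℝ)]
  have e : fderiv ℝ (radial N u) =ᶠ[𝓝 x] fun y => innerSL ℝ (radialGrad N f u k y) := by
    filter_upwards [isOpen_shell.mem_nhds hx] with y hy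
    exact (h.hasFDerivAt_radial hN hα hy).fderiv
  have e2 : fderiv ℝ (fderiv ℝ (radial N u)) x = (innerSL ℝ).comp (hess N f u k x) := by
    rw [e.fderiv_eq]
    exact ((innerSL ℝ (E := Space N)).hasFDerivAt.comp x (h.hasFDerivAt_radialGrad hN hα hx)).fderiv
  simp only [iteratedFDeriv_two_apply, e2]
  have e3 : ∀ i : Fin N, ((innerSL ℝ).comp (hess N f u k x)) (EuclideanSpace.basisFun (Fin N) ℝ i)
      (EuclideanSpace.basisFun (Fin N) ℝ i) = gradFactor N f u k ‖x‖ +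
        ((u ‖x‖ - f ‖x‖ - N * gradFactor N f u k ‖x‖) / ‖x‖ ^ 2) * (x i) ^ 2 := by
    intro i
    simp [hess, EuclideanSpace.inner_single_right, pow_two]
  simp only [Matrix.cons_val_zero, Matrix.cons_val_one]
  simp only [e3, Finset.sum_add_distrib, ← Finset.mul_sum]
  rw [← EuclideanSpace.real_norm_sq_eq]
  simp only [Finset.sum_const, Finset.card_univ, Fintype.card_fin, nsmul_eq_mul]
  by_cases h0 : x = 0
  · have hN0 : (N : ℝ) ≠ 0 := by exact_mod_cast (by omega : N ≠ 0)
    simp [h0, gradFactor]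
    field_simp
  · have : ‖x‖ ≠ 0 := norm_ne_zero_iff.2 h0
    field_simp
    ring

lemma isWeakGradient (h : RadialNeumann N α β f u k) (hN : 3 ≤ N) (hα : 0 ≤ α)
    (hαβ : α < β) : IsWeakGradient (shell N α β) (radial N u) (radialGrad N f u k) := by
  obtain ⟨C, hC⟩ := exists_bound_radial (N := N) (h.continuousOn_gradFactor hN hα hαβ)
  have hG := h.continuousOn_radialGrad hN hα hαβ
  refine isWeakGradient_of_hasFDerivAt isOpen_shell hG
    (memLp_of_bound hG (C := C * β) (fun x hx => ?_) 2) fun x hx => h.hasFDerivAt_radial hN hα hx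
  rw [radialGrad, norm_smul]
  exact mul_le_mul (hC x hx) (norm_lt_of_mem_shell hx).le (norm_nonneg x)
    ((norm_nonneg _).trans (hC x hx))

end RadialNeumann

/-! ### Green's formula against cone elements -/

/-- A smooth truncation of the identity. -/
lemma exists_truncation : ∃ χ : ℝ → ℝ, ContDiff ℝ 1 χ ∧ (∀ t ≤ 1, χ t = 0) ∧
    (∀ t, |χ t| ≤ |t|) ∧ (∀ t, 3 ≤ t → χ t = t) ∧ (∀ t, 3 ≤ t → deriv χ t = 1) ∧
      ∃ C, ∀ t, |deriv χ t| ≤ C := by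
  set χ : ℝ → ℝ := fun t => t * Real.smoothTransition (t - 1) with hχ
  have h1 : ContDiff ℝ 1 χ :=
    contDiff_id.mul (Real.smoothTransition.contDiff.comp (contDiff_id.sub contDiff_const))
  have h2 : ∀ t ≤ 1, χ t = 0 := fun t ht => by
    simp [hχ, Real.smoothTransition.zero_of_nonpos (sub_nonpos.2 ht)]
  have h3 : ∀ t, 2 ≤ t → χ t = t := fun t ht => by
    simp [hχ, Real.smoothTransition.one_of_one_le (by linarith : 1 ≤ t - 1)]
  have h4 : ∀ t, 3 ≤ t → deriv χ t = 1 := fun t ht => by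
    have : χ =ᶠ[𝓝 t] id := by
      filter_upwards [Ioi_mem_nhds (by linarith : 2 < t)] with s hs using h3 s (le_of_lt hs)
    rw [this.deriv_eq, deriv_id]
  have h5 : ∀ t < 1, deriv χ t = 0 := fun t ht => by
    have : χ =ᶠ[𝓝 t] fun _ => 0 := by
      filter_upwards [Iio_mem_nhds ht] with s hs using h2 s (le_of_lt hs)
    rw [this.deriv_eq, deriv_const]
  obtain ⟨C, hC⟩ := (isCompact_Icc (a := (1 : ℝ)) (b := 3)).exists_bound_of_continuousOn
    (h1.continuous_deriv le_rfl).continuousOn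
  refine ⟨χ, h1, h2, fun t => ?_, fun t ht => h3 t (by linarith), h4, max C 1, fun t => ?_⟩
  · rw [hχ, abs_mul, abs_of_nonneg (Real.smoothTransition.nonneg _)]
    exact mul_le_of_le_one_right (abs_nonneg t) (Real.smoothTransition.le_one _)
  · rcases lt_or_ge t 1 with h | h
    · rw [h5 t h]; simp
    rcases le_or_gt 3 t with h' | h'
    · rw [h4 t h']; simp
    · exact (hC t ⟨h, h'.le⟩).trans (le_max_left _ _)

namespace RadialNeumann

variable {N : ℕ} {α β : ℝ} {f u k : ℝ → ℝ}

/-- The weak gradient of a radial function tested with a radial vector field `H(|x|) x`. -/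
lemma integral_radial_field {v : ℝ → ℝ} {g : Space N → Space N} {H H' : ℝ → ℝ} {a b : ℝ}
    (hv : ContinuousOn v (Icc α β)) (hg : IsWeakGradient (shell N α β) (radial N v) g)
    (ha : 0 < a) (hαa : α < a) (hbβ : b < β)
    (hH : ∀ r, HasDerivAt H (H' r) r) (hH' : Continuous H')
    (hsupp : ∀ r, r ∉ Icc a b → H r = 0) :
    ∫ x in shell N α β, v ‖x‖ * (‖x‖ * H' ‖x‖ + N * H ‖x‖) =
      - ∫ x in shell N α β, inner ℝ (g x) (H ‖x‖ • x) := by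
  have hHc : ContDiff ℝ 1 H := by
    rw [contDiff_one_iff_deriv]
    refine ⟨fun r => (hH r).differentiableAt, ?_⟩
    rwa [show deriv H = H' from funext fun r => (hH r).deriv]
  have hn0 : ∀ x : Space N, ‖x‖ < a → H ‖x‖ = 0 := fun x hx => hsupp _ fun h => by
    linarith [h.1]
  have hHx : ContDiff ℝ 1 fun x : Space N => H ‖x‖ := by
    rw [contDiff_iff_contDiffAt]
    intro x
    by_cases h0 : x = 0
    · have : (fun x : Space N => H ‖x‖) =ᶠ[𝓝 x] fun _ => 0 := by
        filter_upwards [ball_mem_nhds x ha] with y hy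
        exact hn0 y (by simpa [h0] using hy)
      exact contDiffAt_const.congr_of_eventuallyEq this
    · exact hHc.contDiffAt.comp x (contDiffAt_norm ℝ h0)
  have hsub : ∀ i : Fin N, tsupport (fun x : Space N => H ‖x‖ * x i) ⊆
      {x : Space N | a ≤ ‖x‖ ∧ ‖x‖ ≤ b} := by
    intro i
    refine closure_minimal (fun x hx => ?_) ((isClosed_le continuous_const continuous_norm).inter
      (isClosed_le continuous_norm continuous_const))
    by_contra hx'
    exact hx (by simp [hsupp ‖x‖ hx'])
  have hshell : {x : Space N | a ≤ ‖x‖ ∧ ‖x‖ ≤ b} ⊆ shell N α β := fun x hx =>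
    mem_shell (hαa.trans_le hx.1) (hx.2.trans_lt hbβ)
  have hcoord : ∀ i : Fin N, ContDiff ℝ 1 fun x : Space N => x i := fun i =>
    (EuclideanSpace.proj (𝕜 := ℝ) i).contDiff
  have hφ : ∀ i : Fin N, ContDiff ℝ 1 fun x : Space N => H ‖x‖ * x i := fun i =>
    hHx.mul (hcoord i)
  have hcs : ∀ i : Fin N, HasCompactSupport fun x : Space N => H ‖x‖ * x i := by
    intro i
    refine HasCompactSupport.of_support_subset_isCompact (isCompact_closedBall (0 : Space N) b)
      fun x hx => ?_
    simpa using (hsub i (subset_tsupport _ hx)).2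
  have hgi : IntegrableOn g (shell N α β) := hg.memLp.integrable (by norm_num)
  -- Each component `H(|x|) x_i` is tested in its own coordinate direction. Summing over `i` turns
  -- the derivatives into the divergence `|x| H' + N H`.
  have id1 := fun i : Fin N => hg.integral_eq_of_contDiff_one isOpen_shell (integrable_radial hv)
    hgi (hφ i) (hcs i) ((hsub i).trans hshell) (EuclideanSpace.single i 1)
  have hcont : ∀ i : Fin N, Continuous fun x : Space N =>
      fderiv ℝ (fun x : Space N => H ‖x‖ * x i) x (EuclideanSpace.single i 1) := fun i =>
    ((hφ i).continuous_fderiv one_ne_zero).clm_apply continuous_const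
  have hcsd : ∀ i : Fin N, HasCompactSupport fun x : Space N =>
      fderiv ℝ (fun x : Space N => H ‖x‖ * x i) x (EuclideanSpace.single i 1) := fun i =>
    ((hcs i).fderiv ℝ).comp_left (g := fun L : Space N →L[ℝ] ℝ => L _) (by simp)
  have I1 : ∀ i ∈ Finset.univ, Integrable (fun x : Space N => radial N v x *
      fderiv ℝ (fun x : Space N => H ‖x‖ * x i) x (EuclideanSpace.single i 1))
      (volume.restrict (shell N α β)) := by
    intro i _
    obtain ⟨C, hC⟩ := (hcont i).bounded_above_of_compact_support (hcsd i)
    exact (integrable_radial hv).mul_bdd (hcont i).aestronglyMeasurable (.of_forall hC)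
  have I2 : ∀ i ∈ Finset.univ, Integrable (fun x : Space N =>
      inner ℝ (g x) (EuclideanSpace.single i 1) * (H ‖x‖ * x i))
      (volume.restrict (shell N α β)) := by
    intro i _
    obtain ⟨C, hC⟩ := (hφ i).continuous.bounded_above_of_compact_support (hcs i)
    exact (hgi.inner_const _).mul_bdd (hφ i).continuous.aestronglyMeasurable (.of_forall hC)
  have id2 := Finset.sum_congr rfl fun i (_ : i ∈ Finset.univ) => id1 i
  rw [Finset.sum_neg_distrib, ← integral_finsetSum _ I1, ← integral_finsetSum _ I2] at id2
  have div_eq : ∀ x : Space N, ∑ i, fderiv ℝ (fun x : Space N => H ‖x‖ * x i) x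
      (EuclideanSpace.single i 1) = ‖x‖ * H' ‖x‖ + N * H ‖x‖ := by
    intro x
    have hd : ∀ i : Fin N, fderiv ℝ (fun x : Space N => H ‖x‖ * x i) x
        (EuclideanSpace.single i 1) = H ‖x‖ + (H' ‖x‖ * ‖x‖⁻¹) * x i ^ 2 := by
      intro i
      have hp : HasFDerivAt (fun x : Space N => x i) (EuclideanSpace.proj (𝕜 := ℝ) i) x :=
        (EuclideanSpace.proj (𝕜 := ℝ) i).hasFDerivAt
      by_cases h0 : x = 0
      · have : (fun x : Space N => H ‖x‖ * x i) =ᶠ[𝓝 x] fun _ => 0 := by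
          filter_upwards [ball_mem_nhds x ha] with y hy
          rw [hn0 y (by simpa [h0] using hy), zero_mul]
        rw [this.fderiv_eq]
        simp [h0, hsupp 0 (fun h => by linarith [h.1])]
      · have hc := ((hH ‖x‖).comp_hasFDerivAt x (hasFDerivAt_norm h0)).mul hp
        have hc' : fderiv ℝ (fun x : Space N => H ‖x‖ * x i) x = _ := hc.fderiv
        rw [hc']
        simp [EuclideanSpace.inner_single_right]
        ring
    simp only [hd, Finset.sum_add_distrib, ← Finset.mul_sum]
    rw [← EuclideanSpace.real_norm_sq_eq]
    by_cases h0 : x = 0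
    · simp [h0]
    · have : ‖x‖ ≠ 0 := norm_ne_zero_iff.2 h0
      simp only [Finset.sum_const, Finset.card_univ, Fintype.card_fin, nsmul_eq_mul]
      field_simp
      ring
  have in_eq : ∀ x : Space N, ∑ i, inner ℝ (g x) (EuclideanSpace.single i 1) * (H ‖x‖ * x i) =
      inner ℝ (g x) (H ‖x‖ • x) := by
    intro x
    rw [real_inner_smul_right, PiLp.inner_apply, Finset.mul_sum]
    refine Finset.sum_congr rfl fun i _ => ?_
    simp [EuclideanSpace.inner_single_right]
    ring
  simp only [← Finset.mul_sum, div_eq, in_eq] at id2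
  exact id2

/-- Green's formula for a radial solution with nonnegative flux against an arbitrary radial
function with a continuous profile and a weak gradient. -/
lemma green (h : RadialNeumann N α β f u k) (hN : 3 ≤ N) (hα : 0 ≤ α) (hαβ : α < β)
    (hk : ∀ r ∈ Icc α β, 0 ≤ k r) {v : ℝ → ℝ} {g : Space N → Space N}
    (hv : ContinuousOn v (Icc α β)) (hg : IsWeakGradient (shell N α β) (radial N v) g) :
    (∫ x in shell N α β, inner ℝ (g x) (radialGrad N f u k x)) +
      ∫ x in shell N α β, u ‖x‖ * v ‖x‖ = ∫ x in shell N α β, f ‖x‖ * v ‖x‖ := by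
  obtain ⟨χ, hχ1, hχ0, hχle, hχid, hχd, C, hC⟩ := exists_truncation
  -- Since the flux vanishes at both ends, its constant extension vanishes outside the interval.
  set K : ℝ → ℝ := IccExtend hαβ.le ((Icc α β).domRestrict k) with hK
  have hKc : Continuous K := (h.continuousOn_flux.domRestrict).Icc_extend'
  have hKin : ∀ r ∈ Icc α β, K r = k r := fun r hr => IccExtend_of_mem _ _ hr
  have hKout : ∀ r, r ∉ Ioo α β → K r = 0 := by
    intro r hr
    rcases lt_or_ge α r with h1 | h1
    · have h2 : β ≤ r := not_lt.1 fun h2 => hr ⟨h1, h2⟩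
      rw [hK, IccExtend_of_right_le _ _ h2]
      exact h.flux_right
    · rw [hK, IccExtend_of_le_left _ _ h1]
      exact h.flux_left
  set G1 : ℝ → ℝ := IccExtend hαβ.le ((Icc α β).domRestrict fun r => u r - f r) with hG1
  have hG1c : Continuous G1 := ((h.continuousOn.sub h.continuousOn_rhs).domRestrict).Icc_extend'
  have hG1in : ∀ r ∈ Icc α β, G1 r = u r - f r := fun r hr => IccExtend_of_mem _ _ hr
  have hd0 : ∀ t ≤ 1, deriv χ t = 0 := by
    intro t ht
    have hcl : IsClosed {t | deriv χ t = 0} :=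
      isClosed_eq (hχ1.continuous_deriv le_rfl) continuous_const
    have : Iio (1 : ℝ) ⊆ {t | deriv χ t = 0} := fun t ht => by
      have : χ =ᶠ[𝓝 t] fun _ => 0 := by
        filter_upwards [Iio_mem_nhds ht] with s hs using hχ0 s (le_of_lt hs)
      simp only [mem_ofPred_eq]
      rw [this.deriv_eq, deriv_const]
    have h2 := closure_minimal this hcl
    rw [closure_Iio] at h2
    exact h2 ht
  -- The gradient field `(k / r^N) x` is not compactly supported in the shell. Replacing `k` by `ε
  -- χ(k / ε)` removes the set where `k ≤ ε`, hence a neighbourhood of both boundaries, and the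
  -- divergence of the new field is exactly `χ'(k / ε) (u - f)`.
  have step : ∀ ε > 0, ∫ x in shell N α β, v ‖x‖ * (deriv χ (k ‖x‖ / ε) * (u ‖x‖ - f ‖x‖)) =
      - ∫ x in shell N α β, inner ℝ (g x) ((ε * χ (k ‖x‖ / ε) / ‖x‖ ^ N) • x) := by
    intro ε hε
    have hcpt : IsCompact {r | r ∈ Icc α β ∧ ε ≤ K r} :=
      isCompact_Icc.inter_right (isClosed_le continuous_const hKc)
    by_cases hne : {r | r ∈ Icc α β ∧ ε ≤ K r}.Nonempty
    swap
    · have hlt : ∀ x ∈ shell N α β, k ‖x‖ / ε < 1 := by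
        intro x hx
        rw [div_lt_one hε, ← hKin _ (norm_mem_Icc hx)]
        by_contra hcon
        exact hne ⟨‖x‖, norm_mem_Icc hx, not_lt.1 hcon⟩
      have e1 : ∫ x in shell N α β, v ‖x‖ * (deriv χ (k ‖x‖ / ε) * (u ‖x‖ - f ‖x‖)) = 0 :=
        setIntegral_eq_zero_of_forall_eq_zero fun x hx => by simp [hd0 _ (hlt x hx).le]
      have e2 : ∫ x in shell N α β, inner ℝ (g x) ((ε * χ (k ‖x‖ / ε) / ‖x‖ ^ N) • x) = 0 :=
        setIntegral_eq_zero_of_forall_eq_zero fun x hx => by simp [hχ0 _ (hlt x hx).le]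
      rw [e1, e2, neg_zero]
    obtain ⟨a, ⟨haI, haK⟩, hamin⟩ := hcpt.exists_isLeast hne
    obtain ⟨b, ⟨hbI, hbK⟩, hbmax⟩ := hcpt.exists_isGreatest hne
    have haα : α < a := lt_of_le_of_ne haI.1 fun e => by
      rw [← e, hKout α (by simp)] at haK; linarith
    have hbβ : b < β := lt_of_le_of_ne hbI.2 fun e => by
      rw [e, hKout β (by simp)] at hbK; linarith
    have ha0 : 0 < a := hα.trans_lt haα
    have hlt : ∀ r, r ∉ Icc a b → K r < ε := by
      intro r hr
      by_contra hcon
      by_cases hrI : r ∈ Icc α β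
      · exact hr ⟨hamin ⟨hrI, not_lt.1 hcon⟩, hbmax ⟨hrI, not_lt.1 hcon⟩⟩
      · rw [hKout r fun h' => hrI (Ioo_subset_Icc_self h')] at hcon
        exact hcon hε
    set H : ℝ → ℝ := fun r => ε * χ (K r / ε) / r ^ N with hH
    set H' : ℝ → ℝ := fun r => deriv χ (K r / ε) * G1 r / r - N * H r / r with hH'
    have hHout : ∀ r, r ∉ Icc a b → H r = 0 := fun r hr => by
      simp [hH, hχ0 _ ((div_lt_one hε).2 (hlt r hr)).le]
    have hH'out : ∀ r, r ∉ Icc a b → H' r = 0 := fun r hr => by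
      simp [hH', hd0 _ ((div_lt_one hε).2 (hlt r hr)).le, hHout r hr]
    have hHd : ∀ r, HasDerivAt H (H' r) r := by
      intro r
      by_cases hr : r ∈ Icc a b
      · have hrI : r ∈ Ioo α β := ⟨haα.trans_le hr.1, hr.2.trans_lt hbβ⟩
        have hr0 : 0 < r := hα.trans_lt hrI.1
        have hKd : HasDerivAt K (r ^ (N - 1) * (u r - f r)) r := by
          refine (h.hasDerivAt_flux hrI).congr_of_eventuallyEq ?_
          filter_upwards [Ioo_mem_nhds hrI.1 hrI.2] with s hs
          exact hKin s (Ioo_subset_Icc_self hs)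
        have hχd' : HasDerivAt χ (deriv χ (K r / ε)) (K r / ε) :=
          (hχ1.differentiable one_ne_zero _).hasDerivAt
        have hd := ((hχd'.comp r (hKd.div_const ε)).const_mul ε).fun_div (hasDerivAt_pow N r)
          (by positivity)
        refine hd.congr_deriv ?_
        simp only [hH', hH, hG1in r (Ioo_subset_Icc_self hrI), Function.comp_apply]
        obtain ⟨n, rfl⟩ : ∃ n, N = n + 1 := ⟨N - 1, by omega⟩
        rw [Nat.add_sub_cancel]
        field_simp
        ring
      · rw [hH'out r hr]
        have hev : H =ᶠ[𝓝 r] fun _ => 0 := by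
          filter_upwards [isClosed_Icc.isOpen_compl.mem_nhds hr] with s hs using hHout s hs
        exact (hasDerivAt_const r 0).congr_of_eventuallyEq hev
    have hHcont : Continuous H' := by
      rw [continuous_iff_continuousAt]
      intro r
      by_cases hr0 : r = 0
      · have hev : H' =ᶠ[𝓝 r] fun _ => 0 := by
          filter_upwards [Iio_mem_nhds (hr0 ▸ ha0)] with s hs
          exact hH'out s fun h' => absurd h'.1 (not_le.2 hs)
        exact hev.continuousAt
      · have c1 : ContinuousAt (fun r => deriv χ (K r / ε)) r :=
          ((hχ1.continuous_deriv le_rfl).comp (hKc.div_const ε)).continuousAt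
        exact ((c1.mul hG1c.continuousAt).div continuousAt_id hr0).sub
          ((continuousAt_const.mul (hHd r).continuousAt).div continuousAt_id hr0)
    have key := integral_radial_field hv hg ha0 haα hbβ hHd hHcont hHout
    have hae : ∀ᵐ x : Space N ∂(volume.restrict (shell N α β)), x ≠ 0 := by
      have : Nonempty (Fin N) := ⟨⟨0, by omega⟩⟩
      exact ae_restrict_of_ae (Measure.ae_ne volume 0)
    have e1 : ∫ x in shell N α β, v ‖x‖ * (deriv χ (k ‖x‖ / ε) * (u ‖x‖ - f ‖x‖)) =
        ∫ x in shell N α β, v ‖x‖ * (‖x‖ * H' ‖x‖ + N * H ‖x‖) := by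
      refine integral_congr_ae ?_
      filter_upwards [hae, ae_restrict_mem measurableSet_shell] with x hx0 hx
      have : ‖x‖ ≠ 0 := norm_ne_zero_iff.2 hx0
      simp only [hH', hG1in _ (norm_mem_Icc hx), hKin _ (norm_mem_Icc hx)]
      field_simp
      ring
    rw [e1, key]
    congr 1
    refine setIntegral_congr_fun measurableSet_shell fun x hx => ?_
    simp only [hH, hKin _ (norm_mem_Icc hx)]
  -- pass to the limit
  have hae : ∀ᵐ x : Space N ∂(volume.restrict (shell N α β)), x ≠ 0 := by
    have : Nonempty (Fin N) := ⟨⟨0, by omega⟩⟩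
    exact ae_restrict_of_ae (Measure.ae_ne volume 0)
  set ε : ℕ → ℝ := fun n => 1 / ((n : ℝ) + 1) with hε
  have hε0 : ∀ n, 0 < ε n := fun n => Nat.one_div_pos_of_nat
  have hεlim : Tendsto ε atTop (𝓝 0) := tendsto_one_div_add_atTop_nhds_zero_nat
  have ev : ∀ s, 0 < s → ∀ᶠ n in atTop, 3 ≤ s / ε n := by
    intro s hs
    filter_upwards [hεlim.eventually (gt_mem_nhds (by positivity : 0 < s / 3))] with n hn
    rw [le_div_iff₀ (hε0 n)]; linarith
  have hgi : IntegrableOn g (shell N α β) := hg.memLp.integrable (by norm_num)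
  have hkr : ContinuousOn (fun x : Space N => k ‖x‖) (shell N α β) :=
    continuousOn_radial h.continuousOn_flux
  have hufr : ContinuousOn (fun x : Space N => u ‖x‖ - f ‖x‖) (shell N α β) :=
    continuousOn_radial (h.continuousOn.sub h.continuousOn_rhs)
  have L1 : Tendsto (fun n => ∫ x in shell N α β,
      v ‖x‖ * (deriv χ (k ‖x‖ / ε n) * (u ‖x‖ - f ‖x‖))) atTop
      (𝓝 (∫ x in shell N α β, v ‖x‖ * (u ‖x‖ - f ‖x‖))) := by
    refine tendsto_integral_of_dominated_convergence
      (fun x => C * |v ‖x‖ * (u ‖x‖ - f ‖x‖)|) (fun n => ?_) ?_ (fun n => ?_) ?_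
    · refine ContinuousOn.aestronglyMeasurable ?_ measurableSet_shell
      exact (continuousOn_radial hv).mul (((hχ1.continuous_deriv le_rfl).comp_continuousOn
        (hkr.div_const _)).mul hufr)
    · exact ((integrable_radial (N := N) (hv.mul (h.continuousOn.sub
        h.continuousOn_rhs))).abs).const_mul C
    · refine .of_forall fun x => ?_
      rw [Real.norm_eq_abs, mul_left_comm, abs_mul]
      exact mul_le_mul_of_nonneg_right (hC _) (abs_nonneg _)
    · filter_upwards [hae, ae_restrict_mem measurableSet_shell] with x hx0 hx
      have hr := norm_mem_Ioo hx hx0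
      rcases eq_or_lt_of_le (hk _ (norm_mem_Icc hx)) with h0 | h0
      · have hmin : IsLocalMin k ‖x‖ := by
          filter_upwards [Ioo_mem_nhds hr.1 hr.2] with s hs
          rw [← h0]; exact hk s (Ioo_subset_Icc_self hs)
        have hz := hmin.hasDerivAt_eq_zero (h.hasDerivAt_flux hr)
        have hnz : ‖x‖ ^ (N - 1) ≠ 0 := pow_ne_zero _ (norm_ne_zero_iff.2 hx0)
        have hz' : u ‖x‖ - f ‖x‖ = 0 := (mul_eq_zero.1 hz).resolve_left hnz
        simp [hz']
      · refine tendsto_const_nhds.congr' ?_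
        filter_upwards [ev _ h0] with n hn
        rw [hχd _ hn, one_mul]
  obtain ⟨Cq, hCq⟩ := exists_bound_radial (N := N) (h.continuousOn_gradFactor hN hα hαβ)
  have L2 : Tendsto (fun n => ∫ x in shell N α β,
      inner ℝ (g x) ((ε n * χ (k ‖x‖ / ε n) / ‖x‖ ^ N) • x)) atTop
      (𝓝 (∫ x in shell N α β, inner ℝ (g x) (radialGrad N f u k x))) := by
    refine tendsto_integral_of_dominated_convergence
      (fun x => ‖g x‖ * (Cq * β)) (fun n => ?_) (hgi.norm.mul_const _) (fun n => ?_) ?_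
    · have hm : AEStronglyMeasurable (fun x : Space N => (ε n * χ (k ‖x‖ / ε n) / ‖x‖ ^ N) • x)
          (volume.restrict (shell N α β)) := by
        have m1 : AEStronglyMeasurable (fun x : Space N => ε n * χ (k ‖x‖ / ε n))
            (volume.restrict (shell N α β)) :=
          ContinuousOn.aestronglyMeasurable (continuousOn_const.mul
            (hχ1.continuous.comp_continuousOn (hkr.div_const _))) measurableSet_shell
        have m2 : Measurable fun x : Space N => ‖x‖ ^ N := measurable_norm.pow_const N
        exact (m1.aemeasurable.div m2.aemeasurable).aestronglyMeasurable.smul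
          aestronglyMeasurable_id
      exact hg.memLp.1.inner hm
    · filter_upwards [hae, ae_restrict_mem measurableSet_shell] with x hx0 hx
      have hn : 0 < ‖x‖ := norm_pos_iff.2 hx0
      refine (norm_inner_le_norm _ _).trans (mul_le_mul_of_nonneg_left ?_ (norm_nonneg _))
      rw [norm_smul]
      have b1 : ‖ε n * χ (k ‖x‖ / ε n) / ‖x‖ ^ N‖ ≤ Cq := by
        refine le_trans ?_ (hCq x hx)
        simp only [radial, gradFactor, if_neg hn.ne', norm_div, norm_mul, Real.norm_eq_abs]
        refine div_le_div_of_nonneg_right ?_ (abs_nonneg _)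
        have := hχle (k ‖x‖ / ε n)
        rw [abs_div, le_div_iff₀ (abs_pos.2 (hε0 n).ne')] at this
        linarith
      exact mul_le_mul b1 (norm_lt_of_mem_shell hx).le (norm_nonneg _)
        ((norm_nonneg _).trans b1)
    · filter_upwards [hae, ae_restrict_mem measurableSet_shell] with x hx0 hx
      have hn : ‖x‖ ≠ 0 := norm_ne_zero_iff.2 hx0
      refine tendsto_const_nhds.congr' ?_
      rcases eq_or_lt_of_le (hk _ (norm_mem_Icc hx)) with h0 | h0
      · filter_upwards with n
        simp [radialGrad, gradFactor, hn, ← h0, hχ0 0 zero_le_one]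
      · filter_upwards [ev _ h0] with n hn'
        have := (hε0 n).ne'
        rw [hχid _ hn']
        simp only [radialGrad, gradFactor, if_neg hn]
        congr 2
        field_simp
  have lim := tendsto_nhds_unique L1 (L2.neg.congr fun n => (step (ε n) (hε0 n)).symm)
  have hsplit : ∫ x in shell N α β, v ‖x‖ * (u ‖x‖ - f ‖x‖) =
      (∫ x in shell N α β, u ‖x‖ * v ‖x‖) - ∫ x in shell N α β, f ‖x‖ * v ‖x‖ := by
    have e := integral_sub (integrable_radial (N := N) (h.continuousOn.mul hv))
      (integrable_radial (N := N) (h.continuousOn_rhs.mul hv))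
    refine Eq.trans (integral_congr_ae (.of_forall fun x => ?_)) e
    simp only [radial, Pi.mul_apply]; ring
  linarith

end RadialNeumann

/-! ### First zeros and monotonicity -/

lemma exists_first_zero {k : ℝ → ℝ} {c d : ℝ} (hk : ContinuousOn k (Icc c d)) (hcd : c ≤ d)
    (hc : k c < 0) (hd : 0 ≤ k d) :
    ∃ b ∈ Ioc c d, k b = 0 ∧ ∀ x ∈ Ico c b, k x < 0 := by
  have hcpt : IsCompact (Icc c d ∩ k ⁻¹' Ici 0) :=
    isCompact_Icc.of_isClosed_subset (hk.preimage_isClosed_of_isClosed isClosed_Icc isClosed_Ici)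
      inter_subset_left
  obtain ⟨b, ⟨hb, hb0⟩, hmin⟩ := hcpt.exists_isLeast ⟨d, ⟨hcd, le_rfl⟩, hd⟩
  have hlt : ∀ x ∈ Ico c b, k x < 0 := fun x hx => by
    by_contra hcon
    exact absurd (hmin ⟨⟨hx.1, hx.2.le.trans hb.2⟩, not_lt.1 hcon⟩) (not_le.2 hx.2)
  have hcb : c < b := lt_of_le_of_ne hb.1 fun e => by
    rw [← e] at hb0; exact absurd hb0 (not_le.2 hc)
  refine ⟨b, ⟨hcb, hb.2⟩, le_antisymm ?_ hb0, hlt⟩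
  have hcl : b ∈ closure (Ico c b) := by rw [closure_Ico hcb.ne]; exact ⟨hcb.le, le_rfl⟩
  have hcw : ContinuousWithinAt k (Ico c b) b :=
    (hk b hb).mono fun x hx => ⟨hx.1, hx.2.le.trans hb.2⟩
  exact hcw.closure_le hcl continuousWithinAt_const fun x hx => (hlt x hx).le

lemma exists_last_zero {k : ℝ → ℝ} {c d : ℝ} (hk : ContinuousOn k (Icc c d)) (hcd : c ≤ d)
    (hc : 0 ≤ k c) (hd : k d < 0) :
    ∃ b ∈ Ico c d, k b = 0 ∧ ∀ x ∈ Ioc b d, k x < 0 := by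
  obtain ⟨b, hb, hb0, hlt⟩ := exists_first_zero (k := fun x => k (-x)) (c := -d) (d := -c)
    (hk.comp continuous_neg.continuousOn fun x hx => ⟨by linarith [hx.2], by linarith [hx.1]⟩)
    (by linarith) (by simpa using hd) (by simpa using hc)
  refine ⟨-b, ⟨by linarith [hb.2], by linarith [hb.1]⟩, hb0, fun x hx => ?_⟩
  simpa using hlt (-x) ⟨by linarith [hx.2], by linarith [hx.1]⟩

section Monotone

variable {F F' : ℝ → ℝ} {a b : ℝ}

lemma monotoneOn_of_hasDerivAt_nonneg (hc : ContinuousOn F (Icc a b))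
    (hd : ∀ x ∈ Ioo a b, HasDerivAt F (F' x) x) (h0 : ∀ x ∈ Ioo a b, 0 ≤ F' x) :
    MonotoneOn F (Icc a b) :=
  monotoneOn_of_hasDerivWithinAt_nonneg (convex_Icc a b) hc
    (fun x hx => (hd x (by rwa [interior_Icc] at hx)).hasDerivWithinAt)
    (fun x hx => h0 x (by rwa [interior_Icc] at hx))

lemma antitoneOn_of_hasDerivAt_nonpos (hc : ContinuousOn F (Icc a b))
    (hd : ∀ x ∈ Ioo a b, HasDerivAt F (F' x) x) (h0 : ∀ x ∈ Ioo a b, F' x ≤ 0) :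
    AntitoneOn F (Icc a b) :=
  antitoneOn_of_hasDerivWithinAt_nonpos (convex_Icc a b) hc
    (fun x hx => (hd x (by rwa [interior_Icc] at hx)).hasDerivWithinAt)
    (fun x hx => h0 x (by rwa [interior_Icc] at hx))

end Monotone

/-! ### Monotone data -/

namespace RadialNeumann

variable {N : ℕ} {α β : ℝ} {f u k : ℝ → ℝ}

/-- At a negative minimum `c` of the flux, `u = f`. Up to the next zero of `k`, `u` decreases while
`f` increases, so `u - f ≤ 0` and `k` keeps decreasing; it can never return to zero. -/
lemma flux_nonneg (h : RadialNeumann N α β f u k) (hα : 0 ≤ α) (hf : MonotoneOn f (Icc α β)) :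
    ∀ r ∈ Icc α β, 0 ≤ k r := by
  intro r₀ hr₀
  obtain ⟨c, hc, hmin⟩ := isCompact_Icc.exists_isMinOn ⟨r₀, hr₀⟩ h.continuousOn_flux
  by_contra hneg
  have hkc : k c < 0 := (hmin hr₀).trans_lt (not_le.1 hneg)
  have hcα : α < c := lt_of_le_of_ne hc.1 fun e => by rw [← e, h.flux_left] at hkc; linarith
  have hcβ : c < β := lt_of_le_of_ne hc.2 fun e => by rw [e, h.flux_right] at hkc; linarith
  have hc0 : 0 < c := hα.trans_lt hcα
  have hg : u c - f c = 0 := by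
    have hz := (hmin.isLocalMin (Icc_mem_nhds hcα hcβ)).hasDerivAt_eq_zero
      (h.hasDerivAt_flux ⟨hcα, hcβ⟩)
    exact (mul_eq_zero.1 hz).resolve_left (by positivity)
  obtain ⟨b, hb, hb0, hlt⟩ := exists_first_zero
    (h.continuousOn_flux.mono (Icc_subset_Icc_left hc.1)) hc.2 hkc h.flux_right.ge
  have hsub : Icc c b ⊆ Icc α β := Icc_subset_Icc hc.1 hb.2
  have hsub' : Ioo c b ⊆ Ioo α β := Ioo_subset_Ioo hc.1 hb.2
  have hu : AntitoneOn u (Icc c b) := antitoneOn_of_hasDerivAt_nonpos (h.continuousOn.mono hsub)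
    (fun x hx => h.hasDerivAt (hsub' hx)) fun x hx => div_nonpos_of_nonpos_of_nonneg
      (hlt x ⟨hx.1.le, hx.2⟩).le (pow_nonneg (hc0.trans hx.1).le _)
  have hk : AntitoneOn k (Icc c b) :=
    antitoneOn_of_hasDerivAt_nonpos (h.continuousOn_flux.mono hsub)
    (fun x hx => h.hasDerivAt_flux (hsub' hx)) fun x hx => by
      have hxm := Ioo_subset_Icc_self hx
      have hcm : c ∈ Icc c b := ⟨le_rfl, hb.1.le⟩
      have h1 := hu hcm hxm hx.1.le
      have h2 := hf (hsub hcm) (hsub hxm) hx.1.le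
      exact mul_nonpos_of_nonneg_of_nonpos (pow_nonneg (hc0.trans hx.1).le _) (by linarith)
  have := hk ⟨le_rfl, hb.1.le⟩ ⟨hb.1.le, le_rfl⟩ hb.1.le
  linarith

lemma monotoneOn (h : RadialNeumann N α β f u k) (hα : 0 ≤ α) (hk : ∀ r ∈ Icc α β, 0 ≤ k r) :
    MonotoneOn u (Icc α β) :=
  monotoneOn_of_hasDerivAt_nonneg h.continuousOn (fun _ hx => h.hasDerivAt hx) fun x hx =>
    div_nonneg (hk x (Ioo_subset_Icc_self hx)) (pow_nonneg (hα.trans hx.1.le) _)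

/-- If `u < f` held at the inner end, `k' < 0` would make the flux negative immediately after its
zero there. For a nonnegative monotone right-hand side this gives `u ≥ 0`. -/
lemma rhs_le_left (h : RadialNeumann N α β f u k) (hα : 0 ≤ α) (hαβ : α < β)
    (hk : ∀ r ∈ Icc α β, 0 ≤ k r) : f α ≤ u α := by
  by_contra hcon
  have hcont := (h.continuousOn.sub h.continuousOn_rhs) α ⟨le_rfl, hαβ.le⟩
  have hev : ∀ᶠ r in 𝓝[Icc α β] α, u r - f r < 0 :=
    hcont.tendsto.eventually (gt_mem_nhds (by simpa using hcon))
  rw [nhdsWithin_Icc_eq_nhdsGE hαβ] at hev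
  obtain ⟨b, hb, hsub⟩ := mem_nhdsGE_iff_exists_Icc_subset.1 hev
  set d := min b β
  have hd : α < d := lt_min hb hαβ
  obtain ⟨c, hc, hce⟩ := exists_hasDerivAt_eq_slope k (fun r => r ^ (N - 1) * (u r - f r)) hd
    (h.continuousOn_flux.mono (Icc_subset_Icc_right (min_le_right _ _)))
    (fun x hx => h.hasDerivAt_flux ⟨hx.1, hx.2.trans_le (min_le_right _ _)⟩)
  have hc' : u c - f c < 0 := hsub ⟨hc.1.le, hc.2.le.trans (min_le_left _ _)⟩
  have hc0 : 0 < c := hα.trans_lt hc.1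
  have hneg : c ^ (N - 1) * (u c - f c) < 0 := mul_neg_of_pos_of_neg (by positivity) hc'
  rw [hce, h.flux_left, sub_zero] at hneg
  have := div_nonneg (hk d ⟨hd.le, min_le_right _ _⟩) (sub_pos.2 hd).le
  linarith

/-- For `s ≤ r` one has `k'(s) ≤ s^(N-1) u(r) ≤ N s^(N-1) u(r)`; integrate up to `r`. -/
lemma flux_le (h : RadialNeumann N α β f u k) (hN : 3 ≤ N) (hα : 0 ≤ α)
    (hk : ∀ r ∈ Icc α β, 0 ≤ k r) (hf0 : ∀ r ∈ Icc α β, 0 ≤ f r)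
    (hu0 : ∀ r ∈ Icc α β, 0 ≤ u r) : ∀ r ∈ Icc α β, k r ≤ r ^ N * u r := by
  intro r hr
  have hsub : Icc α r ⊆ Icc α β := Icc_subset_Icc_right hr.2
  have hN1 : (1 : ℝ) ≤ N := by exact_mod_cast (by omega : 1 ≤ N)
  have hanti : AntitoneOn (fun s => k s - s ^ N * u r) (Icc α r) :=
    antitoneOn_of_hasDerivAt_nonpos
      ((h.continuousOn_flux.mono hsub).sub ((continuousOn_id.pow N).mul continuousOn_const))
      (fun x hx => (h.hasDerivAt_flux ⟨hx.1, hx.2.trans_le hr.2⟩).sub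
        ((hasDerivAt_pow N x).mul_const (u r))) fun x hx => by
      have hx' := hsub (Ioo_subset_Icc_self hx)
      have h1 := h.monotoneOn hα hk hx' hr hx.2.le
      have h2 := hf0 x hx'
      have h3 := hu0 r hr
      have h4 : 0 ≤ x ^ (N - 1) := pow_nonneg (hα.trans hx.1.le) _
      have h5 : u x - f x - N * u r ≤ 0 := by nlinarith
      nlinarith
  have := hanti ⟨le_rfl, hr.1⟩ ⟨hr.1, le_rfl⟩ hr.1
  simp only [h.flux_left] at this
  nlinarith [pow_nonneg hα N, hu0 r hr]

lemma deriv_le (h : RadialNeumann N α β f u k) (hN : 3 ≤ N) (hα : 0 ≤ α) (hβ : β ≤ 1)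
    (hk : ∀ r ∈ Icc α β, 0 ≤ k r) (hf0 : ∀ r ∈ Icc α β, 0 ≤ f r)
    (hu0 : ∀ r ∈ Icc α β, 0 ≤ u r) {r : ℝ} (hr : r ∈ Ioo α β) : k r / r ^ (N - 1) ≤ u r := by
  have hr0 : 0 < r := hα.trans_lt hr.1
  have hI := Ioo_subset_Icc_self hr
  have h1 := h.flux_le hN hα hk hf0 hu0 r hI
  rw [div_le_iff₀ (by positivity)]
  have e : r ^ N = r ^ (N - 1) * r := by rw [← pow_succ]; congr 1; omega
  rw [e] at h1
  have h2 : r ^ (N - 1) * r * u r ≤ r ^ (N - 1) * 1 * u r := by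
    have := hu0 r hI
    have := hI.2.trans hβ
    gcongr
  linarith

/-- The gradient bound which makes normalised solutions equicontinuous. -/
lemma abs_sub_le (h : RadialNeumann N α β f u k) (hN : 3 ≤ N) (hα : 0 ≤ α) (hαβ : α < β)
    (hβ : β ≤ 1) (hk : ∀ r ∈ Icc α β, 0 ≤ k r) (hf0 : ∀ r ∈ Icc α β, 0 ≤ f r)
    (hu0 : ∀ r ∈ Icc α β, 0 ≤ u r) {r s : ℝ} (hr : r ∈ Icc α β) (hs : s ∈ Icc α β) :
    |u r - u s| ≤ u β * |r - s| := by
  have hmono := h.monotoneOn hα hk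
  have hanti : AntitoneOn (fun x => u x - u β * x) (Icc α β) :=
    antitoneOn_of_hasDerivAt_nonpos (h.continuousOn.sub (continuousOn_const.mul continuousOn_id))
      (fun x hx => (h.hasDerivAt hx).sub ((hasDerivAt_id x).const_mul (u β))) fun x hx => by
      have h1 := h.deriv_le hN hα hβ hk hf0 hu0 hx
      have h2 := hmono (Ioo_subset_Icc_self hx) ⟨hαβ.le, le_rfl⟩ hx.2.le
      linarith
  rcases le_total r s with hrs | hrs
  · have h1 := hmono hr hs hrs
    have h2 := hanti hr hs hrs
    rw [abs_of_nonpos (by linarith), abs_of_nonpos (by linarith)]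
    simp only at h2; linarith
  · have h1 := hmono hs hr hrs
    have h2 := hanti hs hr hrs
    rw [abs_of_nonneg (by linarith), abs_of_nonneg (by linarith)]
    simp only at h2; linarith

/-- Since `u' ≤ u`, the function `u e^(-r)` is nonincreasing, so positivity at the outer end
propagates inwards. -/
lemma pos_left (h : RadialNeumann N α β f u k) (hN : 3 ≤ N) (hα : 0 ≤ α) (hαβ : α < β)
    (hβ : β ≤ 1) (hk : ∀ r ∈ Icc α β, 0 ≤ k r) (hf0 : ∀ r ∈ Icc α β, 0 ≤ f r)
    (hu0 : ∀ r ∈ Icc α β, 0 ≤ u r) (hne : 0 < u β) : 0 < u α := by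
  have hanti : AntitoneOn (fun x => u x * Real.exp (-x)) (Icc α β) :=
    antitoneOn_of_hasDerivAt_nonpos (h.continuousOn.mul (by fun_prop))
      (fun x hx => (h.hasDerivAt hx).mul ((hasDerivAt_id x).neg.exp)) fun x hx => by
      have h1 := h.deriv_le hN hα hβ hk hf0 hu0 hx
      have h2 := Real.exp_pos (-x)
      simp only [id, Pi.neg_apply]
      nlinarith
  have := hanti ⟨le_rfl, hαβ.le⟩ ⟨hαβ.le, le_rfl⟩ hαβ.le
  have h1 : 0 < u β * Real.exp (-β) := by positivity
  simp only at this
  exact (pos_iff_pos_of_mul_pos (h1.trans_le this)).2 (Real.exp_pos _)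

end RadialNeumann

/-! ### The solution operator of the linear Neumann problem -/

section Solver

variable {N : ℕ} {α β : ℝ}

/-- The flux `∫_α^s t^(N-1) h(t) dt`. -/
def fluxInt (N : ℕ) (hle : α ≤ β) (h : C(Icc α β, ℝ)) (s : ℝ) : ℝ :=
  ∫ t in α..s, t ^ (N - 1) * IccExtend hle h t

variable {hle : α ≤ β}

lemma continuous_fluxInt_integrand (h : C(Icc α β, ℝ)) :
    Continuous fun t : ℝ => t ^ (N - 1) * IccExtend hle h t :=
  (continuous_id.pow _).mul h.continuous.Icc_extend'

lemma fluxInt_add (h g : C(Icc α β, ℝ)) (s : ℝ) :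
    fluxInt N hle (h + g) s = fluxInt N hle h s + fluxInt N hle g s := by
  unfold fluxInt
  rw [← intervalIntegral.integral_add ((continuous_fluxInt_integrand h).intervalIntegrable _ _)
    ((continuous_fluxInt_integrand g).intervalIntegrable _ _)]
  congr 1; ext t
  simp only [IccExtend, Function.comp_apply, ContinuousMap.add_apply]; ring

lemma fluxInt_smul (c : ℝ) (h : C(Icc α β, ℝ)) (s : ℝ) :
    fluxInt N hle (c • h) s = c * fluxInt N hle h s := by
  unfold fluxInt
  rw [← intervalIntegral.integral_const_mul]
  congr 1; ext t
  simp only [IccExtend, Function.comp_apply, ContinuousMap.smul_apply, smul_eq_mul]; ring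

lemma hasDerivAt_fluxInt (h : C(Icc α β, ℝ)) (s : ℝ) :
    HasDerivAt (fluxInt N hle h) (s ^ (N - 1) * IccExtend hle h s) s :=
  (continuous_fluxInt_integrand h).integral_hasStrictDerivAt α s |>.hasDerivAt

/-- The factor `1 / 3`, available because `N ≥ 3`, is what later makes `radialPrimitiveL` a
contraction on radii at most `1`. -/
lemma abs_fluxInt_le (hN : 3 ≤ N) (hα : 0 ≤ α) (h : C(Icc α β, ℝ)) {s : ℝ} (hs : α ≤ s) :
    |fluxInt N hle h s| ≤ ‖h‖ * (s ^ N / 3) := by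
  have hN3 : (3 : ℝ) ≤ N := by exact_mod_cast hN
  have h1 : ‖fluxInt N hle h s‖ ≤ ∫ t in α..s, ‖h‖ * t ^ (N - 1) := by
    refine intervalIntegral.norm_integral_le_of_norm_le hs (.of_forall fun t ht => ?_)
      (by apply Continuous.intervalIntegrable; fun_prop)
    have ht0 : 0 ≤ t := hα.trans ht.1.le
    rw [norm_mul, norm_pow, Real.norm_of_nonneg ht0, mul_comm]
    exact mul_le_mul_of_nonneg_right (h.norm_coe_le_norm _) (by positivity)
  rw [intervalIntegral.integral_const_mul, integral_pow] at h1
  refine h1.trans (mul_le_mul_of_nonneg_left ?_ (norm_nonneg h))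
  have e : N - 1 + 1 = N := by omega
  have e2 : ((N - 1 : ℕ) : ℝ) + 1 = N := by exact_mod_cast e
  rw [e, e2]
  have : 0 ≤ s ^ N := pow_nonneg (hα.trans hs) N
  exact div_le_div₀ this (by linarith [pow_nonneg hα N]) (by norm_num) hN3

lemma continuousOn_slope_fluxInt (hN : 3 ≤ N) (hα : 0 ≤ α) (h : C(Icc α β, ℝ)) :
    ContinuousOn (fun s => fluxInt N hle h s / s ^ (N - 1)) (Icc α β) := by
  intro s hs
  rcases eq_or_lt_of_le (hα.trans hs.1) with h0 | h0
  · rw [← h0, ContinuousWithinAt, zero_pow (by omega), div_zero]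
    have hlim : Tendsto (fun s : ℝ => ‖h‖ * s) (𝓝[Icc α β] 0) (𝓝 0) := by
      have : Tendsto (fun s : ℝ => ‖h‖ * s) (𝓝 0) (𝓝 (‖h‖ * 0)) :=
        (continuous_const.mul continuous_id).tendsto 0
      rw [mul_zero] at this
      exact this.mono_left nhdsWithin_le_nhds
    refine squeeze_zero_norm' ?_ hlim
    filter_upwards [self_mem_nhdsWithin] with t ht
    rcases eq_or_lt_of_le (hα.trans ht.1) with ht0 | ht0
    · rw [← ht0, zero_pow (by omega)]; simp
    have hb := abs_fluxInt_le (hle := hle) hN hα h ht.1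
    rw [norm_div, norm_pow, Real.norm_eq_abs, Real.norm_of_nonneg ht0.le,
      div_le_iff₀ (by positivity)]
    have e : t ^ N = t * t ^ (N - 1) := by rw [← pow_succ']; congr 1; omega
    rw [e] at hb
    have : 0 ≤ ‖h‖ * (t * t ^ (N - 1)) := by positivity
    linarith
  · exact (hasDerivAt_fluxInt h s).continuousAt.continuousWithinAt.div
      (continuousWithinAt_id.pow _) (by positivity)

/-- The inverse of the radial Laplacian with zero data at the left end point. -/
def radialPrimitive (hN : 3 ≤ N) (hα : 0 ≤ α) (hle : α ≤ β) (h : C(Icc α β, ℝ)) :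
    C(Icc α β, ℝ) where
  toFun r := ∫ s in α..r, IccExtend hle
    ((Icc α β).domRestrict fun s => fluxInt N hle h s / s ^ (N - 1)) s
  continuous_toFun := by
    have hc : Continuous (IccExtend hle
        ((Icc α β).domRestrict fun s => fluxInt N hle h s / s ^ (N - 1))) :=
      (continuousOn_slope_fluxInt hN hα h).domRestrict.Icc_extend'
    exact (intervalIntegral.continuous_primitive (fun a b => hc.intervalIntegrable a b) α).comp
      continuous_subtype_val

lemma radialPrimitive_apply (hN : 3 ≤ N) (hα : 0 ≤ α) (h : C(Icc α β, ℝ)) (r : Icc α β) :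
    radialPrimitive hN hα hle h r = ∫ s in α..r, fluxInt N hle h s / s ^ (N - 1) := by
  refine intervalIntegral.integral_congr fun s hs => ?_
  rw [uIcc_of_le r.2.1] at hs
  exact IccExtend_of_mem _ _ ⟨hs.1, hs.2.trans r.2.2⟩

lemma intervalIntegrable_slope_fluxInt (hN : 3 ≤ N) (hα : 0 ≤ α) (h : C(Icc α β, ℝ))
    (r : Icc α β) :
    IntervalIntegrable (fun s => fluxInt N hle h s / s ^ (N - 1)) volume α r := by
  refine ContinuousOn.intervalIntegrable ?_
  rw [uIcc_of_le r.2.1]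
  exact (continuousOn_slope_fluxInt hN hα h).mono (Icc_subset_Icc_right r.2.2)

/-- `radialPrimitive` as a bounded linear operator. -/
def radialPrimitiveL (hN : 3 ≤ N) (hα : 0 ≤ α) (hle : α ≤ β) (hβ : β ≤ 1) :
    C(Icc α β, ℝ) →L[ℝ] C(Icc α β, ℝ) :=
  LinearMap.mkContinuous
    { toFun := radialPrimitive hN hα hle
      map_add' := fun h g => by
        ext r
        rw [ContinuousMap.add_apply, radialPrimitive_apply, radialPrimitive_apply,
          radialPrimitive_apply, ← intervalIntegral.integral_add
          (intervalIntegrable_slope_fluxInt hN hα h r) (intervalIntegrable_slope_fluxInt hN hα g r)]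
        congr 1; ext s
        rw [fluxInt_add, add_div]
      map_smul' := fun c h => by
        ext r
        rw [ContinuousMap.smul_apply, radialPrimitive_apply, radialPrimitive_apply, smul_eq_mul,
          RingHom.id_apply, ← intervalIntegral.integral_const_mul]
        congr 1; ext s
        rw [fluxInt_smul, mul_div_assoc] }
    (1 / 3) fun h => by
      rw [ContinuousMap.norm_le _ (by positivity)]
      intro r
      change ‖radialPrimitive hN hα hle h r‖ ≤ _
      rw [radialPrimitive_apply]
      refine (intervalIntegral.norm_integral_le_of_norm_le_const (C := 1 / 3 * ‖h‖)
        fun s hs => ?_).trans ?_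
      · rw [uIoc_of_le r.2.1] at hs
        have hs0 : 0 < s := hα.trans_lt hs.1
        have hs1 : s ≤ 1 := hs.2.trans (r.2.2.trans hβ)
        have hb := abs_fluxInt_le (hle := hle) hN hα h hs.1.le
        rw [norm_div, norm_pow, Real.norm_eq_abs, Real.norm_of_nonneg hs0.le,
          div_le_iff₀ (by positivity)]
        have e : s ^ N = s * s ^ (N - 1) := by rw [← pow_succ']; congr 1; omega
        rw [e] at hb
        refine hb.trans ?_
        have : s * s ^ (N - 1) ≤ 1 * s ^ (N - 1) := by gcongr
        nlinarith [norm_nonneg h]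
      · have h1 : |(r : ℝ) - α| ≤ 1 := by
          rw [abs_of_nonneg (by linarith [r.2.1])]; linarith [r.2.2]
        nlinarith [norm_nonneg h]

/-- There is a bounded linear operator which solves the linear Neumann problem. -/
theorem exists_neumannSolver (hN : 3 ≤ N) (hα : 0 ≤ α) (hαβ : α < β) (hβ : β ≤ 1) :
    ∃ T : C(Icc α β, ℝ) →L[ℝ] C(Icc α β, ℝ), ∀ f : C(Icc α β, ℝ), ∃ k : ℝ → ℝ,
      RadialNeumann N α β (IccExtend hαβ.le f) (IccExtend hαβ.le (T f)) k := by
  -- A solution of the initial value problem at the inner end satisfies `w = A + K (w - f)` with `A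
  -- = w(α)`. As `‖K‖ < 1`, the operator `S = (1 - K)⁻¹` gives `w = A S 1 - S K f`, and only the
  -- constant `A` remains to be chosen.
  set K := radialPrimitiveL hN hα hαβ.le hβ with hK
  have hKn : ‖K‖ ≤ 1 / 3 := LinearMap.mkContinuous_norm_le _ (by norm_num) _
  set S : C(Icc α β, ℝ) →L[ℝ] C(Icc α β, ℝ) :=
    ((Units.oneSub K (hKn.trans_lt (by norm_num)))⁻¹).val with hS
  have hSeq : ∀ h, S h = h + K (S h) := by
    intro h
    have : (1 - K) * S = 1 := by
      rw [hS, ← Units.val_oneSub K (hKn.trans_lt (by norm_num))]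
      exact Units.mul_inv _
    have h2 := congrArg (fun L : C(Icc α β, ℝ) →L[ℝ] C(Icc α β, ℝ) => L h) this
    simp only [mul_apply_eq_comp, sub_apply, one_apply_eq_self] at h2
    exact sub_eq_iff_eq_add.1 h2
  have hSn : ∀ h, ‖S h‖ ≤ 3 / 2 * ‖h‖ := by
    intro h
    have h1 : ‖S h‖ ≤ ‖h‖ + 1 / 3 * ‖S h‖ := by
      conv_lhs => rw [hSeq h]
      refine (norm_add_le _ _).trans (add_le_add_right ?_ _)
      exact (K.le_opNorm _).trans (mul_le_mul_of_nonneg_right hKn (norm_nonneg _))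
    linarith
  let J : C(Icc α β, ℝ) →L[ℝ] ℝ := LinearMap.mkContinuous
    { toFun := fun h => fluxInt N hαβ.le h β
      map_add' := fun h g => fluxInt_add h g β
      map_smul' := fun c h => fluxInt_smul c h β } 1 fun h => by
      refine (abs_fluxInt_le (hle := hαβ.le) hN hα h hαβ.le).trans ?_
      have : β ^ N ≤ 1 := pow_le_one₀ (hα.trans hαβ.le) hβ
      nlinarith [norm_nonneg h]
  have hJ : ∀ h, J h = fluxInt N hαβ.le h β := fun h => rfl
  set φ := S 1 with hφ
  -- `φ = 1 + K φ` and `‖K φ‖ ≤ 1/3 · 3/2`. This lower bound makes the flux of `φ` at the outer end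
  -- nonzero.
  have hφ1 : ∀ r, 1 / 2 ≤ φ r := by
    intro r
    have h1 : φ r = 1 + K φ r := by
      have := congrArg (fun g : C(Icc α β, ℝ) => g r) (hSeq 1)
      simpa using this
    have h2 : |K φ r| ≤ 1 / 2 := by
      refine ((K φ).norm_coe_le_norm r).trans ((K.le_opNorm φ).trans ?_)
      have h3 := hSn 1
      have : Nonempty (Icc α β) := ⟨⟨α, le_rfl, hαβ.le⟩⟩
      rw [norm_one] at h3
      have := mul_le_mul hKn h3 (norm_nonneg _) (by norm_num)
      linarith
    rw [h1]; linarith [(abs_le.1 h2).1]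
  have hJφ : 0 < J φ := by
    rw [hJ, fluxInt]
    refine intervalIntegral.intervalIntegral_pos_of_pos_on
      ((continuous_fluxInt_integrand φ).intervalIntegrable _ _) (fun t ht => ?_) hαβ
    have : 0 < t := hα.trans_lt ht.1
    have h2 : 0 < IccExtend hαβ.le φ t := (by norm_num : (0 : ℝ) < 1 / 2).trans_le (hφ1 _)
    positivity
  -- This choice of `A` solves `J (T f) = J f`, which says that the flux of `T f - f` vanishes at
  -- the outer end.
  let A : C(Icc α β, ℝ) →L[ℝ] ℝ := (J φ)⁻¹ • (J + J.comp (S.comp K))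
  refine ⟨A.smulRight φ - S.comp K, fun f => ?_⟩
  set T := A.smulRight φ - S.comp K
  have hTf : T f = A f • φ - S (K f) := rfl
  have hw : T f = A f • 1 + K (T f - f) := by
    have e1 : K (T f) = A f • K φ - K (S (K f)) := by rw [hTf, map_sub, map_smul]
    rw [map_sub, e1, hTf]
    conv_lhs => rw [hSeq (K f), hφ, hSeq 1, ← hφ, smul_add]
    abel
  have hJw : J (T f) = J f := by
    rw [hTf, map_sub, map_smul]
    have : A f = (J φ)⁻¹ * (J f + J (S (K f))) := rfl
    rw [this, smul_eq_mul]
    field_simp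
    ring
  refine ⟨fluxInt N hαβ.le (T f - f), ?_, ?_, ?_, ?_, ?_⟩
  · exact f.continuous.Icc_extend'.continuousOn
  · intro r hr
    have hc : Continuous (IccExtend hαβ.le ((Icc α β).domRestrict
        fun s => fluxInt N hαβ.le (T f - f) s / s ^ (N - 1))) :=
      (continuousOn_slope_fluxInt hN hα _).domRestrict.Icc_extend'
    have hd := ((hc.integral_hasStrictDerivAt α r).hasDerivAt.const_add (A f)).hasDerivWithinAt
      (s := Icc α β)
    rw [IccExtend_of_mem _ _ hr] at hd
    refine HasDerivWithinAt.congr_of_mem hd (fun s hs => ?_) hr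
    rw [IccExtend_of_mem _ _ hs]
    have := congrArg (fun g : C(Icc α β, ℝ) => g ⟨s, hs⟩) hw
    simp only [ContinuousMap.add_apply, ContinuousMap.smul_apply, ContinuousMap.one_apply,
      smul_eq_mul, mul_one] at this
    exact this
  · intro r hr
    have hd := (hasDerivAt_fluxInt (N := N) (hle := hαβ.le) (T f - f) r).hasDerivWithinAt
      (s := Icc α β)
    refine hd.congr_deriv ?_
    simp [IccExtend]
  · simp [fluxInt]
  · rw [← hJ, map_sub, hJw, sub_self]

end Solver

/-! ### The cone and the quotient -/

section Cone

variable {N : ℕ} {p α β : ℝ} {f u v w k : ℝ → ℝ}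

lemma integrable_inner_of_memLp {μ : Measure (Space N)} {g G : Space N → Space N}
    (hg : MemLp g 2 μ) (hG : MemLp G 2 μ) : Integrable (fun x => inner ℝ (g x) (G x)) μ :=
  (hg.norm.integrable_mul hG.norm).mono (hg.1.inner hG.1) (.of_forall fun x => by
    simpa using abs_real_inner_le_norm (g x) (G x))

lemma MemCone.congr (hv : MemCone N α β v) (h : EqOn v w (Icc α β)) : MemCone N α β w where
  continuousOn := hv.continuousOn.congr h.symm
  memH1 := by
    have hr : EqOn (radial N v) (radial N w) (shell N α β) := fun x hx => h (norm_mem_Icc hx)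
    obtain ⟨_, g, hg⟩ := hv.memH1
    exact ⟨memLp_radial (hv.continuousOn.congr h.symm) 2, g, hg.congr measurableSet_shell hr⟩
  nonneg r hr := by rw [← h hr]; exact hv.nonneg r hr
  monotoneOn := hv.monotoneOn.congr h

lemma MemCone.isWeakGradient (hv : MemCone N α β v) :
    IsWeakGradient (shell N α β) (radial N v) (weakGradient (shell N α β) (radial N v)) :=
  isWeakGradient_weakGradient hv.memH1.2

lemma MemCone.const_mul (hv : MemCone N α β v) {c : ℝ} (hc : 0 ≤ c) :
    MemCone N α β (fun r => c * v r) where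
  continuousOn := continuousOn_const.mul hv.continuousOn
  memH1 := ⟨memLp_radial (continuousOn_const.mul hv.continuousOn) 2, _,
    hv.isWeakGradient.const_mul c⟩
  nonneg r hr := mul_nonneg hc (hv.nonneg r hr)
  monotoneOn _ hr _ hs hrs := mul_le_mul_of_nonneg_left (hv.monotoneOn hr hs hrs) hc

lemma RadialNeumann.memCone (h : RadialNeumann N α β f u k) (hN : 3 ≤ N) (hα : 0 ≤ α)
    (hαβ : α < β) (hk : ∀ r ∈ Icc α β, 0 ≤ k r) (hu0 : ∀ r ∈ Icc α β, 0 ≤ u r) :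
    MemCone N α β u where
  continuousOn := h.continuousOn
  memH1 := ⟨memLp_radial h.continuousOn 2, _, h.isWeakGradient hN hα hαβ⟩
  nonneg := hu0
  monotoneOn := h.monotoneOn hα hk

lemma MemCone.pos_right (hv : MemCone N α β v) (hαβ : α < β) (h : ∃ r ∈ Icc α β, v r ≠ 0) :
    0 < v β := by
  obtain ⟨r, hr, hne⟩ := h
  exact ((hv.nonneg r hr).lt_of_ne' hne).trans_le (hv.monotoneOn hr ⟨hαβ.le, le_rfl⟩ hr.2)

lemma Q_congr (h : EqOn v w (Icc α β)) (hv : MemCone N α β v) : Q N p α β v = Q N p α β w := by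
  have hr : EqOn (radial N v) (radial N w) (shell N α β) := fun x hx => h (norm_mem_Icc hx)
  have h1 : h1NormSq (shell N α β) (radial N v) = h1NormSq (shell N α β) (radial N w) := by
    rw [h1NormSq_eq isOpen_shell hv.isWeakGradient,
      h1NormSq_eq isOpen_shell (hv.isWeakGradient.congr measurableSet_shell hr)]
    exact setIntegral_congr_fun measurableSet_shell fun x hx => by simp only [hr hx]
  have h2 : ∫ x in shell N α β, |radial N v x| ^ (p + 1) =
      ∫ x in shell N α β, |radial N w x| ^ (p + 1) :=
    setIntegral_congr_fun measurableSet_shell fun x hx => by simp only [hr hx]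
  rw [Q, Q, h1, lqNorm, lqNorm, h2]

lemma Q_const_mul (hp : 1 < p) (hv : MemCone N α β v) {c : ℝ} (hc : 0 < c) :
    Q N p α β (fun r => c * v r) = Q N p α β v := by
  have h1 : h1NormSq (shell N α β) (radial N fun r => c * v r) =
      c ^ 2 * h1NormSq (shell N α β) (radial N v) := by
    have hg : IsWeakGradient (shell N α β) (radial N fun r => c * v r) _ :=
      hv.isWeakGradient.const_mul c
    rw [h1NormSq_eq isOpen_shell hg, h1NormSq, ← integral_const_mul]
    congr 1; ext x
    rw [norm_smul, mul_pow, Real.norm_eq_abs, sq_abs]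
    simp only [radial]; ring
  have h2 : lqNorm (p + 1) (shell N α β) (radial N fun r => c * v r) =
      c * lqNorm (p + 1) (shell N α β) (radial N v) := by
    unfold lqNorm
    have : ∀ x : Space N, |radial N (fun r => c * v r) x| ^ (p + 1) =
        c ^ (p + 1) * |radial N v x| ^ (p + 1) := fun x => by
      simp only [radial]
      rw [abs_mul, abs_of_pos hc, Real.mul_rpow hc.le (abs_nonneg _)]
    simp only [this, integral_const_mul]
    rw [Real.mul_rpow (by positivity) (integral_nonneg fun x => by positivity),
      ← Real.rpow_mul hc.le, mul_one_div_cancel (by linarith), Real.rpow_one]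
  rw [Q, Q, h1, h2, mul_pow, mul_div_mul_left _ _ (by positivity)]

/-- Positivity at the outer end persists on an interval of radii, hence on an open subset of the
shell. -/
lemma integral_radial_pos (hN : 3 ≤ N) (hα : 0 ≤ α) (hαβ : α < β)
    (hv : ContinuousOn v (Icc α β)) (h0 : ∀ r ∈ Icc α β, 0 ≤ v r) (hpos : 0 < v β) :
    0 < ∫ x in shell N α β, v ‖x‖ := by
  have hβm : β ∈ Icc α β := ⟨hαβ.le, le_rfl⟩
  have hev : ∀ᶠ r in 𝓝[Icc α β] β, 0 < v r := (hv β hβm).tendsto.eventually (lt_mem_nhds hpos)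
  rw [nhdsWithin_Icc_eq_nhdsLE hαβ] at hev
  obtain ⟨a, ha, hsub⟩ := (mem_nhdsLE_iff_exists_Ioc_subset' hαβ).1 hev
  rw [mem_Iio] at ha
  have hm : max a α < β := max_lt ha hαβ
  obtain ⟨x₀, hx₀⟩ := exists_norm_eq hN (r := (max a α + β) / 2)
    (by have := le_max_right a α; linarith)
  rw [setIntegral_pos_iff_support_of_nonneg_ae]
  · have hopen : IsOpen {x : Space N | max a α < ‖x‖ ∧ ‖x‖ < β} :=
      (isOpen_lt continuous_const continuous_norm).inter (isOpen_lt continuous_norm continuous_const)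
    refine (hopen.measure_pos volume ⟨x₀, ?_⟩).trans_le (measure_mono fun x hx => ?_)
    · constructor <;> rw [hx₀] <;> linarith
    · have h1 : a < ‖x‖ := (le_max_left _ _).trans_lt hx.1
      exact ⟨(hsub ⟨h1, hx.2.le⟩ : 0 < v ‖x‖).ne', mem_shell ((le_max_right _ _).trans_lt hx.1) hx.2⟩
  · exact (ae_restrict_iff' measurableSet_shell).2 (.of_forall fun x hx => h0 _ (norm_mem_Icc hx))
  · exact integrable_radial hv

lemma rpow_continuousOn (hp : 0 ≤ p) (hv : ContinuousOn v (Icc α β)) :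
    ContinuousOn (fun r => v r ^ p) (Icc α β) := hv.rpow_const fun _ _ => Or.inr hp

lemma lqNorm_eq (hv : ∀ r ∈ Icc α β, 0 ≤ v r) (q : ℝ) :
    lqNorm q (shell N α β) (radial N v) = (∫ x in shell N α β, v ‖x‖ ^ q) ^ (1 / q) := by
  unfold lqNorm
  congr 1
  refine setIntegral_congr_fun measurableSet_shell fun x hx => ?_
  simp only [radial, abs_of_nonneg (hv _ (norm_mem_Icc hx))]

/-- Green's formula tested with the solution itself. The energy is thereby expressed without
derivatives, so it passes to uniform limits of the data and the solution. -/
lemma RadialNeumann.h1NormSq_eq (h : RadialNeumann N α β f u k) (hN : 3 ≤ N) (hα : 0 ≤ α)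
    (hαβ : α < β) (hk : ∀ r ∈ Icc α β, 0 ≤ k r) :
    h1NormSq (shell N α β) (radial N u) = ∫ x in shell N α β, f ‖x‖ * u ‖x‖ := by
  have hg := h.isWeakGradient hN hα hαβ
  rw [NeumannLayer.h1NormSq_eq isOpen_shell hg, ← h.green hN hα hαβ hk h.continuousOn hg,
    ← integral_add]
  · congr 1; ext x
    rw [real_inner_self_eq_norm_sq]
    simp only [radial]; ring
  · exact integrable_inner_of_memLp hg.memLp hg.memLp
  · exact integrable_radial (N := N) (h.continuousOn.mul h.continuousOn)

/-- One step of the inverse iteration `v ↦ (-Δ + 1)⁻¹ v^p` does not increase the quotient, and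
leaves it unchanged only if it is a multiplication by a constant. -/
lemma Q_inverse_iteration (hN : 3 ≤ N) (hα : 0 ≤ α) (hαβ : α < β) (hp : 1 < p)
    (hv : MemCone N α β v) (hvβ : 0 < v β)
    (hw : RadialNeumann N α β (fun r => v r ^ p) w k) :
    MemCone N α β w ∧ 0 < w β ∧ Q N p α β w ≤ Q N p α β v ∧
      (Q N p α β v ≤ Q N p α β w → ∃ c, 0 < c ∧ EqOn v (fun r => c * w r) (Icc α β)) := by
  have hf0 : ∀ r ∈ Icc α β, 0 ≤ v r ^ p := fun r hr => Real.rpow_nonneg (hv.nonneg r hr) p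
  have hfm : MonotoneOn (fun r => v r ^ p) (Icc α β) := fun r hr s hs hrs =>
    Real.rpow_le_rpow (hv.nonneg r hr) (hv.monotoneOn hr hs hrs) (by linarith)
  have hk := hw.flux_nonneg hα hfm
  have hαm : α ∈ Icc α β := ⟨le_rfl, hαβ.le⟩
  have hβm : β ∈ Icc α β := ⟨hαβ.le, le_rfl⟩
  have hw0 : ∀ r ∈ Icc α β, 0 ≤ w r := fun r hr =>
    ((hf0 α hαm).trans (hw.rhs_le_left hα hαβ hk)).trans (hw.monotoneOn hα hk hαm hr hr.1)
  have hcone := hw.memCone hN hα hαβ hk hw0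
  set Ω := shell N α β with hΩ
  set μ := volume.restrict Ω with hμ
  set g := weakGradient Ω (radial N v) with hg
  set G := radialGrad N (fun r => v r ^ p) w k with hG
  have hgw : IsWeakGradient Ω (radial N v) g := hv.isWeakGradient
  have hGw : IsWeakGradient Ω (radial N w) G := hw.isWeakGradient hN hα hαβ
  set A := ∫ x in Ω, v ‖x‖ ^ (p + 1) with hA
  set B := ∫ x in Ω, w ‖x‖ ^ (p + 1) with hB
  set hv1 := h1NormSq Ω (radial N v) with hhv
  set hw1 := h1NormSq Ω (radial N w) with hhw
  have hApos : 0 < A := integral_radial_pos (v := fun r => v r ^ (p + 1)) hN hα hαβ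
    (rpow_continuousOn (by linarith) hv.continuousOn)
    (fun r hr => Real.rpow_nonneg (hv.nonneg r hr) _) (Real.rpow_pos_of_pos hvβ _)
  -- The `H¹` inner product of `v` and `w` equals `∫ v^(p+1)`, since `w` solves the problem with
  -- right-hand side `v^p`.
  have hgreen : (∫ x in Ω, inner ℝ (g x) (G x)) + ∫ x in Ω, w ‖x‖ * v ‖x‖ = A := by
    rw [hw.green hN hα hαβ hk hv.continuousOn hgw]
    refine setIntegral_congr_fun measurableSet_shell fun x hx => ?_
    rw [Real.rpow_add_one' (hv.nonneg _ (norm_mem_Icc hx)) (by linarith)]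
  have hw1eq : hw1 = ∫ x in Ω, v ‖x‖ ^ p * w ‖x‖ := hw.h1NormSq_eq hN hα hαβ hk
  have i1 : Integrable (fun x => ‖g x‖ ^ 2 + radial N v x ^ 2) μ :=
    hgw.memLp.norm.integrable_sq.add (memLp_radial hv.continuousOn 2).integrable_sq
  have i2 : Integrable (fun x => ‖G x‖ ^ 2 + radial N w x ^ 2) μ :=
    hGw.memLp.norm.integrable_sq.add (memLp_radial hw.continuousOn 2).integrable_sq
  have i3a : Integrable (fun x => inner ℝ (g x) (G x)) μ :=
    integrable_inner_of_memLp hgw.memLp hGw.memLp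
  have i3b : Integrable (fun x => w ‖x‖ * v ‖x‖) μ :=
    integrable_radial (N := N) (hw.continuousOn.mul hv.continuousOn)
  -- The squared `H¹` distance from `v` to `t w`. Its nonnegativity yields Cauchy–Schwarz, and its
  -- vanishing at `t = A / hw1` yields the equality case.
  have quad : ∀ t : ℝ, ∫ x in Ω, (‖g x - t • G x‖ ^ 2 + (v ‖x‖ - t * w ‖x‖) ^ 2) =
      hv1 - 2 * t * A + t ^ 2 * hw1 := by
    intro t
    have e : ∀ x, ‖g x - t • G x‖ ^ 2 + (v ‖x‖ - t * w ‖x‖) ^ 2 =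
        (‖g x‖ ^ 2 + radial N v x ^ 2) - 2 * t * (inner ℝ (g x) (G x) + w ‖x‖ * v ‖x‖) +
          t ^ 2 * (‖G x‖ ^ 2 + radial N w x ^ 2) := by
      intro x
      rw [norm_sub_sq_real, real_inner_smul_right, norm_smul, mul_pow, Real.norm_eq_abs, sq_abs]
      simp only [radial]; ring
    simp only [e]
    have i3 : Integrable (fun x => 2 * t * (inner ℝ (g x) (G x) + w ‖x‖ * v ‖x‖)) μ :=
      (i3a.add i3b).const_mul (2 * t)
    have i4 : Integrable (fun x => ‖g x‖ ^ 2 + radial N v x ^ 2 -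
      2 * t * (inner ℝ (g x) (G x) + w ‖x‖ * v ‖x‖)) μ := i1.sub i3
    rw [integral_add i4 (i2.const_mul (t ^ 2)), integral_sub i1 i3, integral_const_mul,
      integral_const_mul]
    rw [show (∫ x in Ω, (inner ℝ (g x) (G x) + w ‖x‖ * v ‖x‖)) = A by
      rw [← hgreen, integral_add i3a i3b], hhw, NeumannLayer.h1NormSq_eq isOpen_shell hGw]
    rfl
  have quad0 : ∀ t : ℝ, 0 ≤ hv1 - 2 * t * A + t ^ 2 * hw1 := fun t => by
    rw [← quad t]; exact integral_nonneg fun x => by positivity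
  have hhw0 : 0 ≤ hw1 := integral_nonneg fun x => by positivity
  have hhwpos : 0 < hw1 := by
    refine hhw0.lt_of_ne fun e => ?_
    -- If `hw1` were zero the quadratic would be affine in `t`; at this `t` it would equal `-1`.
    have := quad0 ((hv1 + 1) / (2 * A))
    rw [← e, mul_zero, add_zero] at this
    have e2 : 2 * ((hv1 + 1) / (2 * A)) * A = hv1 + 1 := by field_simp
    linarith
  have hwβ : 0 < w β := by
    refine (hw0 β hβm).lt_of_ne fun e => ?_
    have hz : ∀ r ∈ Icc α β, w r = 0 := fun r hr =>
      le_antisymm (e ▸ hw.monotoneOn hα hk hr hβm hr.2) (hw0 r hr)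
    have : hw1 = 0 := by
      rw [hw1eq]
      exact setIntegral_eq_zero_of_forall_eq_zero fun x hx => by rw [hz _ (norm_mem_Icc hx), mul_zero]
    linarith
  have hBpos : 0 < B := integral_radial_pos (v := fun r => w r ^ (p + 1)) hN hα hαβ
    (rpow_continuousOn (by linarith) hw.continuousOn)
    (fun r hr => Real.rpow_nonneg (hw0 r hr) _) (Real.rpow_pos_of_pos hwβ _)
  have hCS : A ^ 2 ≤ hv1 * hw1 := by
    have := quad0 (A / hw1)
    have e : hv1 - 2 * (A / hw1) * A + (A / hw1) ^ 2 * hw1 = (hv1 * hw1 - A ^ 2) / hw1 := by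
      field_simp; ring
    rw [e] at this
    have := (div_nonneg_iff.1 this).resolve_right fun h => by linarith [h.2]
    linarith [this.1]
  -- Hölder with exponents `(p + 1) / p` and `p + 1` applied to `‖w‖²_{H¹} = ∫ v^p w`.
  have hholder : hw1 ≤ A ^ (p / (p + 1)) * B ^ (1 / (p + 1)) := by
    have hconj : ((p + 1) / p).HolderConjugate (p + 1) := by
      rw [Real.holderConjugate_iff]
      refine ⟨by rw [lt_div_iff₀ (by linarith)]; linarith, ?_⟩
      have : p ≠ 0 := by linarith
      have : p + 1 ≠ 0 := by linarith
      field_simp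
    have hh := integral_mul_le_Lp_mul_Lq_of_nonneg (μ := μ) hconj
      (f := fun x : Space N => v ‖x‖ ^ p) (g := fun x => w ‖x‖)
      ((ae_restrict_iff' measurableSet_shell).2 (.of_forall fun x hx => hf0 _ (norm_mem_Icc hx)))
      ((ae_restrict_iff' measurableSet_shell).2 (.of_forall fun x hx => hw0 _ (norm_mem_Icc hx)))
      (memLp_radial (N := N) hw.continuousOn_rhs _) (memLp_radial (N := N) hw.continuousOn _)
    rw [← hw1eq] at hh
    have e : ∫ x in Ω, (v ‖x‖ ^ p) ^ ((p + 1) / p) = A := by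
      refine setIntegral_congr_fun measurableSet_shell fun x hx => ?_
      rw [← Real.rpow_mul (hv.nonneg _ (norm_mem_Icc hx)), mul_div_cancel₀ _ (by linarith)]
    rw [e, one_div_div] at hh
    exact hh
  set a := A ^ (1 / (p + 1)) with ha
  set b := B ^ (1 / (p + 1)) with hb
  have hapos : 0 < a := Real.rpow_pos_of_pos hApos _
  have hbpos : 0 < b := Real.rpow_pos_of_pos hBpos _
  set a' := A ^ (p / (p + 1)) with ha'
  have hapos' : 0 < a' := Real.rpow_pos_of_pos hApos _
  have haa : a' * a = A := by
    rw [ha', ha, ← Real.rpow_add hApos, ← add_div, div_self (by linarith), Real.rpow_one]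
  have hQv : Q N p α β v = hv1 / a ^ 2 := by rw [Q, lqNorm_eq hv.nonneg]
  have hQw : Q N p α β w = hw1 / b ^ 2 := by rw [Q, lqNorm_eq hw0]
  rw [← haa] at hCS
  have hsq : hw1 ^ 2 ≤ (a' * b) ^ 2 := pow_le_pow_left₀ hhw0 hholder 2
  refine ⟨hcone, hwβ, ?_, fun hle => ?_⟩
  · rw [hQv, hQw, div_le_div_iff₀ (by positivity) (by positivity)]
    refine le_of_mul_le_mul_left ?_ hhwpos
    calc hw1 * (hw1 * a ^ 2) = hw1 ^ 2 * a ^ 2 := by ring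
      _ ≤ (a' * b) ^ 2 * a ^ 2 := by gcongr
      _ = (a' * a) ^ 2 * b ^ 2 := by ring
      _ ≤ (hv1 * hw1) * b ^ 2 := by gcongr
      _ = hw1 * (hv1 * b ^ 2) := by ring
  · rw [hQv, hQw, div_le_div_iff₀ (by positivity) (by positivity)] at hle
    -- Equal quotients force equality in Cauchy–Schwarz; equality in Hölder is not needed.
    have heq : hv1 * hw1 ≤ A ^ 2 := by
      refine le_of_mul_le_mul_right ?_ (by positivity : 0 < b ^ 2)
      calc hv1 * hw1 * b ^ 2 = hw1 * (hv1 * b ^ 2) := by ring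
        _ ≤ hw1 * (hw1 * a ^ 2) := by gcongr
        _ = hw1 ^ 2 * a ^ 2 := by ring
        _ ≤ (a' * b) ^ 2 * a ^ 2 := by gcongr
        _ = A ^ 2 * b ^ 2 := by rw [← haa]; ring
    refine ⟨A / hw1, by positivity, ?_⟩
    set t := A / hw1 with ht
    have hz : ∫ x in Ω, (‖g x - t • G x‖ ^ 2 + (v ‖x‖ - t * w ‖x‖) ^ 2) = 0 := by
      refine le_antisymm ?_ (integral_nonneg fun x => by positivity)
      rw [quad t]
      have e : hv1 - 2 * t * A + t ^ 2 * hw1 = (hv1 * hw1 - A ^ 2) / hw1 := by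
        rw [ht]; field_simp; ring
      rw [e]
      exact div_nonpos_of_nonpos_of_nonneg (by linarith) hhw0
    have iz : Integrable (fun x => ‖g x - t • G x‖ ^ 2 + (v ‖x‖ - t * w ‖x‖) ^ 2) μ :=
      ((hgw.memLp.sub (hGw.memLp.const_smul t)).norm.integrable_sq).add
        (memLp_radial (N := N) (hv.continuousOn.sub
          (continuousOn_const.mul hw.continuousOn)) 2).integrable_sq
    rw [integral_eq_zero_iff_of_nonneg (fun x => by positivity) iz] at hz
    refine eqOn_Icc_of_ae_eq hN hα hαβ hv.continuousOn (continuousOn_const.mul hw.continuousOn) ?_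
    filter_upwards [hz] with x hx
    simp only [Pi.zero_apply] at hx
    have h1 : (v ‖x‖ - t * w ‖x‖) ^ 2 = 0 := by
      nlinarith [sq_nonneg (v ‖x‖ - t * w ‖x‖), sq_nonneg ‖g x - t • G x‖]
    have h2 := pow_eq_zero_iff (two_ne_zero) |>.1 h1
    simp only [radial]
    linarith

end Cone

/-! ### Existence of minimizers -/

section Existence

variable {N : ℕ} {p α β : ℝ}

/-- The normalised profiles among which a minimizer is found. -/
def normalizedProfiles (hαβ : α < β) : Set C(Icc α β, ℝ) :=
  {w | (∀ r s, |w r - w s| ≤ |(r : ℝ) - s|) ∧ Monotone w ∧ (∀ r, 0 ≤ w r) ∧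
    w ⟨β, hαβ.le, le_rfl⟩ = 1}

/-- Arzelà–Ascoli: the Lipschitz bound gives equicontinuity. It also makes every pointwise limit
continuous, so the image in the product of copies of `[0, 1]` is closed. -/
lemma isCompact_normalizedProfiles (hαβ : α < β) : IsCompact (normalizedProfiles hαβ) := by
  refine ArzelaAscoli.isCompact_of_equicontinuous _ ?_ ?_
  · have himg : ContinuousMap.toFun '' normalizedProfiles hαβ =
        {w : Icc α β → ℝ | (∀ r s, |w r - w s| ≤ |(r : ℝ) - s|) ∧ Monotone w ∧ (∀ r, 0 ≤ w r) ∧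
          w ⟨β, hαβ.le, le_rfl⟩ = 1} := by
      ext w
      constructor
      · rintro ⟨w, hw, rfl⟩; exact hw
      · intro hw
        have hc : Continuous w := (LipschitzWith.of_dist_le_mul (K := 1) fun r s => by
          simpa [Real.dist_eq, Subtype.dist_eq] using hw.1 r s).continuous
        exact ⟨⟨w, hc⟩, hw, rfl⟩
    rw [himg]
    refine (isCompact_univ_pi fun _ : Icc α β => isCompact_Icc (a := (0 : ℝ)) (b := 1)).of_isClosed_subset
      ?_ fun w hw => ?_
    · have ev : ∀ r : Icc α β, Continuous fun w : Icc α β → ℝ => w r := fun r => continuous_apply r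
      simp only [Monotone, ofPred_and, ofPred_forall]
      refine IsClosed.inter (isClosed_iInter fun r => isClosed_iInter fun s =>
        isClosed_le ((ev r).sub (ev s)).abs continuous_const) (IsClosed.inter
          (isClosed_iInter fun r => isClosed_iInter fun s => isClosed_iInter fun _ =>
            isClosed_le (ev r) (ev s)) (IsClosed.inter (isClosed_iInter fun r =>
              isClosed_le continuous_const (ev r)) (isClosed_eq (ev _) continuous_const)))
    · intro r _
      exact ⟨hw.2.2.1 r, hw.2.2.2 ▸ hw.2.1 (show r ≤ ⟨β, hαβ.le, le_rfl⟩ from r.2.2)⟩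
  · refine LipschitzWith.uniformEquicontinuous (K := 1) _ (fun w => ?_) |>.equicontinuous
    exact LipschitzWith.of_dist_le_mul fun r s => by
      simpa [Real.dist_eq, Subtype.dist_eq] using w.2.1 r s

/-- Integration over the shell of the radial function with a given profile. -/
lemma continuous_integral_radial (hle : α ≤ β) :
    Continuous fun h : C(Icc α β, ℝ) => ∫ x in shell N α β, IccExtend hle h ‖x‖ := by
  refine (LipschitzWith.of_dist_le_mul (K := (volume.restrict (shell N α β)).real univ |>.toNNReal)
    fun h g => ?_).continuous
  have hi : ∀ h : C(Icc α β, ℝ), Integrable (fun x : Space N => IccExtend hle h ‖x‖)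
      (volume.restrict (shell N α β)) := fun h =>
    integrable_radial (N := N) h.continuous.Icc_extend'.continuousOn
  rw [Real.dist_eq, ← integral_sub (hi h) (hi g), Real.coe_toNNReal _ measureReal_nonneg, mul_comm]
  have hb : ∀ x : Space N, ‖IccExtend hle h ‖x‖ - IccExtend hle g ‖x‖‖ ≤ dist h g := fun x => by
    rw [← dist_eq_norm]
    exact ContinuousMap.dist_apply_le_dist (f := h) (g := g) _
  exact norm_integral_le_of_norm_le_const (μ := volume.restrict (shell N α β)) (.of_forall hb)

/-- Composition of a profile with a power. -/
def powProfile (q : ℝ) (hq : 0 ≤ q) (w : C(Icc α β, ℝ)) : C(Icc α β, ℝ) :=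
  (⟨fun t => |t| ^ q, continuous_abs.rpow_const fun _ => Or.inr hq⟩ : C(ℝ, ℝ)).comp w

lemma continuous_powProfile (q : ℝ) (hq : 0 ≤ q) :
    Continuous (powProfile q hq : C(Icc α β, ℝ) → C(Icc α β, ℝ)) :=
  ContinuousMap.continuous_postcomp _

/-- The quotient attains its minimum over the nonzero elements of the cone. -/
theorem exists_minimizer (hN : 3 ≤ N) (hα : 0 ≤ α) (hαβ : α < β) (hβ : β ≤ 1) (hp : 1 < p) :
    ∃ u, MemCone N α β u ∧ 0 < u β ∧
      ∀ v, MemCone N α β v → 0 < v β → Q N p α β u ≤ Q N p α β v := by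
  obtain ⟨T, hT⟩ := exists_neumannSolver hN hα hαβ hβ
  have hp0 : 0 ≤ p := by linarith
  have hp1 : 0 ≤ p + 1 := by linarith
  have hβm : β ∈ Icc α β := ⟨hαβ.le, le_rfl⟩
  set P : C(Icc α β, ℝ) → C(Icc α β, ℝ) := powProfile p hp0 with hP
  have coneIcc : ∀ w : C(Icc α β, ℝ), w ∈ normalizedProfiles hαβ →
      (∀ r ∈ Icc α β, 0 ≤ IccExtend hαβ.le w r) ∧ MonotoneOn (IccExtend hαβ.le w) (Icc α β) ∧
        IccExtend hαβ.le w β = 1 := by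
    intro w hw
    refine ⟨fun r _ => hw.2.2.1 _, (hw.2.1.IccExtend _).monotoneOn _, ?_⟩
    rw [IccExtend_of_mem _ _ hβm]; exact hw.2.2.2
  have Peq : ∀ w : C(Icc α β, ℝ), (∀ r ∈ Icc α β, 0 ≤ IccExtend hαβ.le w r) →
      IccExtend hαβ.le (P w) = fun r => IccExtend hαβ.le w r ^ p := by
    intro w hw
    ext r
    have h0 := hw _ (projIcc α β hαβ.le r).2
    rw [IccExtend_of_mem _ _ (projIcc α β hαβ.le r).2] at h0
    have h1 : IccExtend hαβ.le (P w) r = |w (projIcc α β hαβ.le r)| ^ p := rfl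
    rw [h1, abs_of_nonneg h0]
    rfl
  -- the value of the quotient after one step
  set J : C(Icc α β, ℝ) → ℝ := fun w =>
    (∫ x in shell N α β, IccExtend hαβ.le (P w * T (P w)) ‖x‖) /
      ((∫ x in shell N α β, IccExtend hαβ.le (powProfile (p + 1) hp1 (T (P w))) ‖x‖) ^
        (1 / (p + 1))) ^ 2 with hJ
  have step : ∀ w ∈ normalizedProfiles hαβ,
      MemCone N α β (IccExtend hαβ.le (T (P w))) ∧ 0 < IccExtend hαβ.le (T (P w)) β ∧
      0 < ∫ x in shell N α β, IccExtend hαβ.le (powProfile (p + 1) hp1 (T (P w))) ‖x‖ ∧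
        Q N p α β (IccExtend hαβ.le (T (P w))) = J w := by
    intro w hw
    obtain ⟨c0, cm, cβ⟩ := coneIcc w hw
    obtain ⟨k, hk⟩ := hT (P w)
    have hf0 : ∀ r ∈ Icc α β, 0 ≤ IccExtend hαβ.le (P w) r := fun r hr => by
      rw [Peq w c0]; exact Real.rpow_nonneg (c0 r hr) p
    have hfm : MonotoneOn (IccExtend hαβ.le (P w)) (Icc α β) := fun r hr s hs hrs => by
      rw [Peq w c0]
      exact Real.rpow_le_rpow (c0 r hr) (cm hr hs hrs) (by linarith)
    have hkn := hk.flux_nonneg hα hfm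
    have hαm : α ∈ Icc α β := ⟨le_rfl, hαβ.le⟩
    have hu0 : ∀ r ∈ Icc α β, 0 ≤ IccExtend hαβ.le (T (P w)) r := fun r hr =>
      ((hf0 α hαm).trans (hk.rhs_le_left hα hαβ hkn)).trans (hk.monotoneOn hα hkn hαm hr hr.1)
    have hcone := hk.memCone hN hα hαβ hkn hu0
    have hpos : 0 < IccExtend hαβ.le (T (P w)) β := by
      refine (hu0 β hβm).lt_of_ne fun e => ?_
      have hz : ∀ r ∈ Icc α β, IccExtend hαβ.le (T (P w)) r = 0 := fun r hr =>
        le_antisymm (e ▸ hk.monotoneOn hα hkn hr hβm hr.2) (hu0 r hr)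
      -- Testing with the constant `1` gives `∫ T (P w) = ∫ P w`. The right side is positive because
      -- the normalised profile equals `1` at the outer end, so the image cannot vanish.
      have hg := hk.green hN hα hαβ hkn (v := fun _ => 1) (g := fun _ => 0) continuousOn_const
        { memLp := MemLp.zero'
          integral_eq := fun φ h1 h2 h3 v => by
            have hzero := isWeakGradient_of_hasFDerivAt (f := fun _ : Space N => (1 : ℝ))
              (g := fun _ => 0) (Ω := shell N α β) isOpen_shell continuousOn_const MemLp.zero'
              (fun x _ => by simpa using hasFDerivAt_const (1 : ℝ) x)
            exact hzero.integral_eq φ h1 h2 h3 v }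
      have hpos := integral_radial_pos (v := fun r => IccExtend hαβ.le (P w) r * 1) hN hα hαβ
        (hk.continuousOn_rhs.mul continuousOn_const) (fun r hr => by simpa using hf0 r hr) (by
          rw [Peq w c0]; simp only [cβ]; simp)
      rw [← hg] at hpos
      have e2 : ∫ x in shell N α β, IccExtend hαβ.le (T (P w)) ‖x‖ * 1 = 0 :=
        setIntegral_eq_zero_of_forall_eq_zero fun x hx => by rw [hz _ (norm_mem_Icc hx), zero_mul]
      rw [e2] at hpos
      simp at hpos
    have hpw : ∀ x ∈ shell N α β, IccExtend hαβ.le (powProfile (p + 1) hp1 (T (P w))) ‖x‖ =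
        IccExtend hαβ.le (T (P w)) ‖x‖ ^ (p + 1) := by
      intro x hx
      have h0 := hu0 _ (norm_mem_Icc hx)
      rw [IccExtend_of_mem _ _ (norm_mem_Icc hx)] at h0 ⊢
      have h1 : powProfile (p + 1) hp1 (T (P w)) ⟨‖x‖, norm_mem_Icc hx⟩ =
        |T (P w) ⟨‖x‖, norm_mem_Icc hx⟩| ^ (p + 1) := rfl
      rw [h1, abs_of_nonneg h0, IccExtend_of_mem _ _ (norm_mem_Icc hx)]
    have hint : ∫ x in shell N α β, IccExtend hαβ.le (powProfile (p + 1) hp1 (T (P w))) ‖x‖ =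
        ∫ x in shell N α β, IccExtend hαβ.le (T (P w)) ‖x‖ ^ (p + 1) :=
      setIntegral_congr_fun measurableSet_shell hpw
    refine ⟨hcone, hpos, ?_, ?_⟩
    · rw [hint]
      exact integral_radial_pos (v := fun r => IccExtend hαβ.le (T (P w)) r ^ (p + 1)) hN hα hαβ
        (rpow_continuousOn hp1 hk.continuousOn)
        (fun r hr => Real.rpow_nonneg (hu0 r hr) _) (Real.rpow_pos_of_pos hpos _)
    · rw [Q, hk.h1NormSq_eq hN hα hαβ hkn, lqNorm_eq hu0]
      simp only [hJ]
      rw [hint]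
      rfl
  -- No gradient occurs in `J`, so uniform convergence of profiles is enough; this is why the
  -- quotient is minimised after one step of the iteration.
  have hJc : ContinuousOn J (normalizedProfiles hαβ) := by
    have hPc : Continuous P := continuous_powProfile p hp0
    have c1 : Continuous fun w => ∫ x in shell N α β, IccExtend hαβ.le (P w * T (P w)) ‖x‖ :=
      (continuous_integral_radial hαβ.le).comp (hPc.mul (T.continuous.comp hPc))
    have c2 : Continuous fun w => ∫ x in shell N α β,
        IccExtend hαβ.le (powProfile (p + 1) hp1 (T (P w))) ‖x‖ :=
      (continuous_integral_radial hαβ.le).comp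
        ((continuous_powProfile (p + 1) hp1).comp (T.continuous.comp hPc))
    refine c1.continuousOn.div ((c2.continuousOn.rpow_const fun w hw =>
      Or.inl (step w hw).2.2.1.ne').pow 2) fun w hw => ?_
    exact pow_ne_zero 2 (Real.rpow_pos_of_pos (step w hw).2.2.1 _).ne'
  have hne : (normalizedProfiles hαβ).Nonempty :=
    ⟨1, fun r s => by simp, fun r s _ => by simp, fun r => by simp, by simp⟩
  obtain ⟨w, hw, hmin⟩ := (isCompact_normalizedProfiles hαβ).exists_isMinOn hne hJc
  obtain ⟨s1, s2, s3, s4⟩ := step w hw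
  refine ⟨_, s1, s2, fun v hv hvβ => ?_⟩
  -- compare with the normalised image of `v`
  set fv : C(Icc α β, ℝ) := ⟨(Icc α β).domRestrict fun r => v r ^ p,
    (rpow_continuousOn hp0 hv.continuousOn).domRestrict⟩ with hfv
  obtain ⟨k, hk⟩ := hT fv
  have hk' : RadialNeumann N α β (fun r => v r ^ p) (IccExtend hαβ.le (T fv)) k :=
    hk.congr_rhs fun r hr => IccExtend_of_mem _ _ hr
  obtain ⟨d1, d2, d3, -⟩ := Q_inverse_iteration hN hα hαβ hp hv hvβ hk'
  set m := IccExtend hαβ.le (T fv) β with hm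
  have hf0 : ∀ r ∈ Icc α β, 0 ≤ v r ^ p := fun r hr => Real.rpow_nonneg (hv.nonneg r hr) p
  have hkn := hk'.flux_nonneg hα fun r hr s hs hrs =>
    Real.rpow_le_rpow (hv.nonneg r hr) (hv.monotoneOn hr hs hrs) hp0
  have hval : ∀ r : Icc α β, T fv r = IccExtend hαβ.le (T fv) r := fun r =>
    (IccExtend_of_mem _ _ r.2).symm
  set w' : C(Icc α β, ℝ) := m⁻¹ • T fv with hw'
  have hw'v : ∀ r : Icc α β, w' r = m⁻¹ * IccExtend hαβ.le (T fv) r := fun r => by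
    rw [← hval]; rfl
  have hmem : w' ∈ normalizedProfiles hαβ := by
    refine ⟨fun r s => ?_, fun r s hrs => ?_, fun r => ?_, ?_⟩
    · rw [hw'v, hw'v, ← mul_sub, abs_mul, abs_of_pos (inv_pos.2 d2)]
      have := hk'.abs_sub_le hN hα hαβ hβ hkn hf0 d1.nonneg r.2 s.2
      rw [inv_mul_le_iff₀ d2]; exact this
    · rw [hw'v, hw'v]
      exact mul_le_mul_of_nonneg_left (d1.monotoneOn r.2 s.2 hrs) (inv_pos.2 d2).le
    · rw [hw'v]; exact mul_nonneg (inv_pos.2 d2).le (d1.nonneg r r.2)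
    · rw [hw'v]; exact inv_mul_cancel₀ d2.ne'
  have hext : IccExtend hαβ.le w' = fun r => m⁻¹ * IccExtend hαβ.le (T fv) r := rfl
  have hcone' : MemCone N α β (IccExtend hαβ.le w') := by
    rw [hext]; exact d1.const_mul (inv_pos.2 d2).le
  obtain ⟨k2, hk2⟩ := hT (P w')
  rw [Peq w' (coneIcc w' hmem).1] at hk2
  obtain ⟨-, -, e3, -⟩ := Q_inverse_iteration hN hα hαβ hp hcone'
    (by rw [(coneIcc w' hmem).2.2]; exact one_pos) hk2
  -- An arbitrary `v` is iterated once and normalised, which puts it in the compact set, and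
  -- iterated again so that `J` applies. Neither iteration raises the quotient, and scaling
  -- preserves it.
  calc Q N p α β (IccExtend hαβ.le (T (P w))) = J w := s4
    _ ≤ J w' := hmin hmem
    _ = Q N p α β (IccExtend hαβ.le (T (P w'))) := (step w' hmem).2.2.2.symm
    _ ≤ Q N p α β (IccExtend hαβ.le w') := e3
    _ = Q N p α β (IccExtend hαβ.le (T fv)) := by
      rw [hext]; exact Q_const_mul hp d1 (inv_pos.2 d2)
    _ ≤ Q N p α β v := d3

/-- A minimizer is a multiple of a solution of the nonlinear problem. -/
theorem solution_of_minimizer (hN : 3 ≤ N) (hα : 0 ≤ α) (hαβ : α < β) (hβ : β ≤ 1) (hp : 1 < p)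
    {v : ℝ → ℝ} (hv : MemCone N α β v) (hvβ : 0 < v β)
    (hmin : ∀ w, MemCone N α β w → 0 < w β → Q N p α β v ≤ Q N p α β w) :
    ∃ u k : ℝ → ℝ, RadialNeumann N α β (fun r => u r ^ p) u k ∧ MemCone N α β u ∧ 0 < u β ∧
      ∃ t, 0 < t ∧ EqOn v (fun r => t * u r) (Icc α β) := by
  obtain ⟨T, hT⟩ := exists_neumannSolver hN hα hαβ hβ
  have hp0 : 0 ≤ p := by linarith
  have hβm : β ∈ Icc α β := ⟨hαβ.le, le_rfl⟩
  obtain ⟨k, hk⟩ := hT ⟨(Icc α β).domRestrict fun r => v r ^ p,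
    (rpow_continuousOn hp0 hv.continuousOn).domRestrict⟩
  replace hk := hk.congr_rhs (f' := fun r => v r ^ p) fun r hr => IccExtend_of_mem _ _ hr
  generalize IccExtend hαβ.le _ = w at hk
  obtain ⟨d1, d2, d3, d4⟩ := Q_inverse_iteration hN hα hαβ hp hv hvβ hk
  obtain ⟨c, hc, heq⟩ := d4 (hmin w d1 d2)
  -- `v = c w`; the multiple `s v` solves the problem for `s ^ (p - 1) = c`
  set s := c ^ (1 / (p - 1)) with hs
  have hspos : 0 < s := Real.rpow_pos_of_pos hc _
  have hsp : s ^ p = s * c := by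
    have h1 : s ^ (p - 1) = c := by
      rw [hs, ← Real.rpow_mul hc.le, one_div_mul_cancel (by linarith), Real.rpow_one]
    have h2 := Real.rpow_add_one hspos.ne' (p - 1)
    rw [sub_add_cancel, h1] at h2
    rw [h2, mul_comm]
  have hsc : 0 < s * c := by positivity
  refine ⟨fun r => s * c * w r, fun r => s * c * k r, ?_, d1.const_mul hsc.le, by positivity,
    s⁻¹, inv_pos.2 hspos, fun r hr => ?_⟩
  · refine (hk.const_mul (s * c)).congr_rhs fun r hr => ?_
    have hvr := hv.nonneg r hr
    have he : v r = c * w r := heq hr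
    simp only
    rw [mul_assoc s c (w r), ← he, Real.mul_rpow hspos.le hvr, hsp]
  · rw [heq hr]
    field_simp

end Existence

/-! ### Increasing solutions of the nonlinear problem -/

/-- `u` is the profile of a nondecreasing solution of `-Δu + u = u^p` with Neumann boundary
conditions, `k` is its flux, and `u` lies below `1` at the inner boundary by the margin `η`. -/
structure LayerSolution (N : ℕ) (p α β η : ℝ) (u k : ℝ → ℝ) : Prop where
  three_le : 3 ≤ N
  left_nonneg : 0 ≤ α
  left_lt_right : α < β
  right_le_one : β ≤ 1
  one_lt_exponent : 1 < p
  margin_pos : 0 < η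
  radialNeumann : RadialNeumann N α β (fun r => u r ^ p) u k
  flux_nonneg : ∀ r ∈ Icc α β, 0 ≤ k r
  nonneg : ∀ r ∈ Icc α β, 0 ≤ u r
  pos_right : 0 < u β
  left_le : u α ≤ 1 - η

/-! ### The power `t ^ p` on either side of `t = 1` -/

lemma rpow_lt_self_of_lt_one {t p : ℝ} (hp : 1 < p) (h0 : 0 < t) (h1 : t < 1) : t ^ p < t := by
  simpa using Real.rpow_lt_rpow_of_exponent_gt h0 h1 hp

lemma rpow_le_self_of_le_one {t p : ℝ} (hp : 1 < p) (h0 : 0 ≤ t) (h1 : t ≤ 1) : t ^ p ≤ t := by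
  simpa using Real.rpow_le_rpow_of_exponent_ge_of_imp h0 h1 hp.le (by intro _ h; linarith)

lemma self_le_rpow_of_one_le {t p : ℝ} (hp : 1 < p) (h1 : 1 ≤ t) : t ≤ t ^ p := by
  simpa using Real.rpow_le_rpow_of_exponent_le h1 hp.le

namespace LayerSolution

variable {N : ℕ} {p α β η : ℝ} {u k : ℝ → ℝ}

lemma left_mem (S : LayerSolution N p α β η u k) : α ∈ Icc α β := ⟨le_rfl, S.left_lt_right.le⟩

lemma right_mem (S : LayerSolution N p α β η u k) : β ∈ Icc α β := ⟨S.left_lt_right.le, le_rfl⟩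

lemma continuousOn (S : LayerSolution N p α β η u k) : ContinuousOn u (Icc α β) :=
  S.radialNeumann.continuousOn

lemma continuousOn_flux (S : LayerSolution N p α β η u k) : ContinuousOn k (Icc α β) :=
  S.radialNeumann.continuousOn_flux

lemma hasDerivAt (S : LayerSolution N p α β η u k) {r : ℝ} (hr : r ∈ Ioo α β) :
    HasDerivAt u (k r / r ^ (N - 1)) r := S.radialNeumann.hasDerivAt hr

lemma hasDerivAt_flux (S : LayerSolution N p α β η u k) {r : ℝ} (hr : r ∈ Ioo α β) :
    HasDerivAt k (r ^ (N - 1) * (u r - u r ^ p)) r := S.radialNeumann.hasDerivAt_flux hr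

lemma monotoneOn (S : LayerSolution N p α β η u k) : MonotoneOn u (Icc α β) :=
  S.radialNeumann.monotoneOn S.left_nonneg S.flux_nonneg

lemma pos (S : LayerSolution N p α β η u k) {r : ℝ} (hr : r ∈ Icc α β) : 0 < u r :=
  (S.radialNeumann.pos_left S.three_le S.left_nonneg S.left_lt_right S.right_le_one S.flux_nonneg
    (fun r hr => Real.rpow_nonneg (S.nonneg r hr) p) S.nonneg S.pos_right).trans_le
    (S.monotoneOn S.left_mem hr hr.1)

lemma radius_pos (S : LayerSolution N p α β η u k) {r : ℝ} (hr : r ∈ Ioo α β) : 0 < r :=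
  S.left_nonneg.trans_lt hr.1

/-- The sign of `k'` is that of `u - u^p`: the flux grows while `u ≤ 1` and, by the companion
`flux_antitoneOn`, falls once `u ≥ 1`. -/
lemma flux_monotoneOn (S : LayerSolution N p α β η u k) {b : ℝ} (hb : b ∈ Icc α β)
    (hu : u b ≤ 1) : MonotoneOn k (Icc α b) := by
  refine monotoneOn_of_hasDerivAt_nonneg (S.continuousOn_flux.mono (Icc_subset_Icc_right hb.2))
    (fun x hx => S.hasDerivAt_flux ⟨hx.1, hx.2.trans_le hb.2⟩) fun x hx => ?_
  have hx' : x ∈ Icc α β := ⟨hx.1.le, hx.2.le.trans hb.2⟩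
  have h1 := S.monotoneOn hx' hb hx.2.le
  exact mul_nonneg (pow_nonneg (S.left_nonneg.trans hx.1.le) _)
    (sub_nonneg.2 (rpow_le_self_of_le_one S.one_lt_exponent (S.pos hx').le (h1.trans hu)))

lemma flux_antitoneOn (S : LayerSolution N p α β η u k) {b : ℝ} (hb : b ∈ Icc α β)
    (hu : 1 ≤ u b) : AntitoneOn k (Icc b β) := by
  refine antitoneOn_of_hasDerivAt_nonpos (S.continuousOn_flux.mono (Icc_subset_Icc_left hb.1))
    (fun x hx => S.hasDerivAt_flux ⟨hb.1.trans_lt hx.1, hx.2⟩) fun x hx => ?_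
  have hx' : x ∈ Icc α β := ⟨hb.1.trans hx.1.le, hx.2.le⟩
  have h1 := S.monotoneOn hb hx' hx.1.le
  exact mul_nonpos_of_nonneg_of_nonpos (pow_nonneg (S.left_nonneg.trans hx'.1) _)
    (sub_nonpos.2 (self_le_rpow_of_one_le S.one_lt_exponent (hu.trans h1)))

/-- An interior zero of `k ≥ 0` is a minimum, so `u = u^p`, that is `u = 1`, there. Monotonicity of
the flux below the level `1` then makes `k` vanish all the way to the inner end, so `u = 1` there,
which the margin excludes. -/
lemma flux_pos (S : LayerSolution N p α β η u k) {r : ℝ} (hr : r ∈ Ioo α β) : 0 < k r := by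
  have key : ∀ r ∈ Ioo α β, k r = 0 → u r = 1 := by
    intro r hr h0
    have hmin : IsLocalMin k r := by
      filter_upwards [Icc_mem_nhds hr.1 hr.2] with s hs
      rw [h0]; exact S.flux_nonneg s hs
    have hz := hmin.hasDerivAt_eq_zero (S.hasDerivAt_flux hr)
    have hr0 := S.radius_pos hr
    have hz' : u r - u r ^ p = 0 := (mul_eq_zero.1 hz).resolve_left (by positivity)
    have hu := S.pos (Ioo_subset_Icc_self hr)
    have hp := S.one_lt_exponent
    rcases lt_trichotomy (u r) 1 with h | h | h
    · have := rpow_lt_self_of_lt_one hp hu h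
      linarith
    · exact h
    · have : u r < u r ^ p := by simpa using Real.rpow_lt_rpow_of_exponent_lt h hp
      linarith
  refine (S.flux_nonneg r (Ioo_subset_Icc_self hr)).lt_of_ne fun h0 => ?_
  have hu := key r hr h0.symm
  have hm := S.flux_monotoneOn (Ioo_subset_Icc_self hr) hu.le
  have h1 : ∀ s ∈ Ioo α r, u s = 1 := fun s hs => key s ⟨hs.1, hs.2.trans hr.2⟩ <|
    le_antisymm (h0 ▸ hm ⟨hs.1.le, hs.2.le⟩ ⟨hr.1.le, le_rfl⟩ hs.2.le)
      (S.flux_nonneg s ⟨hs.1.le, hs.2.le.trans hr.2.le⟩)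
  have hcl : α ∈ closure (Ioo α r) := by rw [closure_Ioo hr.1.ne]; exact ⟨le_rfl, hr.1.le⟩
  have hge : 1 ≤ u α := by
    have hcw : ContinuousWithinAt u (Ioo α r) α :=
      (S.continuousOn α S.left_mem).mono fun x hx => ⟨hx.1.le, hx.2.le.trans hr.2.le⟩
    exact continuousWithinAt_const.closure_le hcl hcw fun x hx => (h1 x hx).ge
  linarith [S.left_le, S.margin_pos]

lemma strictMonoOn (S : LayerSolution N p α β η u k) : StrictMonoOn u (Icc α β) := by
  refine strictMonoOn_of_deriv_pos (convex_Icc α β) S.continuousOn fun r hr => ?_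
  rw [interior_Icc] at hr
  rw [(S.hasDerivAt hr).deriv]
  have := S.radius_pos hr
  have := S.flux_pos hr
  positivity

/-- If `u` never exceeded `1`, the flux would be nondecreasing on the whole interval and could not
return from a positive value to zero. -/
lemma exists_eq_one (S : LayerSolution N p α β η u k) : ∃ b ∈ Ioo α β, u b = 1 := by
  have hlt : 1 < u β := by
    by_contra hcon
    have hm := S.flux_monotoneOn S.right_mem (not_lt.1 hcon)
    obtain ⟨m, hmid⟩ := exists_between S.left_lt_right
    change m ∈ Ioo α β at hmid
    have h1 := hm (Ioo_subset_Icc_self hmid) S.right_mem hmid.2.le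
    rw [S.radialNeumann.flux_right] at h1
    linarith [S.flux_pos hmid]
  have hlt' : u α < 1 := by linarith [S.left_le, S.margin_pos]
  exact intermediate_value_Ioo S.left_lt_right.le S.continuousOn ⟨hlt', hlt⟩

/-! ### Bounds for flux, slope and energy -/

lemma sub_rpow_le_one (S : LayerSolution N p α β η u k) {r : ℝ} (hr : r ∈ Icc α β) :
    u r - u r ^ p ≤ 1 := by
  rcases le_total (u r) 1 with h | h
  · linarith [Real.rpow_nonneg (S.pos hr).le p]
  · linarith [self_le_rpow_of_one_le S.one_lt_exponent h]

lemma flux_le_pow (S : LayerSolution N p α β η u k) {r : ℝ} (hr : r ∈ Icc α β) : k r ≤ r ^ N := by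
  have hN1 : (1 : ℝ) ≤ N := by exact_mod_cast (by have := S.three_le; omega : 1 ≤ N)
  have hanti : AntitoneOn (fun s => k s - s ^ N) (Icc α β) :=
    antitoneOn_of_hasDerivAt_nonpos (S.continuousOn_flux.sub (continuousOn_id.pow N))
      (fun x hx => (S.hasDerivAt_flux hx).sub (hasDerivAt_pow N x)) fun x hx => by
      have h1 := S.sub_rpow_le_one (Ioo_subset_Icc_self hx)
      have h4 : 0 ≤ x ^ (N - 1) := pow_nonneg (S.radius_pos hx).le _
      nlinarith
  have := hanti S.left_mem hr hr.1
  simp only [S.radialNeumann.flux_left] at this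
  linarith [pow_nonneg S.left_nonneg N]

lemma deriv_le_radius (S : LayerSolution N p α β η u k) {r : ℝ} (hr : r ∈ Ioo α β) :
    k r / r ^ (N - 1) ≤ r := by
  have hr0 := S.radius_pos hr
  rw [div_le_iff₀ (by positivity)]
  have e : r * r ^ (N - 1) = r ^ N := by
    rw [← pow_succ']; congr 1; have := S.three_le; omega
  rw [e]; exact S.flux_le_pow (Ioo_subset_Icc_self hr)

lemma radius_le_one (S : LayerSolution N p α β η u k) {r : ℝ} (hr : r ∈ Icc α β) : r ≤ 1 :=
  hr.2.trans S.right_le_one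

lemma flux_le_one (S : LayerSolution N p α β η u k) {r : ℝ} (hr : r ∈ Icc α β) : k r ≤ 1 :=
  (S.flux_le_pow hr).trans (pow_le_one₀ (S.left_nonneg.trans hr.1) (S.radius_le_one hr))

lemma sub_le_sub (S : LayerSolution N p α β η u k) {r s : ℝ} (hr : r ∈ Icc α β)
    (hs : s ∈ Icc α β) (hrs : r ≤ s) : u s - u r ≤ s - r := by
  have hanti : AntitoneOn (fun x => u x - x) (Icc α β) :=
    antitoneOn_of_hasDerivAt_nonpos (S.continuousOn.sub continuousOn_id)
      (fun x hx => (S.hasDerivAt hx).sub (hasDerivAt_id x)) fun x hx => by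
      linarith [S.deriv_le_radius hx, S.radius_le_one (Ioo_subset_Icc_self hx)]
  have := hanti hr hs hrs
  simp only at this
  linarith

lemma flux_sub_le_sub (S : LayerSolution N p α β η u k) {r s : ℝ} (hr : r ∈ Icc α β)
    (hs : s ∈ Icc α β) (hrs : r ≤ s) : k s - k r ≤ s - r := by
  have hanti : AntitoneOn (fun x => k x - x) (Icc α β) :=
    antitoneOn_of_hasDerivAt_nonpos (S.continuousOn_flux.sub continuousOn_id)
      (fun x hx => (S.hasDerivAt_flux hx).sub (hasDerivAt_id x)) fun x hx => by
      have h1 := S.sub_rpow_le_one (Ioo_subset_Icc_self hx)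
      have h4 : 0 ≤ x ^ (N - 1) := pow_nonneg (S.radius_pos hx).le _
      have h5 : x ^ (N - 1) ≤ 1 :=
        pow_le_one₀ (S.radius_pos hx).le (S.radius_le_one (Ioo_subset_Icc_self hx))
      nlinarith
  have := hanti hr hs hrs
  simp only at this
  linarith

lemma right_le_two (S : LayerSolution N p α β η u k) : u β ≤ 2 := by
  have := S.sub_le_sub S.left_mem S.right_mem S.left_lt_right.le
  linarith [S.left_le, S.margin_pos, S.left_nonneg, S.right_le_one]

/-- The point where `u = 1` is away from the origin, and the flux there is bounded below. -/
lemma margin_le (S : LayerSolution N p α β η u k) {b : ℝ} (hb : b ∈ Ioo α β) (hu : u b = 1) :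
    η ≤ b ∧ η ^ N ≤ k b := by
  obtain ⟨ξ, hξ, hslope⟩ := exists_hasDerivAt_eq_slope u (fun r => k r / r ^ (N - 1)) hb.1
    (S.continuousOn.mono (Icc_subset_Icc_right hb.2.le))
    (fun x hx => S.hasDerivAt ⟨hx.1, hx.2.trans hb.2⟩)
  have hξ' : ξ ∈ Ioo α β := ⟨hξ.1, hξ.2.trans hb.2⟩
  have hξ0 := S.radius_pos hξ'
  have hη := S.margin_pos
  have hba : 0 < b - α := sub_pos.2 hb.1
  -- The profile climbs at least `η` over a distance at most `1`, so its slope is at least `η`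
  -- somewhere before the level `1`. The flux increases from there to `b`.
  have h1 : η ≤ k ξ / ξ ^ (N - 1) := by
    rw [hslope, le_div_iff₀ hba]
    have : b - α ≤ 1 := by linarith [S.left_nonneg, S.right_le_one, hb.2]
    nlinarith [S.left_le]
  have h2 := h1.trans (S.deriv_le_radius hξ')
  refine ⟨h2.trans hξ.2.le, ?_⟩
  rw [le_div_iff₀ (by positivity)] at h1
  have e : η * η ^ (N - 1) = η ^ N := by
    rw [← pow_succ']; congr 1; have := S.three_le; omega
  have h3 : η * η ^ (N - 1) ≤ η * ξ ^ (N - 1) := by gcongr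
  have h4 := S.flux_monotoneOn (Ioo_subset_Icc_self hb) hu.le ⟨hξ.1.le, hξ.2.le⟩
    ⟨hb.1.le, le_rfl⟩ hξ.2.le
  linarith

/-- The potential of the nonlinearity. -/
def potential (p t : ℝ) : ℝ := t ^ (p + 1) / (p + 1) - t ^ 2 / 2

lemma hasDerivAt_potential (S : LayerSolution N p α β η u k) {r : ℝ} (hr : r ∈ Ioo α β) :
    HasDerivAt (fun r => potential p (u r)) ((u r ^ p - u r) * (k r / r ^ (N - 1))) r := by
  have hp := S.one_lt_exponent
  have h1 := (S.hasDerivAt hr).rpow_const (p := p + 1) (Or.inr (by linarith))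
  have h2 := (S.hasDerivAt hr).fun_pow 2
  refine ((h1.div_const (p + 1)).fun_sub (h2.div_const 2)).congr_deriv ?_
  have : p + 1 ≠ 0 := by linarith
  rw [add_sub_cancel_right]
  field_simp
  push_cast
  ring

lemma continuousOn_potential (S : LayerSolution N p α β η u k) :
    ContinuousOn (fun r => potential p (u r)) (Icc α β) := by
  have hp := S.one_lt_exponent
  exact ((S.continuousOn.rpow_const fun x hx => Or.inr (by linarith)).div_const _).sub
    ((S.continuousOn.pow 2).div_const 2)

/-- The energy `k² / 2 + a F(u)` has derivative `k (u^p - u) (a r^(1-N) - r^(N-1))`. -/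
lemma hasDerivAt_energy (S : LayerSolution N p α β η u k) (a : ℝ) {r : ℝ} (hr : r ∈ Ioo α β) :
    HasDerivAt (fun r => k r ^ 2 / 2 + a * potential p (u r))
      (k r * (u r ^ p - u r) * (a - (r ^ (N - 1)) ^ 2) / r ^ (N - 1)) r := by
  have hr0 := S.radius_pos hr
  refine ((((S.hasDerivAt_flux hr).fun_pow 2).div_const 2).fun_add
    ((S.hasDerivAt_potential hr).const_mul a)).congr_deriv ?_
  have : r ^ (N - 1) ≠ 0 := by positivity
  field_simp
  push_cast
  ring

/-- For `a = 1 ≥ r^(2(N-1))` the energy is nondecreasing once `u ≥ 1`. Comparing the level `1`,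
where `k ≥ η^N`, with the outer end, where `k = 0`, makes `u(β)^(p+1)` at least linear in `p`. -/
lemma energy_lower (S : LayerSolution N p α β η u k) :
    (p + 1) * (η ^ N) ^ 2 / 2 ≤ u β ^ (p + 1) := by
  obtain ⟨b, hb, hub⟩ := S.exists_eq_one
  obtain ⟨hηb, hkb⟩ := S.margin_le hb hub
  have hp := S.one_lt_exponent
  have hmono : MonotoneOn (fun r => k r ^ 2 / 2 + 1 * potential p (u r)) (Icc b β) := by
    refine monotoneOn_of_hasDerivAt_nonneg (ContinuousOn.mono
      (((S.continuousOn_flux.pow 2).div_const 2).add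
        (continuousOn_const.mul S.continuousOn_potential)) (Icc_subset_Icc_left hb.1.le))
      (fun x hx => S.hasDerivAt_energy 1 ⟨hb.1.trans hx.1, hx.2⟩) fun x hx => ?_
    have hx' : x ∈ Ioo α β := ⟨hb.1.trans hx.1, hx.2⟩
    have h0 := S.radius_pos hx'
    have h1 := S.flux_nonneg x (Ioo_subset_Icc_self hx')
    have h2 := self_le_rpow_of_one_le hp
      (hub ▸ S.monotoneOn (Ioo_subset_Icc_self hb) (Ioo_subset_Icc_self hx') hx.1.le)
    have h3 : (x ^ (N - 1)) ^ 2 ≤ 1 := pow_le_one₀ (by positivity)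
      (pow_le_one₀ h0.le (S.radius_le_one (Ioo_subset_Icc_self hx')))
    exact div_nonneg (mul_nonneg (mul_nonneg h1 (by linarith)) (by linarith)) (by positivity)
  have h := hmono ⟨le_rfl, hb.2.le⟩ ⟨hb.2.le, le_rfl⟩ hb.2.le
  simp only [S.radialNeumann.flux_right, hub, potential, Real.one_rpow] at h
  have hM : 1 ≤ u β := hub ▸ S.monotoneOn (Ioo_subset_Icc_self hb) S.right_mem hb.2.le
  have hv : (η ^ N) ^ 2 ≤ k b ^ 2 := by
    have := pow_pos S.margin_pos N
    gcongr
  have hp1 : 0 < p + 1 := by linarith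
  have h5 : 0 < 1 / (p + 1) := by positivity
  have h6 : (η ^ N) ^ 2 / 2 ≤ u β ^ (p + 1) / (p + 1) := by nlinarith
  rw [le_div_iff₀ hp1] at h6
  linarith

/-- The constant in the upper bound of `u(β)^(p+1)`. -/
def energyConst (N : ℕ) (η : ℝ) : ℝ := 2 + 1 / (2 * (η ^ (N - 1)) ^ 2)

/-- The mirror of `energy_lower`: for `a = η^(2(N-1)) ≤ r^(2(N-1))` beyond the level `1` the energy
is nonincreasing. -/
lemma energy_upper (S : LayerSolution N p α β η u k) :
    u β ^ (p + 1) ≤ energyConst N η * (p + 1) := by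
  obtain ⟨b, hb, hub⟩ := S.exists_eq_one
  obtain ⟨hηb, hkb⟩ := S.margin_le hb hub
  have hp := S.one_lt_exponent
  have hη := S.margin_pos
  set a := (η ^ (N - 1)) ^ 2 with ha
  have ha0 : 0 < a := by positivity
  have hanti : AntitoneOn (fun r => k r ^ 2 / 2 + a * potential p (u r)) (Icc b β) := by
    refine antitoneOn_of_hasDerivAt_nonpos (ContinuousOn.mono
      (((S.continuousOn_flux.pow 2).div_const 2).add
        (continuousOn_const.mul S.continuousOn_potential)) (Icc_subset_Icc_left hb.1.le))
      (fun x hx => S.hasDerivAt_energy a ⟨hb.1.trans hx.1, hx.2⟩) fun x hx => ?_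
    have hx' : x ∈ Ioo α β := ⟨hb.1.trans hx.1, hx.2⟩
    have h0 := S.radius_pos hx'
    have h1 := S.flux_nonneg x (Ioo_subset_Icc_self hx')
    have h2 := self_le_rpow_of_one_le hp
      (hub ▸ S.monotoneOn (Ioo_subset_Icc_self hb) (Ioo_subset_Icc_self hx') hx.1.le)
    have h3 : a ≤ (x ^ (N - 1)) ^ 2 := by
      have : η ≤ x := hηb.trans hx.1.le
      rw [ha]; gcongr
    exact div_nonpos_of_nonpos_of_nonneg (mul_nonpos_of_nonneg_of_nonpos
      (mul_nonneg h1 (by linarith)) (by linarith)) (by positivity)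
  have h := hanti ⟨le_rfl, hb.2.le⟩ ⟨hb.2.le, le_rfl⟩ hb.2.le
  simp only [S.radialNeumann.flux_right, hub, potential, Real.one_rpow] at h
  have hM := S.right_le_two
  have hM0 := S.pos_right
  have hk1 : k b ^ 2 ≤ 1 := pow_le_one₀ (S.flux_nonneg b (Ioo_subset_Icc_self hb))
    (S.flux_le_one (Ioo_subset_Icc_self hb))
  have hp1 : 0 < p + 1 := by linarith
  have h5 : 1 / (p + 1) ≤ 1 / 2 := one_div_le_one_div_of_le (by norm_num) (by linarith)
  have h6 : a * (u β ^ (p + 1) / (p + 1)) ≤ 1 / 2 + a * 2 := by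
    have h7 : a * (1 / (p + 1) - 1 ^ 2 / 2) ≤ 0 :=
      mul_nonpos_of_nonneg_of_nonpos ha0.le (by linarith)
    have h8 : a * (u β ^ 2 / 2) ≤ a * 2 := by
      have : u β ^ 2 ≤ 4 := by nlinarith
      exact mul_le_mul_of_nonneg_left (by linarith) ha0.le
    have h9 : a * (u β ^ (p + 1) / (p + 1) - u β ^ 2 / 2) =
      a * (u β ^ (p + 1) / (p + 1)) - a * (u β ^ 2 / 2) := by ring
    rw [h9] at h
    linarith
  have h7 : u β ^ (p + 1) / (p + 1) ≤ energyConst N η := by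
    rw [energyConst, ← ha]
    have e : 1 / 2 + a * 2 = a * (2 + 1 / (2 * a)) := by field_simp; ring
    rw [e] at h6
    exact le_of_mul_le_mul_left h6 ha0
  exact (div_le_iff₀ hp1).1 h7

/-- Lower bound for the flux at levels below `1`. -/
lemma flux_sq_ge (S : LayerSolution N p α β η u k) {r : ℝ} (hr : r ∈ Icc α β) (hu : u r ≤ 1) :
    (η ^ N) ^ 2 - 2 * (1 - u r) ≤ k r ^ 2 := by
  obtain ⟨b, hb, hub⟩ := S.exists_eq_one
  obtain ⟨hηb, hkb⟩ := S.margin_le hb hub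
  have hrb : r ≤ b := by
    by_contra hcon
    have := S.strictMonoOn (Ioo_subset_Icc_self hb) hr (not_le.1 hcon)
    linarith
  have hanti : AntitoneOn (fun r => k r ^ 2 / 2 - u r) (Icc α β) := by
    refine antitoneOn_of_hasDerivAt_nonpos (((S.continuousOn_flux.pow 2).div_const 2).sub
      S.continuousOn) (fun x hx => (((S.hasDerivAt_flux hx).fun_pow 2).div_const 2).fun_sub
        (S.hasDerivAt hx)) fun x hx => ?_
    have h0 := S.radius_pos hx
    have h1 := S.flux_nonneg x (Ioo_subset_Icc_self hx)
    have h2 := S.sub_rpow_le_one (Ioo_subset_Icc_self hx)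
    have h3 : x ^ (N - 1) ≤ 1 := pow_le_one₀ h0.le (S.radius_le_one (Ioo_subset_Icc_self hx))
    have h4 : 0 < x ^ (N - 1) := by positivity
    have h5 : k x ≤ k x / x ^ (N - 1) := by
      rw [le_div_iff₀ h4]; nlinarith
    have h6 : x ^ (N - 1) * (u x - u x ^ p) ≤ 1 := by nlinarith
    have h7 : k x * (x ^ (N - 1) * (u x - u x ^ p)) ≤ k x * 1 := mul_le_mul_of_nonneg_left h6 h1
    push_cast
    norm_num
    linarith
  have h := hanti hr (Ioo_subset_Icc_self hb) hrb
  simp only [hub] at h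
  have hv : (η ^ N) ^ 2 ≤ k b ^ 2 := by
    have := pow_pos S.margin_pos N
    gcongr
  linarith

end LayerSolution

/-! ### Comparison of two solutions -/

/-- The tangent inequality of the convex function `t^p` at `b`, obtained from Bernoulli's inequality
for `a / b`. -/
lemma rpow_sub_rpow_le {a b p : ℝ} (hp : 1 ≤ p) (ha : 0 ≤ a) (hab : a ≤ b) :
    b ^ p - a ^ p ≤ p * b ^ (p - 1) * (b - a) := by
  rcases (ha.trans hab).eq_or_lt with hb | hb
  · have : a = 0 := le_antisymm (hb ▸ hab) ha
    simp [← hb, this]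
  have h1 : -1 ≤ (a - b) / b := by rw [le_div_iff₀ hb]; linarith
  have h2 := one_add_mul_self_le_rpow_one_add h1 hp
  have e : 1 + (a - b) / b = a / b := by field_simp; ring
  rw [e, Real.div_rpow ha hb.le, le_div_iff₀ (Real.rpow_pos_of_pos hb p)] at h2
  have e2 : b ^ p = b ^ (p - 1) * b := by
    rw [← Real.rpow_add_one hb.ne', sub_add_cancel]
  have e3 : (1 + p * ((a - b) / b)) * b ^ p = b ^ p - p * b ^ (p - 1) * (b - a) := by
    rw [e2]; field_simp; ring
  linarith

lemma abs_rpow_sub_rpow_le {a b p M : ℝ} (hp : 1 ≤ p) (ha : a ∈ Icc 0 M) (hb : b ∈ Icc 0 M) :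
    |a ^ p - b ^ p| ≤ p * M ^ (p - 1) * |a - b| := by
  wlog hab : b ≤ a generalizing a b
  · rw [abs_sub_comm, abs_sub_comm a b]; exact this hb ha (le_of_not_ge hab)
  rw [abs_of_nonneg (sub_nonneg.2 hab),
    abs_of_nonneg (sub_nonneg.2 (Real.rpow_le_rpow hb.1 hab (by linarith)))]
  refine (rpow_sub_rpow_le hp hb.1 hab).trans ?_
  have := Real.rpow_le_rpow ha.1 ha.2 (by linarith : 0 ≤ p - 1)
  have := sub_nonneg.2 hab
  gcongr

namespace LayerSolution

variable {N : ℕ} {p α β η : ℝ} {u k u₁ k₁ u₂ k₂ : ℝ → ℝ}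

/-- A solution is determined by its value at the outer boundary. -/
lemma eqOn_of_right_eq (S₁ : LayerSolution N p α β η u₁ k₁) (S₂ : LayerSolution N p α β η u₂ k₂)
    (hβ : u₁ β = u₂ β) : EqOn u₁ u₂ (Icc α β) := by
  have hp := S₁.one_lt_exponent
  -- Both solutions carry the same data `(u(β), 0)` at the outer end, so the system is solved
  -- backwards. Stopping at `a > α` avoids its possible singularity at the origin, and the
  -- restriction `0 ≤ u ≤ 2` makes the power Lipschitz.
  have main : ∀ a ∈ Ioo α β, u₁ a = u₂ a := by
    intro a ha
    have ha0 := S₁.radius_pos ha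
    set K : ℝ := max (1 / a ^ (N - 1)) (1 + p * 2 ^ (p - 1)) with hK
    have hK0 : 0 ≤ K := le_max_of_le_left (by positivity)
    set V : ℝ → ℝ × ℝ → ℝ × ℝ := fun t z => (z.2 / t ^ (N - 1), t ^ (N - 1) * (z.1 - z.1 ^ p))
    have hV : ∀ t ∈ Ioc a β, LipschitzOnWith K.toNNReal (V t) {z : ℝ × ℝ | z.1 ∈ Icc (0 : ℝ) 2} := by
      intro t ht
      refine LipschitzOnWith.of_dist_le_mul fun x hx y hy => ?_
      rw [Real.coe_toNNReal _ hK0]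
      have hta : 0 < t := ha0.trans ht.1
      have hd1 : |x.1 - y.1| ≤ dist x y := by rw [Prod.dist_eq]; exact le_max_left _ _
      have hd2 : |x.2 - y.2| ≤ dist x y := by rw [Prod.dist_eq]; exact le_max_right _ _
      have hd0 : 0 ≤ dist x y := dist_nonneg
      rw [Prod.dist_eq]
      refine max_le ?_ ?_
      · simp only [V, Real.dist_eq]
        rw [← sub_div, abs_div, abs_of_pos (pow_pos hta (N - 1)), div_eq_inv_mul]
        have h1 : (t ^ (N - 1))⁻¹ ≤ K := by
          refine le_trans ?_ (le_max_left _ _)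
          rw [one_div]
          have := ht.1.le
          gcongr
        exact mul_le_mul h1 hd2 (abs_nonneg _) hK0
      · simp only [V, Real.dist_eq]
        rw [← mul_sub, abs_mul, abs_of_pos (pow_pos hta (N - 1))]
        have h1 : t ^ (N - 1) ≤ 1 := pow_le_one₀ hta.le (ht.2.trans S₁.right_le_one)
        have h2 := abs_rpow_sub_rpow_le hp.le hx hy
        have h3 : |x.1 - x.1 ^ p - (y.1 - y.1 ^ p)| ≤ (1 + p * 2 ^ (p - 1)) * |x.1 - y.1| := by
          have : x.1 - x.1 ^ p - (y.1 - y.1 ^ p) = (x.1 - y.1) - (x.1 ^ p - y.1 ^ p) := by ring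
          rw [this]
          refine (abs_sub _ _).trans ?_
          linarith
        calc t ^ (N - 1) * |x.1 - x.1 ^ p - (y.1 - y.1 ^ p)|
            ≤ 1 * |x.1 - x.1 ^ p - (y.1 - y.1 ^ p)| := by gcongr
          _ ≤ (1 + p * 2 ^ (p - 1)) * |x.1 - y.1| := by rw [one_mul]; exact h3
          _ ≤ K * dist x y := mul_le_mul (le_max_right _ _) hd1 (abs_nonneg _) hK0
    have der : ∀ {u k : ℝ → ℝ}, LayerSolution N p α β η u k → ∀ t ∈ Ioc a β,
        HasDerivWithinAt (fun r => (u r, k r)) (V t (u t, k t)) (Iic t) t := by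
      intro u k S t ht
      have htm : t ∈ Icc α β := ⟨ha.1.le.trans ht.1.le, ht.2⟩
      have hmem : Icc α β ∈ 𝓝[≤] t :=
        mem_of_superset (Icc_mem_nhdsLE (ha.1.trans ht.1)) (Icc_subset_Icc_right ht.2)
      exact ((S.radialNeumann.hasDeriv t htm).mono_of_mem_nhdsWithin hmem).prodMk
        ((S.radialNeumann.hasDeriv_flux t htm).mono_of_mem_nhdsWithin hmem)
    have mem : ∀ {u k : ℝ → ℝ}, LayerSolution N p α β η u k → ∀ t ∈ Ioc a β,
        (u t, k t) ∈ {z : ℝ × ℝ | z.1 ∈ Icc (0 : ℝ) 2} := by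
      intro u k S t ht
      have htm : t ∈ Icc α β := ⟨ha.1.le.trans ht.1.le, ht.2⟩
      exact ⟨S.nonneg t htm, (S.monotoneOn htm S.right_mem htm.2).trans S.right_le_two⟩
    have cont : ∀ {u k : ℝ → ℝ}, LayerSolution N p α β η u k →
        ContinuousOn (fun r => (u r, k r)) (Icc a β) := fun S =>
      (S.continuousOn.prodMk S.continuousOn_flux).mono (Icc_subset_Icc_left ha.1.le)
    have h := ODE_solution_unique_of_mem_Icc_left hV (cont S₁) (der S₁) (mem S₁) (cont S₂)
      (der S₂) (mem S₂) (by simp [hβ, S₁.radialNeumann.flux_right, S₂.radialNeumann.flux_right])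
    exact (Prod.ext_iff.1 (h ⟨le_rfl, ha.2.le⟩)).1
  have hcl : closure (Ioo α β) = Icc α β := closure_Ioo S₁.left_lt_right.ne
  exact EqOn.of_subset_closure main S₁.continuousOn S₂.continuousOn Ioo_subset_Icc_self hcl.ge

/-- If one solution lies above the other up to the outer boundary, its logarithmic derivative is
larger at the left end. -/
lemma wronskian_pos (S₁ : LayerSolution N p α β η u₁ k₁) (S₂ : LayerSolution N p α β η u₂ k₂)
    {a : ℝ} (ha : a ∈ Ico α β) (hlt : ∀ r ∈ Ioc a β, u₂ r < u₁ r) :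
    0 < k₁ a * u₂ a - k₂ a * u₁ a := by
  have hp := S₁.one_lt_exponent
  have hsub : Icc a β ⊆ Icc α β := Icc_subset_Icc_left ha.1
  -- The zeroth-order terms cancel and the derivative is `r^(N-1) u₁ u₂ (u₂^(p-1) - u₁^(p-1)) < 0`;
  -- at the outer end both fluxes vanish.
  have hanti : StrictAntiOn (fun r => k₁ r * u₂ r - k₂ r * u₁ r) (Icc a β) := by
    refine strictAntiOn_of_deriv_neg (convex_Icc a β)
      (((S₁.continuousOn_flux.mul S₂.continuousOn).sub
        (S₂.continuousOn_flux.mul S₁.continuousOn)).mono hsub) fun r hr => ?_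
    rw [interior_Icc] at hr
    have hr' : r ∈ Ioo α β := ⟨ha.1.trans_lt hr.1, hr.2⟩
    have hd := ((S₁.hasDerivAt_flux hr').fun_mul (S₂.hasDerivAt hr')).fun_sub
      ((S₂.hasDerivAt_flux hr').fun_mul (S₁.hasDerivAt hr'))
    rw [hd.deriv]
    have h2 := S₂.pos (Ioo_subset_Icc_self hr')
    have h12 := hlt r ⟨hr.1, hr.2.le⟩
    have h1 := h2.trans h12
    have e : ∀ t : ℝ, 0 < t → t ^ p = t ^ (p - 1) * t := fun t ht => by
      rw [← Real.rpow_add_one ht.ne', sub_add_cancel]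
    have hpow := Real.rpow_lt_rpow h2.le h12 (by linarith : 0 < p - 1)
    have hr0 : 0 < r ^ (N - 1) := pow_pos (S₁.radius_pos hr') _
    rw [e _ h1, e _ h2]
    have : r ^ (N - 1) * (u₁ r - u₁ r ^ (p - 1) * u₁ r) * u₂ r + k₁ r * (k₂ r / r ^ (N - 1)) -
        (r ^ (N - 1) * (u₂ r - u₂ r ^ (p - 1) * u₂ r) * u₁ r + k₂ r * (k₁ r / r ^ (N - 1))) =
        r ^ (N - 1) * (u₁ r * u₂ r) * (u₂ r ^ (p - 1) - u₁ r ^ (p - 1)) := by ring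
    rw [this]
    exact mul_neg_of_pos_of_neg (by positivity) (sub_neg.2 hpow)
  have := hanti ⟨le_rfl, ha.2.le⟩ ⟨ha.2.le, le_rfl⟩ ha.2
  simpa [S₁.radialNeumann.flux_right, S₂.radialNeumann.flux_right] using this

/-- Without a crossing the Wronskian would be positive at the inner end, where both fluxes are zero.
At the last crossing the profiles agree, so positivity of the Wronskian is exactly `k₁ > k₂`. -/
lemma exists_crossing (S₁ : LayerSolution N p α β η u₁ k₁)
    (S₂ : LayerSolution N p α β η u₂ k₂) (hβ : u₂ β < u₁ β) :
    ∃ r ∈ Ioo α β, u₁ r = u₂ r ∧ k₂ r < k₁ r ∧ ∀ x ∈ Ioc r β, u₂ x < u₁ x := by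
  have hαβ := S₁.left_lt_right
  have hnot : ¬ ∀ r ∈ Ioc α β, u₂ r < u₁ r := fun h => by
    have := wronskian_pos S₁ S₂ ⟨le_rfl, hαβ⟩ h
    simp [S₁.radialNeumann.flux_left, S₂.radialNeumann.flux_left] at this
  push Not at hnot
  obtain ⟨c, hc, hle⟩ := hnot
  obtain ⟨r, hr, h0, hlt⟩ := exists_last_zero (k := fun x => u₂ x - u₁ x) (c := c) (d := β)
    ((S₂.continuousOn.sub S₁.continuousOn).mono (Icc_subset_Icc_left hc.1.le)) hc.2
    (by linarith) (by linarith)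
  have hr' : r ∈ Ioo α β := ⟨hc.1.trans_le hr.1, hr.2⟩
  have hlt' : ∀ x ∈ Ioc r β, u₂ x < u₁ x := fun x hx => by linarith [hlt x hx]
  have he : u₁ r = u₂ r := by linarith
  refine ⟨r, hr', he, ?_, hlt'⟩
  have hw := wronskian_pos S₁ S₂ ⟨hr'.1.le, hr'.2⟩ hlt'
  rw [he, ← sub_mul] at hw
  have := (pos_iff_pos_of_mul_pos hw).2 (S₂.pos (Ioo_subset_Icc_self hr'))
  linarith

/-- Below the level where `u - u^p` is increasing, the ordering of the fluxes persists towards the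
inner boundary, where both fluxes vanish. -/
lemma flux_le_of_le (S₁ : LayerSolution N p α β η u₁ k₁) (S₂ : LayerSolution N p α β η u₂ k₂)
    {r s : ℝ} (hr : r ∈ Icc α β) (hs : p * s ^ (p - 1) ≤ 1) (hle : u₁ r ≤ u₂ r) (hus : u₂ r ≤ s) :
    k₁ r ≤ k₂ r := by
  by_contra hcon
  have hp := S₁.one_lt_exponent
  -- Beyond the last radius `c` where the fluxes agree, `k₁ > k₂`, so `u₂ - u₁` decreases to a
  -- nonnegative value and is nonnegative on the way. As `t - t^p` is increasing there, `k₂ - k₁` is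
  -- nondecreasing from zero, a contradiction.
  obtain ⟨c, hc, h0, hlt⟩ := exists_last_zero (k := fun x => k₂ x - k₁ x) (c := α) (d := r)
    ((S₂.continuousOn_flux.sub S₁.continuousOn_flux).mono (Icc_subset_Icc_right hr.2)) hr.1
    (by simp [S₁.radialNeumann.flux_left, S₂.radialNeumann.flux_left]) (by linarith)
  have hsub : Icc c r ⊆ Icc α β := Icc_subset_Icc hc.1 hr.2
  have hsub' : Ioo c r ⊆ Ioo α β := Ioo_subset_Ioo hc.1 hr.2
  have hu : AntitoneOn (fun x => u₂ x - u₁ x) (Icc c r) :=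
    antitoneOn_of_hasDerivAt_nonpos ((S₂.continuousOn.sub S₁.continuousOn).mono hsub)
      (fun x hx => (S₂.hasDerivAt (hsub' hx)).fun_sub (S₁.hasDerivAt (hsub' hx))) fun x hx => by
      rw [← sub_div]
      exact div_nonpos_of_nonpos_of_nonneg (hlt x ⟨hx.1, hx.2.le⟩).le
        (pow_nonneg (S₁.radius_pos (hsub' hx)).le _)
  have hk : MonotoneOn (fun x => k₂ x - k₁ x) (Icc c r) :=
    monotoneOn_of_hasDerivAt_nonneg ((S₂.continuousOn_flux.sub S₁.continuousOn_flux).mono hsub)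
      (fun x hx => (S₂.hasDerivAt_flux (hsub' hx)).fun_sub (S₁.hasDerivAt_flux (hsub' hx)))
      fun x hx => by
      have hx' := Ioo_subset_Icc_self hx
      have h1 := hu hx' ⟨hc.2.le, le_rfl⟩ hx.2.le
      simp only at h1
      have h2 : u₁ x ≤ u₂ x := by linarith
      have h3 := rpow_sub_rpow_le hp.le (S₁.nonneg x (hsub hx')) h2
      have h4 : p * u₂ x ^ (p - 1) ≤ 1 := by
        refine le_trans ?_ hs
        have := Real.rpow_le_rpow (S₂.nonneg x (hsub hx'))
          ((S₂.monotoneOn (hsub hx') hr hx.2.le).trans hus) (by linarith : 0 ≤ p - 1)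
        gcongr
      have h5 : u₂ x ^ p - u₁ x ^ p ≤ 1 * (u₂ x - u₁ x) :=
        h3.trans (mul_le_mul_of_nonneg_right h4 (by linarith))
      rw [← mul_sub]
      exact mul_nonneg (pow_nonneg (S₁.radius_pos (hsub' hx)).le _) (by linarith)
  have := hk ⟨le_rfl, hc.2.le⟩ ⟨hc.2.le, le_rfl⟩ hc.2.le
  simp only at this h0
  linarith

/-- The last crossing above the level `1` keeps its distance from the outer boundary. -/
lemma crossing_dist (S₁ : LayerSolution N p α β η u₁ k₁) (S₂ : LayerSolution N p α β η u₂ k₂)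
    {r : ℝ} (hr : r ∈ Ioo α β) (he : u₁ r = u₂ r) (hlt : ∀ x ∈ Ioc r β, u₂ x < u₁ x)
    (h1 : 1 ≤ u₂ r) : η ^ (N - 1) ≤ p * u₁ β ^ (p - 1) * (β - r) ^ 2 := by
  have hp := S₁.one_lt_exponent
  have hη := S₁.margin_pos
  obtain ⟨b, hb, hub⟩ := S₂.exists_eq_one
  have hbr : b ≤ r := by
    by_contra hcon
    have := S₂.strictMonoOn (Ioo_subset_Icc_self hr) (Ioo_subset_Icc_self hb) (not_le.1 hcon)
    linarith
  have hηr : η ≤ r := (S₂.margin_le hb hub).1.trans hbr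
  have hsub : Icc r β ⊆ Icc α β := Icc_subset_Icc_left hr.1.le
  have hsub' : Ioo r β ⊆ Ioo α β := Ioo_subset_Ioo_left hr.1.le
  have hcD : ContinuousOn (fun x => u₁ x - u₂ x) (Icc r β) :=
    (S₁.continuousOn.sub S₂.continuousOn).mono hsub
  -- The maximum `m` of `u₁ - u₂` bounds itself. Integrating inwards from the outer end bounds the
  -- flux difference by `A m d`, and integrating from the crossing gives `m ≤ A m d² / η^(N-1)`;
  -- then `m` cancels.
  obtain ⟨x₀, hx₀, hmax⟩ := isCompact_Icc.exists_isMaxOn ⟨β, hr.2.le, le_rfl⟩ hcD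
  set m := u₁ x₀ - u₂ x₀ with hm
  have hmax' : ∀ x ∈ Icc r β, u₁ x - u₂ x ≤ m := fun x hx => hmax hx
  have hm0 : 0 < m := by
    have h2 := hmax' β ⟨hr.2.le, le_rfl⟩
    linarith [hlt β ⟨hr.2, le_rfl⟩]
  set A := p * u₁ β ^ (p - 1) with hA
  have hA0 : 0 < A := mul_pos (by linarith) (Real.rpow_pos_of_pos S₁.pos_right _)
  set d := β - r with hd
  have hd0 : 0 < d := sub_pos.2 hr.2
  have hflux : ∀ x ∈ Icc r β, k₁ x - k₂ x ≤ A * m * d := by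
    have hmono : MonotoneOn (fun x => k₁ x - k₂ x + A * m * x) (Icc r β) :=
      monotoneOn_of_hasDerivAt_nonneg
        (((S₁.continuousOn_flux.sub S₂.continuousOn_flux).mono hsub).add
          (continuousOn_const.mul continuousOn_id))
        (fun x hx => ((S₁.hasDerivAt_flux (hsub' hx)).fun_sub
          (S₂.hasDerivAt_flux (hsub' hx))).fun_add ((hasDerivAt_id x).const_mul (A * m)))
        fun x hx => by
        have hx' := hsub (Ioo_subset_Icc_self hx)
        have h12 := hlt x ⟨hx.1, hx.2.le⟩
        have h3 := rpow_sub_rpow_le hp.le (S₂.nonneg x hx') h12.le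
        have h4 : p * u₁ x ^ (p - 1) ≤ A := by
          have := Real.rpow_le_rpow (S₁.nonneg x hx')
            (S₁.monotoneOn hx' S₁.right_mem hx'.2) (by linarith : 0 ≤ p - 1)
          rw [hA]; gcongr
        have h5 : u₁ x ^ p - u₂ x ^ p ≤ A * m :=
          h3.trans (mul_le_mul h4 (hmax' x (Ioo_subset_Icc_self hx)) (by linarith) hA0.le)
        have hx0 : 0 ≤ x ^ (N - 1) := pow_nonneg (S₁.radius_pos (hsub' hx)).le _
        have hx1 : x ^ (N - 1) ≤ 1 :=
          pow_le_one₀ (S₁.radius_pos (hsub' hx)).le (S₁.radius_le_one hx')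
        have hAm : 0 ≤ A * m := by positivity
        rw [← mul_sub, mul_one]
        nlinarith
    intro x hx
    have := hmono hx ⟨hr.2.le, le_rfl⟩ hx.2
    simp only [S₁.radialNeumann.flux_right, S₂.radialNeumann.flux_right] at this
    have hAm : 0 ≤ A * m := by positivity
    nlinarith [hx.1]
  have hηp : 0 < η ^ (N - 1) := by positivity
  have hanti : AntitoneOn (fun x => u₁ x - u₂ x - A * m * d / η ^ (N - 1) * x) (Icc r β) :=
    antitoneOn_of_hasDerivAt_nonpos (hcD.sub (continuousOn_const.mul continuousOn_id))
      (fun x hx => ((S₁.hasDerivAt (hsub' hx)).fun_sub (S₂.hasDerivAt (hsub' hx))).fun_sub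
        ((hasDerivAt_id x).const_mul _)) fun x hx => by
      have hx0 := S₁.radius_pos (hsub' hx)
      have h2 : (k₁ x - k₂ x) / x ^ (N - 1) ≤ A * m * d / η ^ (N - 1) := by
        have h3 : η ≤ x := hηr.trans hx.1.le
        calc (k₁ x - k₂ x) / x ^ (N - 1) ≤ A * m * d / x ^ (N - 1) := by
              gcongr; exact hflux x (Ioo_subset_Icc_self hx)
          _ ≤ A * m * d / η ^ (N - 1) := by gcongr
      rw [← sub_div, mul_one]
      linarith
  have h2 := hanti ⟨le_rfl, hr.2.le⟩ hx₀ hx₀.1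
  simp only [he, sub_self] at h2
  have h3 : m ≤ A * m * d / η ^ (N - 1) * d := by
    have : A * m * d / η ^ (N - 1) * (x₀ - r) ≤ A * m * d / η ^ (N - 1) * d := by
      have := hx₀.2
      gcongr
      linarith
    nlinarith
  rw [div_mul_eq_mul_div, le_div_iff₀ hηp] at h3
  have h4 : m * η ^ (N - 1) ≤ m * (A * d ^ 2) := by nlinarith
  exact le_of_mul_le_mul_left h4 hm0

end LayerSolution

/-! ### Comparison along level sets -/

namespace LayerSolution

variable {N : ℕ} {p α β η : ℝ} {u k u₁ k₁ u₂ k₂ : ℝ → ℝ}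

lemma energyConst_pos (N : ℕ) (η : ℝ) : 0 < energyConst N η := by
  unfold energyConst; positivity

/-- The distance of a crossing from the outer boundary is at least this constant over `p`. -/
def crossingConst (N : ℕ) (η : ℝ) : ℝ := min (1 / 2) (η ^ (N - 1) / (2 * energyConst N η))

lemma crossingConst_pos (N : ℕ) (hη : 0 < η) : 0 < crossingConst N η := by
  have := energyConst_pos N η
  unfold crossingConst
  positivity

/-- `energy_upper` makes `u₁(β)^(p-1)` at most linear in `p`, so `crossing_dist` bounds `(p (β -
r))²` below. The cap `1 / 2` in `crossingConst` turns this into a bound on `p (β - r)` itself. -/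
lemma crossingConst_le (S₁ : LayerSolution N p α β η u₁ k₁) (S₂ : LayerSolution N p α β η u₂ k₂)
    {r : ℝ} (hr : r ∈ Ioo α β) (he : u₁ r = u₂ r) (hlt : ∀ x ∈ Ioc r β, u₂ x < u₁ x)
    (h1 : 1 ≤ u₂ r) : crossingConst N η / p ≤ β - r := by
  have hp := S₁.one_lt_exponent
  have hτ := crossingConst_pos N S₁.margin_pos
  have hC := energyConst_pos N η
  have hd := crossing_dist S₁ S₂ hr he hlt h1
  have hM : 1 ≤ u₁ β := h1.trans (he ▸ S₁.monotoneOn (Ioo_subset_Icc_self hr) S₁.right_mem hr.2.le)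
  have h2 : u₁ β ^ (p - 1) ≤ 2 * energyConst N η * p := by
    calc u₁ β ^ (p - 1) ≤ u₁ β ^ (p + 1) := Real.rpow_le_rpow_of_exponent_le hM (by linarith)
      _ ≤ energyConst N η * (p + 1) := S₁.energy_upper
      _ ≤ 2 * energyConst N η * p := by nlinarith
  have hdpos : 0 < β - r := sub_pos.2 hr.2
  have h3 : η ^ (N - 1) ≤ 2 * energyConst N η * (p * (β - r)) ^ 2 := by
    refine hd.trans ?_
    have : p * u₁ β ^ (p - 1) * (β - r) ^ 2 ≤ p * (2 * energyConst N η * p) * (β - r) ^ 2 := by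
      gcongr
    linarith
  have h4 : crossingConst N η ≤ (p * (β - r)) ^ 2 := by
    refine (min_le_right _ _).trans ?_
    rw [div_le_iff₀ (by positivity)]
    linarith
  have h5 : crossingConst N η ≤ 1 / 2 := min_le_left _ _
  have h6 : crossingConst N η ≤ p * (β - r) := by
    have : 0 < p * (β - r) := by positivity
    nlinarith
  rw [div_le_iff₀ (by linarith)]
  linarith

/-- Lower bound for the flux at a crossing above the level `1`. -/
def fluxConst (N : ℕ) (η : ℝ) : ℝ := crossingConst N η * η ^ (N - 1) * (η ^ N) ^ 2 / 16

lemma fluxConst_pos (N : ℕ) (hη : 0 < η) : 0 < fluxConst N η := by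
  have := crossingConst_pos N hη
  unfold fluxConst
  positivity

/-- On the last stretch of length `δ = crossingConst / p`, `u₂^p` stays at least half of `u₂(β)^p`,
which grows linearly in `p`. So `-k₂'` is of order `p` over a length of order `1 / p`, and the flux
gained is independent of `p`. -/
lemma fluxConst_le (S₁ : LayerSolution N p α β η u₁ k₁) (S₂ : LayerSolution N p α β η u₂ k₂)
    {r : ℝ} (hr : r ∈ Ioo α β) (he : u₁ r = u₂ r) (hlt : ∀ x ∈ Ioc r β, u₂ x < u₁ x)
    (h1 : 1 ≤ u₂ r) (hpη : 32 ≤ p * (η ^ N) ^ 2) : fluxConst N η ≤ k₂ r := by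
  have hp := S₁.one_lt_exponent
  have hη := S₁.margin_pos
  have hp0 : 0 < p := by linarith
  have hτ := crossingConst_pos N S₁.margin_pos
  have hd := crossingConst_le S₁ S₂ hr he hlt h1
  set δ := crossingConst N η / p with hδ
  have hδ0 : 0 < δ := by positivity
  have hpδ : p * δ ≤ 1 / 2 := by
    rw [hδ, mul_div_cancel₀ _ hp0.ne']; exact min_le_left _ _
  obtain ⟨b, hb, hub⟩ := S₂.exists_eq_one
  have hbr : b ≤ r := by
    by_contra hcon
    have := S₂.strictMonoOn (Ioo_subset_Icc_self hr) (Ioo_subset_Icc_self hb) (not_le.1 hcon)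
    linarith
  have hηr : η ≤ r := (S₂.margin_le hb hub).1.trans hbr
  have hM1 : 1 ≤ u₂ β := h1.trans (S₂.monotoneOn (Ioo_subset_Icc_self hr) S₂.right_mem hr.2.le)
  have hM2 := S₂.right_le_two
  have hMp : (p + 1) * (η ^ N) ^ 2 / 4 ≤ u₂ β ^ p := by
    have h2 := S₂.energy_lower
    rw [Real.rpow_add_one S₂.pos_right.ne'] at h2
    have h3 : 0 ≤ u₂ β ^ p := Real.rpow_nonneg S₂.pos_right.le p
    nlinarith
  have hcm : β - δ ∈ Icc α β := ⟨by linarith [hr.1], by linarith⟩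
  have hkr : k₂ (β - δ) ≤ k₂ r := S₂.flux_antitoneOn (Ioo_subset_Icc_self hr) h1
    ⟨le_rfl, hr.2.le⟩ ⟨by linarith, by linarith⟩ (by linarith)
  refine le_trans ?_ hkr
  set B := η ^ (N - 1) * (p * (η ^ N) ^ 2 / 16) with hB
  have hanti : AntitoneOn (fun x => k₂ x + B * x) (Icc (β - δ) β) := by
    refine antitoneOn_of_hasDerivAt_nonpos
      ((S₂.continuousOn_flux.mono (Icc_subset_Icc_left hcm.1)).add
        (continuousOn_const.mul continuousOn_id))
      (fun x hx => (S₂.hasDerivAt_flux ⟨hcm.1.trans_lt hx.1, hx.2⟩).fun_add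
        ((hasDerivAt_id x).const_mul B)) fun x hx => ?_
    have hx' : x ∈ Ioo α β := ⟨hcm.1.trans_lt hx.1, hx.2⟩
    have hxm := Ioo_subset_Icc_self hx'
    have hux : u₂ x ≤ 2 := (S₂.monotoneOn hxm S₂.right_mem hx.2.le).trans hM2
    have hsub := S₂.sub_le_sub hxm S₂.right_mem hx.2.le
    have h2 := rpow_sub_rpow_le hp.le (S₂.nonneg x hxm) (S₂.monotoneOn hxm S₂.right_mem hx.2.le)
    have h3 : p * u₂ β ^ (p - 1) * (u₂ β - u₂ x) ≤ 1 / 2 * u₂ β ^ p := by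
      have h4 : u₂ β ^ (p - 1) ≤ u₂ β ^ p := Real.rpow_le_rpow_of_exponent_le hM1 (by linarith)
      have h5 : 0 ≤ u₂ β ^ (p - 1) := Real.rpow_nonneg S₂.pos_right.le _
      have h6 : u₂ β - u₂ x ≤ δ := by linarith [hx.1]
      calc p * u₂ β ^ (p - 1) * (u₂ β - u₂ x) ≤ p * u₂ β ^ (p - 1) * δ := by gcongr
        _ = p * δ * u₂ β ^ (p - 1) := by ring
        _ ≤ 1 / 2 * u₂ β ^ p := by gcongr
    -- Half of `u₂(β)^p` is at least `(p + 1) (η^N)² / 8`; the hypothesis `32 ≤ p (η^N)²` absorbs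
    -- `u₂ ≤ 2` into half of it.
    have h4 : p * (η ^ N) ^ 2 / 16 ≤ u₂ x ^ p - u₂ x := by nlinarith [sq_nonneg (η ^ N)]
    have h5 : η ^ (N - 1) ≤ x ^ (N - 1) := by
      have : η ≤ x := by linarith [hx.1]
      gcongr
    have h6 : B ≤ x ^ (N - 1) * (u₂ x ^ p - u₂ x) := by
      rw [hB]; exact mul_le_mul h5 h4 (by positivity) (pow_nonneg (S₂.radius_pos hx').le _)
    rw [mul_one]
    linarith
  have h := hanti ⟨le_rfl, by linarith⟩ ⟨by linarith, le_rfl⟩ (by linarith : β - δ ≤ β)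
  simp only [S₂.radialNeumann.flux_right] at h
  have e : fluxConst N η = B * δ := by
    rw [fluxConst, hB, hδ]; field_simp
  rw [e]; linarith

/-- The radius as a function of the level. -/
lemma exists_levelRadius (S : LayerSolution N p α β η u k) :
    ∃ ρ : ℝ → ℝ, (∀ r ∈ Icc α β, ρ (u r) = r) ∧ ∀ s ∈ Ioo (u α) (u β),
      ρ s ∈ Ioo α β ∧ u (ρ s) = s ∧ HasDerivAt ρ (ρ s ^ (N - 1) / k (ρ s)) s := by
  set ρ := Function.invFunOn u (Icc α β) with hρ
  have hleft : ∀ r ∈ Icc α β, ρ (u r) = r := fun r hr =>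
    S.strictMonoOn.injOn.leftInvOn_invFunOn hr
  have hval : ∀ s ∈ Ioo (u α) (u β), ρ s ∈ Ioo α β ∧ u (ρ s) = s := by
    intro s hs
    obtain ⟨r, hr, rfl⟩ := intermediate_value_Ioo S.left_lt_right.le S.continuousOn hs
    rw [hleft r (Ioo_subset_Icc_self hr)]
    exact ⟨hr, rfl⟩
  refine ⟨ρ, hleft, fun s hs => ⟨(hval s hs).1, (hval s hs).2, ?_⟩⟩
  have hmono : StrictMonoOn ρ (Ioo (u α) (u β)) := by
    intro s hs t ht hst
    by_contra hcon
    have := S.monotoneOn (Ioo_subset_Icc_self (hval t ht).1) (Ioo_subset_Icc_self (hval s hs).1)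
      (not_lt.1 hcon)
    rw [(hval t ht).2, (hval s hs).2] at this
    linarith
  have himg : Ioo α β ⊆ ρ '' Ioo (u α) (u β) := fun r hr =>
    ⟨u r, ⟨S.strictMonoOn S.left_mem (Ioo_subset_Icc_self hr) hr.1,
      S.strictMonoOn (Ioo_subset_Icc_self hr) S.right_mem hr.2⟩, hleft r (Ioo_subset_Icc_self hr)⟩
  have hcont : ContinuousAt ρ s := hmono.continuousAt_of_image_mem_nhds (Ioo_mem_nhds hs.1 hs.2)
    (mem_of_superset (Ioo_mem_nhds (hval s hs).1.1 (hval s hs).1.2) himg)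
  have hk := S.flux_pos (hval s hs).1
  have hr0 := S.radius_pos (hval s hs).1
  have hd := HasDerivAt.of_local_left_inverse hcont (S.hasDerivAt (hval s hs).1) (by positivity)
    (by filter_upwards [Ioo_mem_nhds hs.1 hs.2] with y hy using (hval y hy).2)
  rwa [inv_div] at hd

end LayerSolution

/-- Backward stability of a system `x' ≈ -y`, `y' ≲ x` over a short interval. -/
lemma pos_of_backward_system {x y x' y' : ℝ → ℝ} {a b C D : ℝ} (hab : a ≤ b) (hC : 0 ≤ C)
    (hD : 0 ≤ D) (hx : ∀ s ∈ Icc a b, HasDerivAt x (x' s) s)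
    (hy : ∀ s ∈ Icc a b, HasDerivAt y (y' s) s)
    (hx' : ∀ s ∈ Icc a b, 0 ≤ y s → x' s ≤ 0 ∧ -(C * y s) ≤ x' s)
    (hy' : ∀ s ∈ Icc a b, 0 ≤ y s → 0 ≤ x s → y' s ≤ D * x s)
    (hxb : x b = 0) (hyb : 0 < y b) (hsmall : C * D * (b - a) ^ 2 ≤ 1 / 2) :
    0 < y a ∧ 0 ≤ x a ∧ x a ≤ 2 * C * (b - a) * y a := by
  have hcx : ContinuousOn x (Icc a b) := fun s hs => (hx s hs).continuousAt.continuousWithinAt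
  have hcy : ContinuousOn y (Icc a b) := fun s hs => (hy s hs).continuousAt.continuousWithinAt
  have key : ∀ c ∈ Icc a b, (∀ s ∈ Icc c b, 0 ≤ y s) →
      0 ≤ x c ∧ x c ≤ 2 * C * (b - a) * y c ∧ y b ≤ y c + D * x c * (b - a) := by
    intro c hc hpos
    have hsub : Icc c b ⊆ Icc a b := Icc_subset_Icc_left hc.1
    have hax : AntitoneOn x (Icc c b) := antitoneOn_of_hasDerivAt_nonpos (hcx.mono hsub)
      (fun s hs => hx s (hsub (Ioo_subset_Icc_self hs))) fun s hs =>
        (hx' s (hsub (Ioo_subset_Icc_self hs)) (hpos s (Ioo_subset_Icc_self hs))).1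
    have hx0 : ∀ s ∈ Icc c b, 0 ≤ x s := fun s hs => hxb ▸ hax hs ⟨hc.2, le_rfl⟩ hs.2
    have hcm : c ∈ Icc c b := ⟨le_rfl, hc.2⟩
    have hxc := hx0 c hcm
    have hba : 0 ≤ b - a := by linarith
    have hY : ∀ s ∈ Icc c b, y s ≤ y c + D * x c * (b - a) := by
      have hanti : AntitoneOn (fun s => y s - D * x c * s) (Icc c b) :=
        antitoneOn_of_hasDerivAt_nonpos
          ((hcy.mono hsub).sub (continuousOn_const.mul continuousOn_id))
          (fun s hs => (hy s (hsub (Ioo_subset_Icc_self hs))).fun_sub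
            ((hasDerivAt_id s).const_mul (D * x c))) fun s hs => by
          have hs' := Ioo_subset_Icc_self hs
          have h1 := hy' s (hsub hs') (hpos s hs') (hx0 s hs')
          have h2 := mul_le_mul_of_nonneg_left (hax hcm hs' hs'.1) hD
          linarith
      intro s hs
      have h1 := hanti hcm hs hs.1
      simp only at h1
      have h2 : D * x c * (s - c) ≤ D * x c * (b - a) :=
        mul_le_mul_of_nonneg_left (by linarith [hs.2, hc.1]) (mul_nonneg hD hxc)
      linarith
    refine ⟨hxc, ?_, hY b ⟨hc.2, le_rfl⟩⟩
    set Y := y c + D * x c * (b - a) with hYdef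
    have hY0 : 0 ≤ Y := (hpos c hcm).trans (hY c hcm)
    have hmono : MonotoneOn (fun s => x s + C * Y * s) (Icc c b) :=
      monotoneOn_of_hasDerivAt_nonneg
        ((hcx.mono hsub).add (continuousOn_const.mul continuousOn_id))
        (fun s hs => (hx s (hsub (Ioo_subset_Icc_self hs))).fun_add
          ((hasDerivAt_id s).const_mul (C * Y))) fun s hs => by
        have hs' := Ioo_subset_Icc_self hs
        have h1 := (hx' s (hsub hs') (hpos s hs')).2
        have h2 := mul_le_mul_of_nonneg_left (hY s hs') hC
        linarith
    have h1 := hmono hcm ⟨hc.2, le_rfl⟩ hc.2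
    simp only [hxb] at h1
    have h2 : C * Y * (b - c) ≤ C * Y * (b - a) :=
      mul_le_mul_of_nonneg_left (by linarith [hc.1]) (mul_nonneg hC hY0)
    have h3 : x c ≤ C * Y * (b - a) := by linarith
    have h4 : C * Y * (b - a) = C * (b - a) * y c + C * D * (b - a) ^ 2 * x c := by
      rw [hYdef]; ring
    have h5 : C * D * (b - a) ^ 2 * x c ≤ 1 / 2 * x c := mul_le_mul_of_nonneg_right hsmall hxc
    linarith
  have hya : ∀ s ∈ Icc a b, 0 < y s := by
    by_contra hcon
    push Not at hcon
    obtain ⟨s₀, hs₀, hle⟩ := hcon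
    -- At the last zero of `y` the estimates of `key` give first `x = 0` and then `y b ≤ 0`.
    obtain ⟨c, hc, h0, hlt⟩ := exists_last_zero (k := fun s => -y s) (c := s₀) (d := b)
      (hcy.neg.mono (Icc_subset_Icc_left hs₀.1)) hs₀.2 (by linarith) (by linarith)
    have h0' : y c = 0 := by linarith
    obtain ⟨k1, k2, k3⟩ := key c ⟨hs₀.1.trans hc.1, hc.2.le⟩ fun s hs => by
      rcases hs.1.eq_or_lt with h | h
      · rw [← h, h0']
      · linarith [hlt s ⟨h, hs.2⟩]
    rw [h0', mul_zero] at k2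
    have : x c = 0 := le_antisymm k2 k1
    rw [h0', this] at k3
    linarith
  have ham : a ∈ Icc a b := ⟨le_rfl, hab⟩
  obtain ⟨k1, k2, -⟩ := key a ham fun s hs => (hya s hs).le
  exact ⟨hya a ham, k1, k2⟩

/-! ### Elementary inequalities for powers of radii -/

lemma pow_mul_sub_le_inv_sub_inv {c a b : ℝ} {N : ℕ} (hN : 3 ≤ N) (hc : 0 < c) (hc1 : c ≤ 1)
    (hca : c ≤ a) (hab : a ≤ b) (hb : b ≤ 1) :
    c ^ N * (b - a) ≤ (a ^ (N - 2))⁻¹ - (b ^ (N - 2))⁻¹ := by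
  obtain ⟨n, rfl⟩ : ∃ n, N = n + 3 := ⟨N - 3, by omega⟩
  have e : n + 3 - 2 = n + 1 := by omega
  rw [e]
  have ha : 0 < a := hc.trans_le hca
  have hb0 : 0 < b := ha.trans_le hab
  have h1 : c ^ (n + 3) * (b - a) ≤ b ^ (n + 1) - a ^ (n + 1) := by
    have h2 : c ^ (n + 3) ≤ b ^ n :=
      (pow_le_pow_of_le_one hc.le hc1 (by omega)).trans
        (pow_le_pow_left₀ hc.le (hca.trans hab) n)
    have h3 : a ^ n ≤ b ^ n := by gcongr
    have h4 : b ^ n * (b - a) ≤ b ^ (n + 1) - a ^ (n + 1) := by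
      rw [pow_succ, pow_succ]; nlinarith
    exact (mul_le_mul_of_nonneg_right h2 (by linarith)).trans h4
  have h5 : (a ^ (n + 1))⁻¹ - (b ^ (n + 1))⁻¹ =
      (b ^ (n + 1) - a ^ (n + 1)) / (a ^ (n + 1) * b ^ (n + 1)) := by
    field_simp
  rw [h5, le_div_iff₀ (by positivity)]
  have h6 : a ^ (n + 1) * b ^ (n + 1) ≤ 1 :=
    mul_le_one₀ (pow_le_one₀ ha.le (hab.trans hb)) (by positivity) (pow_le_one₀ hb0.le hb)
  have h7 : 0 ≤ c ^ (n + 3) * (b - a) := mul_nonneg (by positivity) (by linarith)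
  nlinarith

lemma pow_sub_pow_le_mul_sub {a b : ℝ} (n : ℕ) (ha : 0 ≤ a) (hab : a ≤ b) (hb : b ≤ 1) :
    b ^ n - a ^ n ≤ n * (b - a) := by
  induction n with
  | zero => simp
  | succ n ih =>
    have h1 : a ^ n ≤ 1 := pow_le_one₀ ha (hab.trans hb)
    have h3 : a ^ n ≤ b ^ n := by gcongr
    rw [pow_succ, pow_succ]
    push_cast
    have : b ^ n * b - a ^ n * a = (b ^ n - a ^ n) * b + a ^ n * (b - a) := by ring
    nlinarith [pow_nonneg ha n]

/-! ### Uniqueness of increasing solutions -/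

namespace LayerSolution

variable {N : ℕ} {p α β η : ℝ} {u k u₁ k₁ u₂ k₂ : ℝ → ℝ}

/-- The squared flux as a function of the level. -/
lemma hasDerivAt_flux_sq_level (S : LayerSolution N p α β η u k) {ρ : ℝ → ℝ} {s : ℝ}
    (hρ : ρ s ∈ Ioo α β) (hu : u (ρ s) = s)
    (hd : HasDerivAt ρ (ρ s ^ (N - 1) / k (ρ s)) s) :
    HasDerivAt (fun s => k (ρ s) ^ 2) (2 * (ρ s ^ (N - 1)) ^ 2 * (s - s ^ p)) s := by
  refine (((S.hasDerivAt_flux hρ).comp s hd).fun_pow 2).congr_deriv ?_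
  have := (S.flux_pos hρ).ne'
  simp only [hu, Function.comp]
  field_simp
  push_cast
  ring

/-- The fundamental solution as a function of the level. -/
lemma hasDerivAt_inv_radius_level (S : LayerSolution N p α β η u k) {ρ : ℝ → ℝ} {s : ℝ}
    (hρ : ρ s ∈ Ioo α β) (hd : HasDerivAt ρ (ρ s ^ (N - 1) / k (ρ s)) s) :
    HasDerivAt (fun s => (ρ s ^ (N - 2))⁻¹) (-((N - 2 : ℕ) / k (ρ s))) s := by
  have h0 := S.radius_pos hρ
  refine ((hd.fun_pow (N - 2)).fun_inv (by positivity)).congr_deriv ?_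
  have := (S.flux_pos hρ).ne'
  obtain ⟨n, rfl⟩ : ∃ n, N = n + 3 := ⟨N - 3, by have := S.three_le; omega⟩
  have e1 : n + 3 - 2 = n + 1 := by omega
  have e2 : n + 3 - 1 = n + 2 := by omega
  simp only [e1, e2, Nat.add_sub_cancel]
  field_simp
  ring

/-- From a crossing, follow both solutions down to the level `s₁`: if the heights are close, the
ordering of the fluxes at the crossing persists. -/
lemma exists_flux_lt_at_level (S₁ : LayerSolution N p α β η u₁ k₁)
    (S₂ : LayerSolution N p α β η u₂ k₂) {r s₁ c h : ℝ} (hr : r ∈ Ioo α β) (he : u₁ r = u₂ r)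
    (hlt : k₂ r < k₁ r) (hs₁ : 1 - η < s₁) (hs₁r : s₁ ≤ u₂ r) (hc : 0 < c)
    (hck : ∀ x ∈ Icc α r, s₁ ≤ u₂ x → c ≤ k₂ x) (hh : u₂ r - s₁ ≤ h)
    (hh1 : N / c ^ 3 * (4 * N / c ^ N) * h ^ 2 ≤ 1 / 2) (hh2 : 4 * (N / c ^ 3) * h < c ^ N) :
    ∃ t ∈ Icc α β, u₁ t ≤ u₂ t ∧ u₂ t = s₁ ∧ k₂ t < k₁ t := by
  have hrm := Ioo_subset_Icc_self hr
  have hN := S₁.three_le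
  obtain ⟨ρ₁, hl₁, hρ₁⟩ := S₁.exists_levelRadius
  obtain ⟨ρ₂, hl₂, hρ₂⟩ := S₂.exists_levelRadius
  set b := u₂ r with hb
  have hm₁ : ∀ s ∈ Icc s₁ b, s ∈ Ioo (u₁ α) (u₁ β) := fun s hs =>
    ⟨by linarith [S₁.left_le, hs.1],
      hs.2.trans_lt (he ▸ S₁.strictMonoOn hrm S₁.right_mem hr.2)⟩
  have hm₂ : ∀ s ∈ Icc s₁ b, s ∈ Ioo (u₂ α) (u₂ β) := fun s hs =>
    ⟨by linarith [S₂.left_le, hs.1], hs.2.trans_lt (S₂.strictMonoOn hrm S₂.right_mem hr.2)⟩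
  have hc1 : c ≤ 1 := (hck r ⟨hr.1.le, le_rfl⟩ hs₁r).trans (S₂.flux_le_one hrm)
  have hV₂ : ∀ s ∈ Icc s₁ b, c ≤ k₂ (ρ₂ s) := by
    intro s hs
    obtain ⟨h1, h2, -⟩ := hρ₂ s (hm₂ s hs)
    refine hck _ ⟨h1.1.le, ?_⟩ (h2.symm ▸ hs.1)
    by_contra hcon
    have := S₂.strictMonoOn hrm (Ioo_subset_Icc_self h1) (not_le.1 hcon)
    linarith [hs.2]
  -- In the level variable `s`, the derivative of `k²` is `2 r^(2(N-1)) (s - s^p)` and that of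
  -- `r^(2-N)` is `-(N-2) / k`. With these unknowns the differences drive each other as in
  -- `pos_of_backward_system`, and `x` vanishes at the crossing.
  set y : ℝ → ℝ := fun s => k₁ (ρ₁ s) ^ 2 - k₂ (ρ₂ s) ^ 2 with hy
  set x : ℝ → ℝ := fun s => (ρ₂ s ^ (N - 2))⁻¹ - (ρ₁ s ^ (N - 2))⁻¹ with hx
  have hV₁ : ∀ s ∈ Icc s₁ b, 0 ≤ y s → k₂ (ρ₂ s) ≤ k₁ (ρ₁ s) := by
    intro s hs hys
    exact le_of_sq_le_sq (by simp only [hy] at hys; linarith)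
      (S₁.flux_nonneg _ (Ioo_subset_Icc_self (hρ₁ s (hm₁ s hs)).1))
  have rad : ∀ {u k : ℝ → ℝ}, LayerSolution N p α β η u k → ∀ t ∈ Ioo α β, c ≤ k t → c ≤ t := by
    intro u k S t ht hkt
    refine hkt.trans ((S.flux_le_pow (Ioo_subset_Icc_self ht)).trans ?_)
    exact pow_le_of_le_one (S.radius_pos ht).le (S.radius_le_one (Ioo_subset_Icc_self ht))
      (by omega)
  have hR₂ : ∀ s ∈ Icc s₁ b, c ≤ ρ₂ s := fun s hs =>
    rad S₂ _ (hρ₂ s (hm₂ s hs)).1 (hV₂ s hs)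
  have hR₁ : ∀ s ∈ Icc s₁ b, 0 ≤ y s → c ≤ ρ₁ s := fun s hs hys =>
    rad S₁ _ (hρ₁ s (hm₁ s hs)).1 ((hV₂ s hs).trans (hV₁ s hs hys))
  have hΔ0 : ∀ s ∈ Icc s₁ b, 0 ≤ x s → ρ₂ s ≤ ρ₁ s := by
    intro s hs hxs
    have h1 := S₁.radius_pos (hρ₁ s (hm₁ s hs)).1
    have h2 := S₂.radius_pos (hρ₂ s (hm₂ s hs)).1
    have h3 : (ρ₁ s ^ (N - 2))⁻¹ ≤ (ρ₂ s ^ (N - 2))⁻¹ := by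
      simp only [hx] at hxs; linarith
    rw [inv_le_inv₀ (by positivity) (by positivity)] at h3
    exact (pow_le_pow_iff_left₀ h2.le h1.le (by omega)).1 h3
  have hΔ : ∀ s ∈ Icc s₁ b, 0 ≤ x s → c ^ N * (ρ₁ s - ρ₂ s) ≤ x s := fun s hs hxs =>
    pow_mul_sub_le_inv_sub_inv hN hc hc1 (hR₂ s hs) (hΔ0 s hs hxs)
      (S₁.radius_le_one (Ioo_subset_Icc_self (hρ₁ s (hm₁ s hs)).1))
  have hNN : ((N - 2 : ℕ) : ℝ) ≤ N := by exact_mod_cast Nat.sub_le N 2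
  have hcN : 0 < c ^ N := by positivity
  obtain ⟨r1, r2, r3⟩ := pos_of_backward_system (x := x) (y := y) (a := s₁) (b := b)
    (C := N / c ^ 3) (D := 4 * N / c ^ N) hs₁r (by positivity) (by positivity)
    (fun s hs => (S₂.hasDerivAt_inv_radius_level (hρ₂ s (hm₂ s hs)).1
      (hρ₂ s (hm₂ s hs)).2.2).fun_sub (S₁.hasDerivAt_inv_radius_level (hρ₁ s (hm₁ s hs)).1
      (hρ₁ s (hm₁ s hs)).2.2))
    (fun s hs => (S₁.hasDerivAt_flux_sq_level (hρ₁ s (hm₁ s hs)).1 (hρ₁ s (hm₁ s hs)).2.1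
      (hρ₁ s (hm₁ s hs)).2.2).fun_sub (S₂.hasDerivAt_flux_sq_level (hρ₂ s (hm₂ s hs)).1
      (hρ₂ s (hm₂ s hs)).2.1 (hρ₂ s (hm₂ s hs)).2.2))
    (fun s hs hys => by
      have h1 := hV₁ s hs hys
      have h2 := hV₂ s hs
      have hy' : y s = (k₁ (ρ₁ s) - k₂ (ρ₂ s)) * (k₁ (ρ₁ s) + k₂ (ρ₂ s)) := by
        simp only [hy]; ring
      generalize k₁ (ρ₁ s) = V₁ at *
      generalize k₂ (ρ₂ s) = V₂ at *
      have p2 : 0 < V₂ := hc.trans_le h2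
      have p1 : 0 < V₁ := p2.trans_le h1
      have e : -(((N - 2 : ℕ) : ℝ) / V₂) - -(((N - 2 : ℕ) : ℝ) / V₁) =
          -(((N - 2 : ℕ) : ℝ) * ((V₁ - V₂) / (V₁ * V₂))) := by
        field_simp; ring
      have hq : 0 ≤ (V₁ - V₂) / (V₁ * V₂) := div_nonneg (by linarith) (by positivity)
      rw [e]
      refine ⟨neg_nonpos.2 (by positivity), neg_le_neg ?_⟩
      have hq2 : (V₁ - V₂) / (V₁ * V₂) ≤ y s / c ^ 3 := by
        have h3 : c * c ≤ V₁ * V₂ := mul_le_mul (h2.trans h1) h2 hc.le p1.le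
        have h4 : (V₁ - V₂) * c ≤ y s := by
          rw [hy']; exact mul_le_mul_of_nonneg_left (by linarith) (by linarith)
        rw [div_le_div_iff₀ (by positivity) (by positivity)]
        calc (V₁ - V₂) * c ^ 3 = (V₁ - V₂) * c * (c * c) := by ring
          _ ≤ y s * (V₁ * V₂) := mul_le_mul h4 h3 (by positivity) hys
      calc ((N - 2 : ℕ) : ℝ) * ((V₁ - V₂) / (V₁ * V₂)) ≤ N * (y s / c ^ 3) :=
            mul_le_mul hNN hq2 hq (by positivity)
        _ = N / c ^ 3 * y s := by ring)
    (fun s hs hys hxs => by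
      have h0 := hΔ0 s hs hxs
      have h1 := hΔ s hs hxs
      have h2 := S₁.sub_rpow_le_one (Ioo_subset_Icc_self (hρ₁ s (hm₁ s hs)).1)
      rw [(hρ₁ s (hm₁ s hs)).2.1] at h2
      have p2 := S₂.radius_pos (hρ₂ s (hm₂ s hs)).1
      have l1 := S₁.radius_le_one (Ioo_subset_Icc_self (hρ₁ s (hm₁ s hs)).1)
      have h3 := pow_sub_pow_le_mul_sub (N - 1) p2.le h0 l1
      have hN1 : ((N - 1 : ℕ) : ℝ) ≤ N := by exact_mod_cast Nat.sub_le N 1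
      generalize ρ₁ s = R₁ at *
      generalize ρ₂ s = R₂ at *
      have p1 : 0 < R₁ := p2.trans_le h0
      have h4 : R₂ ^ (N - 1) ≤ R₁ ^ (N - 1) := by gcongr
      have h5 : R₁ ^ (N - 1) ≤ 1 := pow_le_one₀ p1.le l1
      have p3 : 0 < R₂ ^ (N - 1) := by positivity
      have h6 : R₁ ^ (N - 1) - R₂ ^ (N - 1) ≤ N * (R₁ - R₂) :=
        h3.trans (mul_le_mul_of_nonneg_right hN1 (by linarith))
      have h7 : (R₁ ^ (N - 1)) ^ 2 - (R₂ ^ (N - 1)) ^ 2 ≤ 2 * (N * (R₁ - R₂)) := by nlinarith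
      have h8 : R₁ - R₂ ≤ x s / c ^ N := by rw [le_div_iff₀ hcN]; linarith
      calc 2 * (R₁ ^ (N - 1)) ^ 2 * (s - s ^ p) - 2 * (R₂ ^ (N - 1)) ^ 2 * (s - s ^ p)
          = 2 * ((R₁ ^ (N - 1)) ^ 2 - (R₂ ^ (N - 1)) ^ 2) * (s - s ^ p) := by ring
        _ ≤ 2 * ((R₁ ^ (N - 1)) ^ 2 - (R₂ ^ (N - 1)) ^ 2) * 1 :=
            mul_le_mul_of_nonneg_left h2 (by nlinarith)
        _ ≤ 4 * N * (R₁ - R₂) := by linarith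
        _ ≤ 4 * N * (x s / c ^ N) := by gcongr
        _ = 4 * N / c ^ N * x s := by ring)
    (by simp only [hx]; rw [← he, hl₁ r hrm, he, hl₂ r hrm, sub_self])
    (by
      simp only [hy]; rw [← he, hl₁ r hrm, he, hl₂ r hrm]
      have := S₂.flux_nonneg r hrm
      nlinarith)
    (by
      refine le_trans ?_ hh1
      have : 0 ≤ b - s₁ := by linarith
      gcongr)
  have hsm : s₁ ∈ Icc s₁ b := ⟨le_rfl, hs₁r⟩
  obtain ⟨m1, e1, -⟩ := hρ₁ s₁ (hm₁ s₁ hsm)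
  obtain ⟨m2, e2, -⟩ := hρ₂ s₁ (hm₂ s₁ hsm)
  have h0 := hΔ0 s₁ hsm r2
  have h1 := hΔ s₁ hsm r2
  have m1' := Ioo_subset_Icc_self m1
  have m2' := Ioo_subset_Icc_self m2
  refine ⟨ρ₂ s₁, m2', ?_, e2, ?_⟩
  · rw [e2]; exact (S₁.monotoneOn m2' m1' h0).trans e1.le
  · have h2 := S₁.flux_sub_le_sub m2' m1' h0
    have l1 := S₁.flux_le_one m1'
    have l2 := S₂.flux_le_one m2'
    have h3 := hV₁ s₁ hsm r1.le
    have hlt' : k₂ (ρ₂ s₁) < k₁ (ρ₁ s₁) := by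
      refine h3.lt_of_ne fun e => ?_
      simp only [hy, e, sub_self, lt_self_iff_false] at r1
    have h4 : y s₁ ≤ 2 * (k₁ (ρ₁ s₁) - k₂ (ρ₂ s₁)) := by simp only [hy]; nlinarith
    have h5 : c ^ N * (ρ₁ s₁ - ρ₂ s₁) < c ^ N * (k₁ (ρ₁ s₁) - k₂ (ρ₂ s₁)) := by
      calc c ^ N * (ρ₁ s₁ - ρ₂ s₁) ≤ 2 * (N / c ^ 3) * (b - s₁) * y s₁ := h1.trans r3
        _ ≤ 2 * (N / c ^ 3) * h * (2 * (k₁ (ρ₁ s₁) - k₂ (ρ₂ s₁))) := by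
            have : 0 ≤ b - s₁ := by linarith
            have : 0 ≤ h := by linarith
            gcongr
        _ = 4 * (N / c ^ 3) * h * (k₁ (ρ₁ s₁) - k₂ (ρ₂ s₁)) := by ring
        _ < c ^ N * (k₁ (ρ₁ s₁) - k₂ (ρ₂ s₁)) := mul_lt_mul_of_pos_right hh2 (by linarith)
    have h6 := lt_of_mul_lt_mul_left h5 hcN.le
    linarith

end LayerSolution

lemma tendsto_mul_rpow_of_lt_one {b : ℝ} (hb : 0 < b) (hb1 : b < 1) :
    Tendsto (fun x : ℝ => x * b ^ x) atTop (𝓝 0) := by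
  have h := tendsto_rpow_mul_exp_neg_mul_atTop_nhds_zero 1 (-Real.log b)
    (neg_pos.2 (Real.log_neg hb hb1))
  refine h.congr fun x => ?_
  rw [Real.rpow_one, neg_neg, ← Real.rpow_def_of_pos hb]

/-- For large exponents there is at most one increasing solution with a given margin. -/
theorem eventually_layerSolution_unique {N : ℕ} {η : ℝ} (hη : 0 < η) :
    ∀ᶠ p : ℝ in atTop, ∀ {α β : ℝ} {u₁ k₁ u₂ k₂ : ℝ → ℝ}, LayerSolution N p α β η u₁ k₁ →
      LayerSolution N p α β η u₂ k₂ → EqOn u₁ u₂ (Icc α β) := by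
  set v := η ^ N with hv
  have hv0 : 0 < v := by positivity
  set c := min (v / 2) (LayerSolution.fluxConst N η) with hc
  have hc0 : 0 < c := lt_min (by positivity) (LayerSolution.fluxConst_pos N hη)
  -- `ε < η` puts the level `1 - ε` in the range of both profiles, and `ε ≤ 3 v² / 8` gives `v² - 2ε
  -- ≥ (v/2)²` for the squared flux below the level `1`. The last two conditions are the smallness
  -- required over a level interval of length `2ε`.
  obtain ⟨ε, hε0, hε⟩ : ∃ ε : ℝ, 0 < ε ∧ (ε < η ∧ ε < 1 ∧ ε ≤ 3 * v ^ 2 / 8 ∧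
      N / c ^ 3 * (4 * N / c ^ N) * (2 * ε) ^ 2 ≤ 1 / 2 ∧ 4 * (N / c ^ 3) * (2 * ε) < c ^ N) := by
    have hcN : 0 < c ^ N := by positivity
    have t1 : Tendsto (fun ε : ℝ => N / c ^ 3 * (4 * N / c ^ N) * (2 * ε) ^ 2) (𝓝[>] 0) (𝓝 0) := by
      have : Continuous fun ε : ℝ => N / c ^ 3 * (4 * N / c ^ N) * (2 * ε) ^ 2 := by fun_prop
      simpa using (this.tendsto 0).mono_left nhdsWithin_le_nhds
    have t2 : Tendsto (fun ε : ℝ => 4 * (N / c ^ 3) * (2 * ε)) (𝓝[>] 0) (𝓝 0) := by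
      have : Continuous fun ε : ℝ => 4 * (N / c ^ 3) * (2 * ε) := by fun_prop
      simpa using (this.tendsto 0).mono_left nhdsWithin_le_nhds
    have t3 : Tendsto (fun ε : ℝ => ε) (𝓝[>] 0) (𝓝 0) := nhdsWithin_le_nhds
    exact ((eventually_mem_nhdsWithin (a := (0 : ℝ)) (s := Ioi 0)).and ((t3.eventually (gt_mem_nhds hη)).and
      ((t3.eventually (gt_mem_nhds one_pos)).and
      ((t3.eventually (ge_mem_nhds (by positivity))).and ((t1.eventually
        (ge_mem_nhds (by norm_num))).and (t2.eventually (gt_mem_nhds hcN))))))).exists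
  obtain ⟨hεη, hε1, hεv, hh1, hh2⟩ := hε
  have hE := LayerSolution.energyConst_pos N η
  have T1 := tendsto_mul_rpow_of_lt_one (b := 1 - ε) (by linarith) (by linarith)
  have T2 := (tendsto_mul_rpow_of_lt_one (b := (1 + ε)⁻¹) (by positivity)
    (inv_lt_one_of_one_lt₀ (by linarith))).comp (tendsto_atTop_add_const_right atTop 1 tendsto_id)
  filter_upwards [T1.eventually (ge_mem_nhds (by linarith : 0 < 1 - ε)),
    T2.eventually (gt_mem_nhds (by positivity : 0 < (LayerSolution.energyConst N η)⁻¹)),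
    eventually_ge_atTop (32 / v ^ 2)] with p hp1 hp2 hp3
  have key : ∀ {α β : ℝ} {u₁ k₁ u₂ k₂ : ℝ → ℝ}, LayerSolution N p α β η u₁ k₁ →
      LayerSolution N p α β η u₂ k₂ → u₁ β ≤ u₂ β := by
    intro α β u₁ k₁ u₂ k₂ S₁ S₂
    by_contra hcon
    have hp := S₁.one_lt_exponent
    obtain ⟨r, hr, he, hk, hlt⟩ := S₁.exists_crossing S₂ (not_le.1 hcon)
    have hrm := Ioo_subset_Icc_self hr
    -- This is where `t - t^p` becomes increasing on `[0, 1 - ε]`.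
    have hs : p * (1 - ε) ^ (p - 1) ≤ 1 := by
      rw [Real.rpow_sub_one (by linarith), mul_div_assoc', div_le_one (by linarith)]
      exact hp1
    -- `(1 + ε)^(p+1)` eventually exceeds the linear upper bound on `u₂(β)^(p+1)`.
    have hM : u₂ β < 1 + ε := by
      have h1 := S₂.energy_upper
      simp only [Function.comp, id] at hp2
      rw [Real.inv_rpow (by linarith), ← div_eq_mul_inv, div_lt_iff₀ (by positivity),
        ← div_eq_inv_mul, lt_div_iff₀ hE] at hp2
      by_contra hcon
      have := Real.rpow_le_rpow (by linarith) (not_lt.1 hcon) (by linarith : 0 ≤ p + 1)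
      linarith
    by_cases hlev : u₂ r ≤ 1 - ε
    · exact absurd (S₁.flux_le_of_le S₂ hrm hs he.le hlev) (not_le.2 hk)
    · have hrβ := S₂.monotoneOn hrm S₂.right_mem hr.2.le
      have hpv : 32 ≤ p * v ^ 2 := by rwa [div_le_iff₀ (by positivity)] at hp3
      obtain ⟨t, ht, t1, t2, t3⟩ := S₁.exists_flux_lt_at_level S₂ (s₁ := 1 - ε) (c := c)
        (h := 2 * ε) hr he hk (by linarith) (by linarith) hc0 (fun x hx hux => by
          have hx' : x ∈ Icc α β := ⟨hx.1, hx.2.trans hr.2.le⟩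
          rcases le_total (u₂ x) 1 with h1 | h1
          · refine (min_le_left _ _).trans ?_
            have h2 := S₂.flux_sq_ge hx' h1
            refine le_of_sq_le_sq ?_ (S₂.flux_nonneg x hx')
            rw [← hv] at h2
            nlinarith
          · refine (min_le_right _ _).trans ?_
            have h2 := h1.trans (S₂.monotoneOn hx' hrm hx.2)
            exact (S₁.fluxConst_le S₂ hr he hlt h2 hpv).trans
              (S₂.flux_antitoneOn hx' h1 ⟨le_rfl, hx'.2⟩ ⟨hx.2, hr.2.le⟩ hx.2))
        (by linarith) hh1 hh2
      exact absurd (S₁.flux_le_of_le S₂ ht hs t1 t2.le) (not_le.2 t3)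
  intro α β u₁ k₁ u₂ k₂ S₁ S₂
  exact S₁.eqOn_of_right_eq S₂ (le_antisymm (key S₁ S₂) (key S₂ S₁))

/-! ### Minimizers lie below `1` at the inner boundary -/

section Margin

variable {N : ℕ} {α β : ℝ}

/-- There is a profile in the cone with maximum `1` and smaller energy than the constant `1`. -/
lemma exists_test_profile (hN : 3 ≤ N) (hα : 0 ≤ α) (hαβ : α < β) (hβ : β ≤ 1) :
    ∃ ψ : ℝ → ℝ, MemCone N α β ψ ∧ ψ β = 1 ∧
      h1NormSq (shell N α β) (radial N ψ) < volume.real (shell N α β) := by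
  set Ω := shell N α β with hΩ
  set V := volume.real Ω with hV
  set w : ℝ → ℝ := fun r => β ^ 2 - r ^ 2 with hw
  have hwc : ContinuousOn w (Icc α β) := by fun_prop
  have hw0 : ∀ r ∈ Icc α β, 0 ≤ w r := fun r hr => by
    have := hr.2; have := hα.trans hr.1
    simp only [hw]; nlinarith
  have hw1 : ∀ r ∈ Icc α β, w r ≤ 1 := fun r hr => by
    have := hr.2; have := hα.trans hr.1
    simp only [hw]; nlinarith
  have hiw : Integrable (fun x : Space N => w ‖x‖) (volume.restrict Ω) :=
    integrable_radial (N := N) hwc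
  set A := ∫ x in Ω, w ‖x‖ with hA
  have hconst : ∀ c : ℝ, ∫ _ in Ω, c = c * V := fun c => by
    rw [setIntegral_const, smul_eq_mul, mul_comm]
  have hApos : 0 < A := by
    refine (setIntegral_nonneg measurableSet_shell fun x hx => hw0 _ (norm_mem_Icc hx)).lt_of_ne
      fun h0 => ?_
    have h1 := (setIntegral_eq_zero_iff_of_nonneg_ae (ae_restrict_of_forall_mem
      measurableSet_shell fun x hx => hw0 _ (norm_mem_Icc hx)) hiw).1 h0.symm
    have h2 := eqOn_Icc_of_ae_eq (v := fun _ => 0) hN hα hαβ hwc continuousOn_const h1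
      ⟨le_rfl, hαβ.le⟩
    simp only [hw] at h2
    nlinarith
  have hAV : A ≤ V := by
    have := setIntegral_mono_on hiw (integrable_const (1 : ℝ)) measurableSet_shell
      fun x hx => hw1 _ (norm_mem_Icc hx)
    rwa [hconst, one_mul] at this
  have hVpos : 0 < V := hApos.trans_le hAV
  -- The energy density of `1 - ε w` is at most `1 - 2 ε w + 5 ε²`: one `ε²` comes from `w²` and
  -- four from the gradient. This `ε` makes `5 ε² V = ε A`, half of the gain `2 ε A`.
  set ε := A / (5 * V) with hε
  have hε0 : 0 < ε := by positivity
  have hε1 : ε ≤ 1 := by rw [hε, div_le_one (by positivity)]; linarith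
  set ψ : ℝ → ℝ := fun r => 1 - ε * w r with hψ
  have hψc : ContinuousOn ψ (Icc α β) := continuousOn_const.sub (continuousOn_const.mul hwc)
  have hgrad : IsWeakGradient Ω (radial N ψ) fun x => (2 * ε) • x := by
    refine isWeakGradient_of_hasFDerivAt isOpen_shell (by fun_prop)
      (memLp_of_bound (C := 2 * ε) (by fun_prop) (fun x hx => ?_) 2) fun x _ => ?_
    · rw [norm_smul, Real.norm_of_nonneg (by positivity)]
      have := (norm_mem_Icc hx).2.trans hβ
      nlinarith
    · have h1 := ((hasStrictFDerivAt_norm_sq x).hasFDerivAt.const_sub (β ^ 2)).const_mul ε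
      refine (h1.const_sub 1).congr_fderiv ?_
      ext y
      simp
      ring
  refine ⟨ψ, ⟨hψc, ⟨memLp_radial hψc 2, _, hgrad⟩, fun r hr => ?_, fun r hr s hs hrs => ?_⟩,
    by simp [hψ, hw], ?_⟩
  · have := hw0 r hr; have := hw1 r hr
    simp only [hψ]; nlinarith
  · have := hα.trans hr.1
    have h1 : w s ≤ w r := by simp only [hw]; nlinarith
    have := mul_le_mul_of_nonneg_left h1 hε0.le
    simp only [hψ]; linarith
  · rw [h1NormSq_eq isOpen_shell hgrad]
    have hint : ∫ x in Ω, (‖(2 * ε) • x‖ ^ 2 + radial N ψ x ^ 2) ≤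
        ∫ x in Ω, ((1 + 5 * ε ^ 2) - 2 * ε * w ‖x‖) := by
      refine setIntegral_mono_on ?_ ((integrable_const _).sub (hiw.const_mul _))
        measurableSet_shell fun x hx => ?_
      · exact hgrad.memLp.norm.integrable_sq.add (memLp_radial hψc 2).integrable_sq
      · have h0 := hw0 _ (norm_mem_Icc hx)
        have h1 := hw1 _ (norm_mem_Icc hx)
        have h2 : ‖x‖ ^ 2 ≤ 1 := pow_le_one₀ (norm_nonneg x) ((norm_mem_Icc hx).2.trans hβ)
        rw [norm_smul, mul_pow, Real.norm_eq_abs, sq_abs]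
        simp only [radial, hψ]
        have h3 : w ‖x‖ ^ 2 ≤ 1 := pow_le_one₀ h0 h1
        nlinarith [mul_le_mul_of_nonneg_left h2 (sq_nonneg ε),
          mul_le_mul_of_nonneg_left h3 (sq_nonneg ε)]
    refine hint.trans_lt ?_
    rw [integral_sub (integrable_const _) (hiw.const_mul _), integral_const_mul, hconst, ← hA]
    have : 5 * ε * V = A := by rw [hε]; field_simp
    nlinarith [mul_pos hε0 hApos]

/-- For large exponents a minimizing solution is bounded away from `1` at the inner boundary. -/
theorem exists_margin (hN : 3 ≤ N) (hα : 0 ≤ α) (hαβ : α < β) (hβ : β ≤ 1) :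
    ∃ η : ℝ, 0 < η ∧ ∀ᶠ p : ℝ in atTop, ∀ u k : ℝ → ℝ,
      RadialNeumann N α β (fun r => u r ^ p) u k → (∀ r ∈ Icc α β, 0 ≤ k r) →
      MemCone N α β u → 0 < u β →
      (∀ v, MemCone N α β v → 0 < v β → Q N p α β u ≤ Q N p α β v) → u α ≤ 1 - η := by
  obtain ⟨ψ, hψ, hψβ, hlt⟩ := exists_test_profile hN hα hαβ hβ
  set Ω := shell N α β with hΩ
  set V := volume.real Ω with hV
  set A := h1NormSq Ω (radial N ψ) with hA
  have hA0 : 0 ≤ A := integral_nonneg fun x => by positivity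
  have hV0 : 0 < V := hA0.trans_lt hlt
  have hβm : β ∈ Icc α β := ⟨hαβ.le, le_rfl⟩
  have hαm : α ∈ Icc α β := ⟨le_rfl, hαβ.le⟩
  have hψ1 : ∀ r ∈ Icc α β, ψ r ≤ 1 := fun r hr => hψβ ▸ hψ.monotoneOn hr hβm hr.2
  obtain ⟨δ, hδ0, hδ1, hδ⟩ : ∃ δ : ℝ, 0 < δ ∧ δ < 1 ∧ A / (1 - δ) ^ 2 < V := by
    have t : Tendsto (fun δ : ℝ => A / (1 - δ) ^ 2) (𝓝[>] 0) (𝓝 (A / (1 - 0) ^ 2)) := by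
      refine Tendsto.mono_left ?_ nhdsWithin_le_nhds
      exact tendsto_const_nhds.div ((tendsto_const_nhds.sub tendsto_id).pow 2) (by norm_num)
    have t3 : Tendsto (fun δ : ℝ => δ) (𝓝[>] 0) (𝓝 0) := nhdsWithin_le_nhds
    exact ((eventually_mem_nhdsWithin (a := (0 : ℝ)) (s := Ioi 0)).and
      ((t3.eventually (gt_mem_nhds one_pos)).and
        (t.eventually (gt_mem_nhds (by simpa using hlt))))).exists
  -- `ψ^(p+1) ≥ (1 - δ)^(p+1) max(0, ψ - (1 - δ))`, so `‖ψ‖_{p+1} ≥ (1 - δ) m^(1/(p+1))`, a bound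
  -- that tends to `1 - δ` as `p → ∞`.
  set m := ∫ x in Ω, max 0 (ψ ‖x‖ - (1 - δ)) with hm
  have hcut : ContinuousOn (fun r => max 0 (ψ r - (1 - δ))) (Icc α β) :=
    continuousOn_const.sup (hψ.continuousOn.sub continuousOn_const)
  have hm0 : 0 < m := integral_radial_pos (v := fun r => max 0 (ψ r - (1 - δ))) hN hα hαβ hcut
    (fun r _ => le_max_left _ _) (by simp [hψβ, hδ0])
  obtain ⟨L, hL1, hL2⟩ := exists_between hδ
  have hL0 : 0 < L := (by positivity : 0 ≤ A / (1 - δ) ^ 2).trans_lt hL1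
  -- For large `p` a minimizing solution has energy below `L < V`, whereas its energy is at least
  -- `u(α)² V`; hence `u(α) ≤ √(L / V)`.
  set η := 1 - √(L / V) with hη
  refine ⟨η, ?_, ?_⟩
  · rw [hη, sub_pos, Real.sqrt_lt' one_pos, one_pow, div_lt_one hV0]; exact hL2
  have hlim : Tendsto (fun p : ℝ => (A / ((1 - δ) * m ^ (1 / (p + 1))) ^ 2) ^ ((p + 1) / (p - 1)))
      atTop (𝓝 ((A / ((1 - δ) * m ^ (0 : ℝ)) ^ 2) ^ (1 : ℝ))) := by
    have e1 : Tendsto (fun p : ℝ => 1 / (p + 1)) atTop (𝓝 0) :=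
      tendsto_const_nhds.div_atTop (tendsto_atTop_add_const_right _ _ tendsto_id)
    have e2 : Tendsto (fun p : ℝ => (p + 1) / (p - 1)) atTop (𝓝 1) := by
      have h : Tendsto (fun p : ℝ => 1 + 2 / (p - 1)) atTop (𝓝 (1 + 0)) :=
        tendsto_const_nhds.add (tendsto_const_nhds.div_atTop
          (tendsto_atTop_add_const_right _ (-1) tendsto_id))
      rw [add_zero] at h
      refine h.congr' ?_
      filter_upwards [eventually_gt_atTop 1] with p hp
      have : p - 1 ≠ 0 := by linarith
      field_simp; ring
    refine Tendsto.rpow (tendsto_const_nhds.div ((tendsto_const_nhds.mul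
      (tendsto_const_nhds.rpow e1 (Or.inl hm0.ne'))).pow 2) ?_) e2 (Or.inr one_pos)
    have : 0 < 1 - δ := by linarith
    rw [Real.rpow_zero]; positivity
  rw [Real.rpow_zero, mul_one, Real.rpow_one] at hlim
  filter_upwards [hlim.eventually (gt_mem_nhds hL1), eventually_gt_atTop 1] with p hpL hp
  intro u k h hk hu huβ hmin
  have hp1 : 0 < p + 1 := by linarith
  set E := ∫ x in Ω, u ‖x‖ ^ (p + 1) with hE
  have hEpos : 0 < E := integral_radial_pos (v := fun r => u r ^ (p + 1)) hN hα hαβ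
    (rpow_continuousOn (by linarith) hu.continuousOn)
    (fun r hr => Real.rpow_nonneg (hu.nonneg r hr) _) (Real.rpow_pos_of_pos huβ _)
  have hEeq : h1NormSq Ω (radial N u) = E := by
    rw [h.h1NormSq_eq hN hα hαβ hk]
    refine setIntegral_congr_fun measurableSet_shell fun x hx => ?_
    exact (Real.rpow_add_one' (hu.nonneg _ (norm_mem_Icc hx)) (by linarith)).symm
  -- For a solution the energy equals `E = ∫ u^(p+1)`, so the quotient is `E^(1 - 2/(p+1))` and
  -- comparison with `ψ` bounds `E` itself.
  have hQu : Q N p α β u = E ^ ((p - 1) / (p + 1)) := by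
    rw [Q, hEeq, lqNorm_eq hu.nonneg, ← Real.rpow_natCast, ← Real.rpow_mul hEpos.le]
    nth_rewrite 1 [← Real.rpow_one E]
    rw [← Real.rpow_sub hEpos]
    congr 1
    push_cast
    field_simp
    ring
  have hQψ : Q N p α β ψ ≤ A / ((1 - δ) * m ^ (1 / (p + 1))) ^ 2 := by
    have hδ' : 0 < 1 - δ := by linarith
    rw [Q, lqNorm_eq hψ.nonneg]
    have hle : (1 - δ) ^ (p + 1) * m ≤ ∫ x in Ω, ψ ‖x‖ ^ (p + 1) := by
      rw [hm, ← integral_const_mul]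
      refine setIntegral_mono_on ((integrable_radial (N := N) hcut).const_mul _)
        (integrable_radial (N := N) (rpow_continuousOn hp1.le hψ.continuousOn))
        measurableSet_shell fun x hx => ?_
      have h0 := hψ.nonneg _ (norm_mem_Icc hx)
      have h1 := hψ1 _ (norm_mem_Icc hx)
      rcases le_total (ψ ‖x‖) (1 - δ) with hc | hc
      · rw [max_eq_left (by linarith), mul_zero]; exact Real.rpow_nonneg h0 _
      · rw [max_eq_right (by linarith)]
        have h2 := Real.rpow_le_rpow hδ'.le hc hp1.le
        have h3 := Real.rpow_nonneg hδ'.le (p + 1)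
        nlinarith
    have hle2 := Real.rpow_le_rpow (by positivity) hle (by positivity : 0 ≤ 1 / (p + 1))
    rw [Real.mul_rpow (by positivity) hm0.le, ← Real.rpow_mul hδ'.le,
      mul_one_div_cancel hp1.ne', Real.rpow_one] at hle2
    have : 0 < m ^ (1 / (p + 1)) := by positivity
    gcongr
  have hEL : E < L := by
    have h1 := (hmin ψ hψ (by rw [hψβ]; exact one_pos)).trans hQψ
    rw [hQu] at h1
    have hp1' : 0 < p - 1 := by linarith
    have h2 := Real.rpow_le_rpow (by positivity) h1
      (by positivity : 0 ≤ (p + 1) / (p - 1))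
    rw [← Real.rpow_mul hEpos.le, div_mul_div_cancel₀' hp1'.ne', div_self hp1.ne',
      Real.rpow_one] at h2
    exact h2.trans_lt hpL
  have huα : u α ^ 2 * V ≤ E := by
    rw [← hEeq, h1NormSq_eq isOpen_shell hu.isWeakGradient]
    have : ∫ _ in Ω, u α ^ 2 = u α ^ 2 * V := by
      rw [setIntegral_const, smul_eq_mul, mul_comm]
    rw [← this]
    refine setIntegral_mono_on (integrable_const _) (hu.isWeakGradient.memLp.norm.integrable_sq.add
      (memLp_radial hu.continuousOn 2).integrable_sq) measurableSet_shell fun x hx => ?_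
    have h1 := hu.monotoneOn hαm (norm_mem_Icc hx) (norm_mem_Icc hx).1
    have h2 := hu.nonneg α hαm
    have h3 : u α ^ 2 ≤ radial N u x ^ 2 := by simp only [radial]; gcongr
    have h4 := sq_nonneg ‖weakGradient (shell N α β) (radial N u) x‖
    linarith
  rw [hη, sub_sub_cancel]
  refine Real.le_sqrt_of_sq_le ?_
  rw [le_div_iff₀ hV0]
  linarith

end Margin

/-! ### Competitors and solutions -/

section Assembly

variable {N : ℕ} {p α β : ℝ} {u k v w : ℝ → ℝ}

/-- Truncating `w` at its essential supremum changes it only on a null set, hence nowhere on `[α,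
β]` by continuity; so `w(β)` does not exceed the essential supremum. -/
lemma MemCone.eLpNorm_top (hN : 3 ≤ N) (hα : 0 ≤ α) (hαβ : α < β) (hw : MemCone N α β w) :
    eLpNorm (radial N w) ⊤ (volume.restrict (shell N α β)) = ENNReal.ofReal (w β) := by
  have hβm : β ∈ Icc α β := ⟨hαβ.le, le_rfl⟩
  have hle : eLpNorm (radial N w) ⊤ (volume.restrict (shell N α β)) ≤ ENNReal.ofReal (w β) := by
    rw [eLpNorm_exponent_top]
    refine eLpNormEssSup_le_of_ae_bound
      (ae_restrict_of_forall_mem measurableSet_shell fun x hx => ?_)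
    have hx' := norm_mem_Icc hx
    rw [radial, Real.norm_of_nonneg (hw.nonneg _ hx')]
    exact hw.monotoneOn hx' hβm hx'.2
  refine le_antisymm hle ?_
  have hfin : eLpNorm (radial N w) ⊤ (volume.restrict (shell N α β)) ≠ ⊤ :=
    (hle.trans_lt ENNReal.ofReal_lt_top).ne
  set c := (eLpNorm (radial N w) ⊤ (volume.restrict (shell N α β))).toReal with hc
  have hae : ∀ᵐ x ∂(volume.restrict (shell N α β)),
      radial N w x = radial N (fun r => min (w r) c) x := by
    have h1 := enorm_ae_le_eLpNormEssSup (radial N w) (volume.restrict (shell N α β))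
    filter_upwards [h1] with x hx
    rw [← eLpNorm_exponent_top] at hx
    have h2 : ‖radial N w x‖ ≤ c := by
      have := ENNReal.toReal_mono hfin hx
      rwa [toReal_enorm] at this
    exact (min_eq_left ((le_abs_self _).trans h2)).symm
  have h3 := eqOn_Icc_of_ae_eq hN hα hαβ hw.continuousOn
    (hw.continuousOn.inf continuousOn_const) hae hβm
  have h4 : w β ≤ c := min_eq_left_iff.1 h3.symm
  calc ENNReal.ofReal (w β) ≤ ENNReal.ofReal c := ENNReal.ofReal_le_ofReal h4
    _ = _ := ENNReal.ofReal_toReal hfin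

lemma admissible_iff (hN : 3 ≤ N) (hα : 0 ≤ α) (hαβ : α < β) :
    Admissible N α β w ↔ MemCone N α β w ∧ 0 < w β ∧ w β < √(Real.exp 1) + 1 := by
  have hβm : β ∈ Icc α β := ⟨hαβ.le, le_rfl⟩
  have hpos : 0 < √(Real.exp 1) + 1 := by positivity
  constructor
  · rintro ⟨h1, h2, h3⟩
    rw [h1.eLpNorm_top hN hα hαβ, ENNReal.ofReal_lt_ofReal_iff hpos] at h3
    exact ⟨h1, h1.pos_right hαβ h2, h3⟩
  · rintro ⟨h1, h2, h3⟩
    exact ⟨h1, ⟨β, hβm, h2.ne'⟩, by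
      rwa [h1.eLpNorm_top hN hα hαβ, ENNReal.ofReal_lt_ofReal_iff hpos]⟩

/-- `u` minimizes the quotient among the nonzero elements of the cone. -/
structure IsConeMinimizer (N : ℕ) (p α β : ℝ) (u : ℝ → ℝ) : Prop where
  memCone : MemCone N α β u
  pos_right : 0 < u β
  le : ∀ v, MemCone N α β v → 0 < v β → Q N p α β u ≤ Q N p α β v

lemma IsConeMinimizer.of_eqOn_mul (hαβ : α < β) (hp : 1 < p) (hv : IsConeMinimizer N p α β v)
    (hu : MemCone N α β u) {t : ℝ} (ht : 0 < t) (h : EqOn v (fun r => t * u r) (Icc α β)) :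
    IsConeMinimizer N p α β u where
  memCone := hu
  pos_right := by
    have h1 : v β = t * u β := h ⟨hαβ.le, le_rfl⟩
    have h2 := hv.pos_right
    rw [h1] at h2
    exact (pos_iff_pos_of_mul_pos h2).1 ht
  le w hw hwβ := by
    rw [← Q_const_mul hp hu ht, ← Q_congr h hv.memCone]
    exact hv.le w hw hwβ

/-- Every nonzero element of the cone has an admissible multiple, for instance the one with maximum
`1 < √e + 1`, so the sup-norm constraint does not change the infimum. -/
lemma IsConeMinimizer.cPlus_eq (hN : 3 ≤ N) (hα : 0 ≤ α) (hαβ : α < β) (hp : 1 < p)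
    (hu : IsConeMinimizer N p α β u) : cPlus N p α β = Q N p α β u := by
  have hpos := hu.pos_right
  refine IsLeast.csInf_eq ⟨⟨fun r => (u β)⁻¹ * u r, ?_, ?_⟩, ?_⟩
  · refine (admissible_iff hN hα hαβ).2 ⟨hu.memCone.const_mul (by positivity), by positivity, ?_⟩
    rw [inv_mul_cancel₀ hpos.ne']
    have : 0 < √(Real.exp 1) := by positivity
    linarith
  · exact Q_const_mul hp hu.memCone (by positivity)
  · rintro _ ⟨v, hv, rfl⟩
    obtain ⟨h1, h2, -⟩ := (admissible_iff hN hα hαβ).1 hv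
    exact hu.le v h1 h2

lemma IsConeMinimizer.achieves_iff (hN : 3 ≤ N) (hα : 0 ≤ α) (hαβ : α < β) (hp : 1 < p)
    (hu : IsConeMinimizer N p α β u) : Achieves N p α β w ↔
      IsConeMinimizer N p α β w ∧ w β < √(Real.exp 1) + 1 := by
  rw [Achieves, admissible_iff hN hα hαβ, hu.cPlus_eq hN hα hαβ hp]
  constructor
  · rintro ⟨⟨h1, h2, h3⟩, h4⟩
    exact ⟨⟨h1, h2, fun v hv hvβ => h4 ▸ hu.le v hv hvβ⟩, h3⟩
  · rintro ⟨h1, h2⟩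
    exact ⟨⟨h1.memCone, h1.pos_right, h2⟩, le_antisymm (h1.le u hu.memCone hu.pos_right)
      (hu.le w h1.memCone h1.pos_right)⟩

lemma RadialNeumann.isNeumannSolution (h : RadialNeumann N α β (fun r => u r ^ p) u k)
    (hN : 3 ≤ N) (hα : 0 ≤ α) (hαβ : α < β) : IsNeumannSolution N p α β u where
  contDiffOn_profile := h.contDiffOn_profile hN hα hαβ
  contDiffOn := h.contDiffOn_radial hN hα hαβ
  equation x hx := by
    rw [h.laplacian_radial hN hα hx]
    simp only [radial]; ring
  neumann_left := h.derivWithin_left hαβ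
  neumann_right := h.derivWithin_right hαβ

/-- A positive multiple of a positive solution is a solution only if it is the solution itself. -/
lemma RadialNeumann.eq_one_of_eqOn_mul (h : RadialNeumann N α β (fun r => u r ^ p) u k)
    (hN : 3 ≤ N) (hα : 0 ≤ α) (hαβ : α < β) (hp : 1 < p) (hpos : ∀ r ∈ Icc α β, 0 < u r)
    (hv : IsNeumannSolution N p α β v) {c : ℝ} (hc : 0 < c)
    (he : EqOn v (fun r => c * u r) (Icc α β)) : c = 1 := by
  obtain ⟨r, hr1, hr2⟩ := exists_between hαβ
  obtain ⟨x, hx⟩ := exists_norm_eq hN (hα.trans hr1.le)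
  have hxs : x ∈ shell N α β := mem_shell (hx ▸ hr1) (hx ▸ hr2)
  have hrm : r ∈ Icc α β := ⟨hr1.le, hr2.le⟩
  have hur := hpos r hrm
  have hev : radial N v =ᶠ[𝓝 x] radial N fun r => c * u r := by
    filter_upwards [isOpen_shell.mem_nhds hxs] with y hy using he (norm_mem_Icc hy)
  have h1 := hv.equation x hxs
  rw [(InnerProductSpace.laplacian_congr_nhds hev).self_of_nhds, hev.self_of_nhds,
    (h.const_mul c).laplacian_radial hN hα hxs] at h1
  simp only [radial, hx] at h1
  rw [Real.mul_rpow hc.le hur.le] at h1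
  have h2 : c * u r ^ p = c ^ p * u r ^ p := by linarith
  have h3 := mul_right_cancel₀ (Real.rpow_pos_of_pos hur p).ne' h2
  rcases lt_trichotomy c 1 with h4 | h4 | h4
  · exact absurd h3.symm (rpow_lt_self_of_lt_one hp hc h4).ne
  · exact h4
  · have : c < c ^ p := by simpa using Real.rpow_lt_rpow_of_exponent_lt h4 hp
    exact absurd h3 this.ne

end Assembly

end NeumannLayer

end

/-! ### The main theorem -/

open NeumannLayer in
theorem mainTheorem5 (N : ℕ) (hN : 3 ≤ N) (α β : ℝ) (hα : 0 ≤ α) (hαβ : α < β) (hβ : β ≤ 1) :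
    ∃ p₀ : ℝ, 1 < p₀ ∧ ∀ p : ℝ, p₀ < p →
      ∃ u : ℝ → ℝ,
        NeumannLayer.IsUPlus N p α β u ∧
        StrictMonoOn u (Set.Icc α β) ∧
        (∀ v : ℝ → ℝ, NeumannLayer.IsUPlus N p α β v → Set.EqOn v u (Set.Icc α β)) ∧
        ∀ w : ℝ → ℝ, NeumannLayer.Achieves N p α β w ↔
          ∃ t : ℝ, 0 < t ∧ t * u β < √(Real.exp 1) + 1 ∧
            Set.EqOn w (fun r => t * u r) (Set.Icc α β) := by
  obtain ⟨η, hη, hmargin⟩ := exists_margin hN hα hαβ hβ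
  obtain ⟨p₁, hp₁⟩ := Filter.eventually_atTop.1
    (hmargin.and (eventually_layerSolution_unique (N := N) hη))
  refine ⟨max p₁ 2, lt_max_of_lt_right (by norm_num), fun p hp₀ => ?_⟩
  have hp : 1 < p := by linarith [le_max_right p₁ 2]
  obtain ⟨hmarg, huniq⟩ := hp₁ p ((le_max_left p₁ 2).trans hp₀.le)
  have hβm : β ∈ Icc α β := ⟨hαβ.le, le_rfl⟩
  -- Every minimizer is a multiple of an increasing solution with the same margin `η`, the setting
  -- in which uniqueness holds.
  have solve : ∀ w, IsConeMinimizer N p α β w → ∃ u k, LayerSolution N p α β η u k ∧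
      IsConeMinimizer N p α β u ∧ ∃ t, 0 < t ∧ EqOn w (fun r => t * u r) (Icc α β) := by
    intro w hw
    obtain ⟨u, k, h, hu, huβ, t, ht, he⟩ :=
      solution_of_minimizer hN hα hαβ hβ hp hw.memCone hw.pos_right hw.le
    have hmin := hw.of_eqOn_mul hαβ hp hu ht he
    have hk := h.flux_nonneg hα fun r hr s hs hrs =>
      Real.rpow_le_rpow (hu.nonneg r hr) (hu.monotoneOn hr hs hrs) (by linarith)
    exact ⟨u, k, ⟨hN, hα, hαβ, hβ, hp, hη, h, hk, hu.nonneg, huβ, hmarg u k h hk hu huβ hmin.le⟩,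
      hmin, t, ht, he⟩
  obtain ⟨v₀, hv₀, hv₀β, hv₀min⟩ := exists_minimizer hN hα hαβ hβ hp
  obtain ⟨u, k, S, hu, -⟩ := solve v₀ ⟨hv₀, hv₀β, hv₀min⟩
  have huβ := hu.pos_right
  have multiples : ∀ w, Achieves N p α β w ↔ ∃ t : ℝ, 0 < t ∧ t * u β < √(Real.exp 1) + 1 ∧
      EqOn w (fun r => t * u r) (Icc α β) := by
    intro w
    rw [hu.achieves_iff hN hα hαβ hp]
    constructor
    · rintro ⟨hw, hwβ⟩
      -- The solution generated by any other minimizer coincides with `u`, so all minimizers lie on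
      -- one ray.
      obtain ⟨u', k', S', -, t, ht, he⟩ := solve w hw
      have he' : EqOn w (fun r => t * u r) (Icc α β) := fun r hr => by
        rw [he hr]; simp only [huniq S' S hr]
      exact ⟨t, ht, by rwa [he' hβm] at hwβ, he'⟩
    · rintro ⟨t, ht, htβ, he⟩
      have hwcone : MemCone N α β w := (hu.memCone.const_mul ht.le).congr he.symm
      have hinv : EqOn u (fun r => t⁻¹ * w r) (Icc α β) := fun r hr => by
        simp only [he hr]; field_simp
      exact ⟨hu.of_eqOn_mul hαβ hp hwcone (inv_pos.2 ht) hinv, by rw [he hβm]; exact htβ⟩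
  refine ⟨u, ⟨hu.memCone, S.radialNeumann.isNeumannSolution hN hα hαβ, (u β)⁻¹, inv_pos.2 huβ,
    (multiples _).2 ⟨(u β)⁻¹, inv_pos.2 huβ, ?_, fun r _ => rfl⟩⟩, S.strictMonoOn, ?_, multiples⟩
  · rw [inv_mul_cancel₀ huβ.ne']
    have : 0 < √(Real.exp 1) := by positivity
    linarith
  · rintro v ⟨-, hvs, s, hs, hach⟩
    obtain ⟨t, ht, -, he⟩ := (multiples _).1 hach
    -- A competing solution lies on the ray of `u`; the nonlinearity, not being homogeneous of
    -- degree one, then fixes the factor to be `1`.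
    have he' : EqOn v (fun r => t / s * u r) (Icc α β) := fun r hr => by
      have h1 : s * v r = t * u r := he hr
      simp only
      field_simp
      linarith
    have hc := S.radialNeumann.eq_one_of_eqOn_mul hN hα hαβ hp (fun r hr => S.pos hr) hvs
      (div_pos ht hs) he'
    intro r hr
    rw [he' hr]
    simp only [hc, one_mul]
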